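/- Conventions. For $m\ge 1$ and $z\in\mathbb C^m$ let $\|z\|=(|z_1|^2+\dots+|z_m|^2)^{1/2}$, and for $r>0$ let $\eta_m$ be the normalized (total mass $1$) rotation-invariant measure on the sphere $S_m(r)=\{\|z\|=r\}$. A meromorphic function $f$ on $\mathbb C^m$ is given (as is always possible on $\mathbb C^m$) by a reduced representation $[f_0,f_1]$: $f_0\not\equiv 0$ and $f_1$ are entire functions on $\mathbb C^m$ whose only common factors in the ring of entire functions are units, and $f=f_1/f_0$. Its characteristic function is $$T_f(r)=\int_{S_m(r)}\log\big(|f_0|^2+|f_1|^2\big)^{1/2}\,\eta_m-\int_{S_m(1)}\log\big(|f_0|^2+|f_1|^2\big)^{1/2}\,\eta_m\qquad(r>1),$$ which does not depend on the choice of the reduced representation, and its hyperorder is $$\zeta_2(f)=\limsup_{r\to\infty}\frac{\log^+\log^+T_f(r)}{\log r}.$$ Lemma (difference analogue of the lemma on the logarithmic derivative in several variables). Let $f$ be a nonconstant meromorphic function on $\mathbb C^m$ such that $f(0)\ne 0,\infty$, let $c\in\mathbb C^m$ and let $\varepsilon>0$. If $\zeta:=\zeta_2(f)<1$, then $\log^+|f(z+c)/f(z)|$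 is integrable over $S_m(r)$ for every $r>0$, and there is a set $E\subset[1,\infty)$ of finite logarithmic measure $\int_E\frac{dt}{t}<\infty$ such that $$m\Big(r,\frac{f(z+c)}{f(z)}\Big):=\int_{S_m(r)}\log^+\left|\frac{f(z+c)}{f(z)}\right|\eta_m(z)=o\left(\frac{T_f(r)}{r^{1-\zeta-\varepsilon}}\right)\qquad(r\to\infty,\ r\notin E).$$ -/

import Mathlib

open MeasureTheory Filter Set Real

/-- `ℂ^m` with its Hermitian norm `‖z‖ = (|z₁|² + ⋯ + |z_m|²)^{1/2}`. -/
abbrev CSpace (m : ℕ) : Type := EuclideanSpace ℂ (Fin m)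

/-- The rotation invariant probability measure `η_m` on the spheres `S_m(r)`, carried to the unit
sphere by `ξ ↦ r ξ`: it is the normalized surface measure. -/
noncomputable def unitSphereMeasure (m : ℕ) : Measure (Metric.sphere (0 : CSpace m) 1) :=
  ((volume : Measure (CSpace m)).toSphere univ)⁻¹ • (volume : Measure (CSpace m)).toSphere

/-- `u` is integrable over the sphere `S_m(r)` with respect to `η_m`. -/
def SphereIntegrable {m : ℕ} (u : CSpace m → ℝ) (r : ℝ) : Prop :=
  Integrable (fun ξ : Metric.sphere (0 : CSpace m) 1 => u (r • (ξ : CSpace m)))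
    (unitSphereMeasure m)

/-- The integral `∫_{S_m(r)} u η_m`. -/
noncomputable def sphereIntegral {m : ℕ} (u : CSpace m → ℝ) (r : ℝ) : ℝ :=
  ∫ ξ : Metric.sphere (0 : CSpace m) 1, u (r • (ξ : CSpace m)) ∂(unitSphereMeasure m)

/-- `[f₀, f₁]` is a reduced representation of the meromorphic function `f = f₁ / f₀` on `ℂ^m`:
`f₀ ≢ 0` and `f₁` are entire, and their only common factors in the ring of entire functions are
units (that is, nowhere vanishing). The values of `f` on the thin set `f₀ = 0` are immaterial. -/
structure IsReducedRepresentation {m : ℕ} (f₀ f₁ f : CSpace m → ℂ) : Prop where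
  entire_den : Differentiable ℂ f₀
  entire_num : Differentiable ℂ f₁
  den_ne_zero : ∃ z, f₀ z ≠ 0
  reduced : ∀ g a b : CSpace m → ℂ, Differentiable ℂ g → Differentiable ℂ a → Differentiable ℂ b →
    (∀ z, f₀ z = g z * a z) → (∀ z, f₁ z = g z * b z) → ∀ z, g z ≠ 0
  eq_div : ∀ z, f₀ z ≠ 0 → f z = f₁ z / f₀ z

/-- The characteristic function
`T_f(r) = ∫_{S_m(r)} log ‖(f₀, f₁)‖ η_m - ∫_{S_m(1)} log ‖(f₀, f₁)‖ η_m` of the meromorphic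
function with reduced representation `[f₀, f₁]`, where `‖(f₀, f₁)‖ = (|f₀|² + |f₁|²)^{1/2}`. -/
noncomputable def characteristicFn {m : ℕ} (f₀ f₁ : CSpace m → ℂ) (r : ℝ) : ℝ :=
  sphereIntegral (fun z => log (√(‖f₀ z‖ ^ 2 + ‖f₁ z‖ ^ 2))) r -
    sphereIntegral (fun z => log (√(‖f₀ z‖ ^ 2 + ‖f₁ z‖ ^ 2))) 1

/-- The hyperorder `limsup_{r → ∞} log⁺ log⁺ T_f(r) / log r`, with values in `[-∞, ∞]`. -/
noncomputable def hyperOrder {m : ℕ} (f₀ f₁ : CSpace m → ℂ) : EReal :=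
  limsup (fun r : ℝ => ((posLog (posLog (characteristicFn f₀ f₁ r)) / log r : ℝ) : EReal)) atTop

/-- The proximity function `m(r, φ) = ∫_{S_m(r)} log⁺ |φ| η_m`. -/
noncomputable def proximityFn {m : ℕ} (φ : CSpace m → ℂ) (r : ℝ) : ℝ :=
  sphereIntegral (fun z => posLog ‖φ z‖) r

/-- `E ⊆ [1, ∞)` has finite logarithmic measure `∫_E dt / t < ∞`. -/
def FiniteLogMeasure (E : Set ℝ) : Prop :=
  MeasurableSet E ∧ E ⊆ Ici 1 ∧ ∫⁻ t in E, ENNReal.ofReal (1 / t) < ⊤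

/-!
Write `f = f₁ / f₀` and `g = log ‖f₁‖ - log ‖f₀‖` (`logQuot`). Since `log⁺ |f(z + c) / f(z)|` is at
most `|g(z + c) - g(z)|` almost everywhere on every sphere, it suffices to bound the spherical means
`D(r)` of this difference (`sphereDiff`). Let `B(r)` be the spherical mean of `log max (‖f₀‖, ‖f₁‖)`
(`maxMean`); it is increasing and differs from `T_f(r)` by a bounded amount.

*One variable.* For entire functions `φ₀`, `φ₁` of one variable, the `L¹` norm of the increment of
`log ‖φ₁ / φ₀‖` under a translation by `s ≤ 1` is `O(s)` times the `L¹` norm of `log ‖φ₁ / φ₀‖` on a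
larger disc plus the Jensen defects of `φ₀` and `φ₁`, which bound their numbers of zeros
(`exists_lintegral_abs_log_quotient_translate_le`). Indeed, the zeros in a disc contribute
logarithmic kernels, and the rest is harmonic.

*Several variables.* A translation by `c` is compared with the average over all translations `v` of
comparable length, and `v = s y` with `‖y‖ < τ` is a translation by `s` on the slice `w ↦ z + w y`.
Averaging the one-variable estimate over all base points `z` in a shell `a ≤ ‖z‖ ≤ b` and over all
directions `y` produces only rotation invariant averages of `|g|`, `log ‖f₀‖` and `log ‖f₁‖`, which
Jensen's formula on complex lines bounds by `B` at a slightly larger radius. The gain is the factor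
`s`, comparable to `‖c‖ / τ` (`exists_lintegral_shell_diff_le`). In polar coordinates, with `τ`
proportional to `b - a`, this says that the integral of `D` over `[a, b]` is at most a constant
times `B(2 b - a)`, uniformly in `a ≤ b ≤ 2 a` as long as `a` and `b - a` are large
(`exists_lintegral_sphereDiff_le`).

*Growth.* Let `ζ < γ < 1` and cut the half-line at the points `k ^ (1 / γ)`; the interval with
number `k` has logarithmic length of order `1 / k`. Where `B` grows by a bounded factor over two
consecutive intervals, Chebyshev's inequality shows that `D(r) ≤ B(r) r ^ (-δ)`, for a given
`δ < 1 - γ`, fails only on a set whose logarithmic measure is summable over `k`. Elsewhere `log B`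
increases by at least `1`, and as `log B(k ^ (1 / γ))` is `O(k ^ θ)` with `θ < 1`, summation by
parts shows that the logarithmic lengths of these intervals have a finite sum as well
(`exists_finiteLogMeasure_of_lintegral_le`).
-/

/-! ### Circle averages of `log ‖φ‖` for entire functions of one variable -/

theorem Entire.analyticOnNhd_entire {φ : ℂ → ℂ} (hφ : Differentiable ℂ φ) (s : Set ℂ) :
    AnalyticOnNhd ℂ φ s := fun z _ => hφ.analyticAt z

theorem Entire.meromorphic_entire {φ : ℂ → ℂ} (hφ : Differentiable ℂ φ) :
    Meromorphic φ := fun z => (hφ.analyticAt z).meromorphicAt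

theorem Entire.eventually_ne_zero_codiscrete {φ : ℂ → ℂ} (hφ : Differentiable ℂ φ)
    {x : ℂ} (hx : φ x ≠ 0) : ∀ᶠ z in codiscrete ℂ, φ z ≠ 0 :=
  (Entire.analyticOnNhd_entire hφ univ).preimage_zero_mem_codiscrete hx

theorem Entire.circleIntegrable_log_norm {φ : ℂ → ℂ} (hφ : Differentiable ℂ φ) (R : ℝ) :
    CircleIntegrable (fun z => log ‖φ z‖) 0 R :=
  MeromorphicOn.circleIntegrable_log_norm fun z _ => Entire.meromorphic_entire hφ z

theorem Entire.circleAverage_log_norm_mono {φ : ℂ → ℂ} (hφ : Differentiable ℂ φ)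
    {r R : ℝ} (hr : 0 < r) (hrR : r ≤ R) :
    circleAverage (fun z => log ‖φ z‖) 0 r ≤ circleAverage (fun z => log ‖φ z‖) 0 R := by
  have hR : 0 < R := hr.trans_le hrR
  have h1 := Function.locallyFinsuppWithin.logCounting_divisor_eq_circleAverage_sub_const
    (Entire.meromorphic_entire hφ) hr.ne'
  have h2 := Function.locallyFinsuppWithin.logCounting_divisor_eq_circleAverage_sub_const
    (Entire.meromorphic_entire hφ) hR.ne'
  have h3 := Function.locallyFinsuppWithin.logCounting_mono
    (MeromorphicOn.AnalyticOnNhd.divisor_nonneg (Entire.analyticOnNhd_entire hφ univ)) hr hR hrR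
  linarith

theorem Entire.log_norm_le_circleAverage {φ : ℂ → ℂ} (hφ : Differentiable ℂ φ)
    (h0 : φ 0 ≠ 0) {R : ℝ} (hR : 0 < R) :
    log ‖φ 0‖ ≤ circleAverage (fun z => log ‖φ z‖) 0 R := by
  have h := AnalyticOnNhd.circleAverage_log_norm hR.ne' (Entire.analyticOnNhd_entire hφ _) h0
  rw [h]
  have hnn : 0 ≤ ∑ᶠ u, (MeromorphicOn.divisor φ (Metric.closedBall 0 |R|) u : ℝ) *
      log (R * ‖(0 : ℂ) - u‖⁻¹) := by
    refine finsum_nonneg fun u => ?_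
    by_cases hu : u ∈ Metric.closedBall (0 : ℂ) |R|
    · refine mul_nonneg (mod_cast MeromorphicOn.AnalyticOnNhd.divisor_nonneg
        (Entire.analyticOnNhd_entire hφ _) u) ?_
      rcases eq_or_ne u 0 with rfl | hu0
      · simp
      · refine log_nonneg ?_
        rw [zero_sub, norm_neg, ← div_eq_mul_inv, one_le_div (norm_pos_iff.2 hu0)]
        simpa [abs_of_pos hR] using hu
    · simp [hu]
  linarith

/-- Multiplicativity: the zeros of either factor meet the circle in a finite set, so that
`log ‖φ ψ‖ = log ‖φ‖ + log ‖ψ‖` fails only there. -/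
theorem Entire.circleAverage_log_norm_mul {φ ψ : ℂ → ℂ} (hφ : Differentiable ℂ φ)
    (hψ : Differentiable ℂ ψ) {x y : ℂ} (hx : φ x ≠ 0) (hy : ψ y ≠ 0) {R : ℝ} (hR : 0 < R) :
    circleAverage (fun z => log ‖φ z * ψ z‖) 0 R =
      circleAverage (fun z => log ‖φ z‖) 0 R + circleAverage (fun z => log ‖ψ z‖) 0 R := by
  rw [← circleAverage_fun_add (Entire.circleIntegrable_log_norm hφ R)
    (Entire.circleIntegrable_log_norm hψ R)]
  refine circleAverage_congr_codiscreteWithin (codiscreteWithin_mono (subset_univ _) ?_) hR.ne'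
  filter_upwards [Entire.eventually_ne_zero_codiscrete hφ hx,
    Entire.eventually_ne_zero_codiscrete hψ hy]
    with z h1 h2
  rw [norm_mul, log_mul (norm_ne_zero_iff.2 h1) (norm_ne_zero_iff.2 h2)]

theorem Entire.exists_eq_mul_of_eq_zero {φ : ℂ → ℂ} (hφ : Differentiable ℂ φ) {b : ℂ}
    (hb : φ b = 0) : ∃ ψ : ℂ → ℂ, Differentiable ℂ ψ ∧ ∀ w, φ w = (w - b) * ψ w := by
  refine ⟨dslope φ b, ?_, fun w => ?_⟩
  · have h := (Complex.differentiableOn_dslope (f := φ) (s := univ) (c := b) univ_mem).2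
      hφ.differentiableOn
    exact differentiableOn_univ.1 h
  · have h := sub_smul_dslope φ b w
    rw [hb, sub_zero, smul_eq_mul] at h
    exact h.symm

/-- If `φ` vanishes at the centre, dividing by `w` shows that circle averages grow at least like
`log R`. -/
theorem Entire.circleAverage_log_norm_add_log_le {φ : ℂ → ℂ} (hφ : Differentiable ℂ φ)
    (h0 : φ 0 = 0) {x : ℂ} (hx : φ x ≠ 0) {r R : ℝ} (hr : 0 < r) (hrR : r ≤ R) :
    circleAverage (fun z => log ‖φ z‖) 0 r + log (R / r) ≤
      circleAverage (fun z => log ‖φ z‖) 0 R := by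
  have hR : 0 < R := hr.trans_le hrR
  obtain ⟨ψ, hψ, hφψ⟩ := Entire.exists_eq_mul_of_eq_zero hφ h0
  have hid : Differentiable ℂ fun w : ℂ => w - 0 := by fun_prop
  have hψx : ψ x ≠ 0 := fun h => hx (by rw [hφψ, h, mul_zero])
  have key : ∀ ρ : ℝ, 0 < ρ → circleAverage (fun z => log ‖φ z‖) 0 ρ =
      log ρ + circleAverage (fun z => log ‖ψ z‖) 0 ρ := by
    intro ρ hρ
    simp_rw [hφψ]
    rw [Entire.circleAverage_log_norm_mul hid hψ (x := 1) (by simp) hψx hρ,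
      circleAverage_log_norm_sub_const_of_mem_closedBall (by simp)]
  rw [key r hr, key R hR, log_div hR.ne' hr.ne']
  linarith [Entire.circleAverage_log_norm_mono hψ hr hrR]

/-! ### Removing the zeros in a disc -/

/-- Each zero in the disc of radius `4` contributes at least `log 3 ≥ 1` to Jensen's formula on the
circle of radius `12`. -/
theorem card_add_log_norm_le_circleAverage (s : Multiset ℂ) :
    ∀ ψ : ℂ → ℂ, Differentiable ℂ ψ → ψ 0 ≠ 0 → (∀ b ∈ s, b ≠ 0 ∧ ‖b‖ ≤ 4) →
      (s.card : ℝ) + log ‖(s.map fun b => (0 : ℂ) - b).prod * ψ 0‖ ≤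
        circleAverage (fun w => log ‖(s.map fun b => w - b).prod * ψ w‖) 0 12 := by
  induction s using Multiset.induction with
  | empty =>
    intro ψ hψ h0 _
    simpa using Entire.log_norm_le_circleAverage hψ h0 (by norm_num : (0 : ℝ) < 12)
  | cons a s ih =>
    intro ψ hψ h0 hs
    obtain ⟨ha0, ha4⟩ := hs a (Multiset.mem_cons_self a s)
    have hs' : ∀ b ∈ s, b ≠ 0 ∧ ‖b‖ ≤ 4 := fun b hb => hs b (Multiset.mem_cons_of_mem hb)
    have hQ : Differentiable ℂ fun w => (s.map fun b => w - b).prod * ψ w := by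
      refine Differentiable.mul ?_ hψ
      clear ih hs hs'
      induction s using Multiset.induction with
      | empty => simp
      | cons b s ih2 =>
        simp only [Multiset.map_cons, Multiset.prod_cons]
        exact (by fun_prop : Differentiable ℂ fun w : ℂ => w - b).mul ih2
    have hQ0 : (s.map fun b => (0 : ℂ) - b).prod * ψ 0 ≠ 0 := by
      refine mul_ne_zero ?_ h0
      refine Multiset.prod_ne_zero fun h => ?_
      obtain ⟨b, hb, hb0⟩ := Multiset.mem_map.1 h
      exact (hs' b hb).1 (by simpa using hb0)
    have hlin : Differentiable ℂ fun w : ℂ => w - a := by fun_prop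
    simp only [Multiset.map_cons, Multiset.prod_cons, mul_assoc, Multiset.card_cons]
    rw [Entire.circleAverage_log_norm_mul hlin hQ (x := 0) (by simpa using ha0) hQ0 (by norm_num),
      circleAverage_log_norm_sub_const_of_mem_closedBall
        (by simp only [Metric.mem_closedBall, dist_zero_right]; rw [abs_of_pos] <;> linarith),
      norm_mul, log_mul (by simpa using ha0) (norm_ne_zero_iff.2 hQ0)]
    have h1 := ih ψ hψ h0 hs'
    have h2 : log ‖(0 : ℂ) - a‖ ≤ log 4 := by
      rw [zero_sub, norm_neg]; exact log_le_log (norm_pos_iff.2 ha0) ha4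
    have h3 : log 12 = log 3 + log 4 := by
      rw [← log_mul (by norm_num) (by norm_num)]; norm_num
    have h4 : 1 ≤ log 3 := by
      rw [le_log_iff_exp_le (by norm_num)]
      linarith [exp_one_lt_d9]
    push_cast
    linarith

/-- An entire function with `φ 0 ≠ 0` is a product of linear factors with zeros in the closed disc
of radius `4` and an entire function without zeros there; the number of factors is bounded by
Jensen's formula. -/
theorem exists_zero_factorization {φ : ℂ → ℂ} (hφ : Differentiable ℂ φ) (h0 : φ 0 ≠ 0) :
    ∃ (s : Multiset ℂ) (ψ : ℂ → ℂ), Differentiable ℂ ψ ∧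
      (∀ w ∈ Metric.closedBall (0 : ℂ) 4, ψ w ≠ 0) ∧ (∀ b ∈ s, ‖b‖ ≤ 4) ∧
      (∀ w, φ w = (s.map fun b => w - b).prod * ψ w) ∧
      (s.card : ℝ) ≤ circleAverage (fun w => log ‖φ w‖) 0 12 - log ‖φ 0‖ := by
  have bound : ∀ (s : Multiset ℂ) (ψ : ℂ → ℂ), Differentiable ℂ ψ → (∀ b ∈ s, ‖b‖ ≤ 4) →
      (∀ w, φ w = (s.map fun b => w - b).prod * ψ w) →
      (s.card : ℝ) ≤ circleAverage (fun w => log ‖φ w‖) 0 12 - log ‖φ 0‖ := by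
    intro s ψ hψ hs hprod
    have hψ0 : ψ 0 ≠ 0 := fun h => h0 (by rw [hprod, h, mul_zero])
    have hs0 : ∀ b ∈ s, b ≠ 0 ∧ ‖b‖ ≤ 4 := by
      refine fun b hb => ⟨?_, hs b hb⟩
      rintro rfl
      refine h0 ?_
      rw [hprod, Multiset.prod_eq_zero, zero_mul]
      exact Multiset.mem_map.2 ⟨0, hb, by simp⟩
    have h := card_add_log_norm_le_circleAverage s ψ hψ hψ0 hs0
    simp_rw [← hprod] at h
    linarith
  by_contra hcon
  push Not at hcon
  -- Without such a factorization, zeros could be split off forever, against the bound.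
  have all : ∀ n : ℕ, ∃ (s : Multiset ℂ) (ψ : ℂ → ℂ), Differentiable ℂ ψ ∧ (∀ b ∈ s, ‖b‖ ≤ 4) ∧
      (∀ w, φ w = (s.map fun b => w - b).prod * ψ w) ∧ s.card = n := by
    intro n
    induction n with
    | zero => exact ⟨0, φ, hφ, by simp, by simp, by simp⟩
    | succ n ih =>
      obtain ⟨s, ψ, hψ, hs, hprod, hn⟩ := ih
      have : ∃ b ∈ Metric.closedBall (0 : ℂ) 4, ψ b = 0 := by
        by_contra hno
        push Not at hno
        exact absurd (bound s ψ hψ hs hprod) (not_le.2 (hcon s ψ hψ hno hs hprod))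
      obtain ⟨b, hb, hb0⟩ := this
      obtain ⟨χ, hχ, hψχ⟩ := Entire.exists_eq_mul_of_eq_zero hψ hb0
      refine ⟨b ::ₘ s, χ, hχ, ?_, ?_, by simp [hn]⟩
      · intro a ha
        rcases Multiset.mem_cons.1 ha with rfl | ha
        · simpa using hb
        · exact hs a ha
      · intro w
        rw [hprod, hψχ, Multiset.map_cons, Multiset.prod_cons]
        ring
  obtain ⟨n, hn⟩ := exists_nat_gt (circleAverage (fun w => log ‖φ w‖) 0 12 - log ‖φ 0‖)
  obtain ⟨s, ψ, hψ, hs, hprod, hsn⟩ := all n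
  have := bound s ψ hψ hs hprod
  rw [hsn] at this
  linarith

theorem log_norm_multiset_prod_mul {s : Multiset ℂ} {w c : ℂ}
    (h : (s.map fun b => w - b).prod * c ≠ 0) :
    log ‖(s.map fun b => w - b).prod * c‖ = (s.map fun b => log ‖w - b‖).sum + log ‖c‖ := by
  induction s using Multiset.induction with
  | empty => simp
  | cons a s ih =>
    simp only [Multiset.map_cons, Multiset.prod_cons, Multiset.sum_cons, mul_assoc] at h ⊢
    rw [norm_mul, log_mul (norm_ne_zero_iff.2 (left_ne_zero_of_mul h))
      (norm_ne_zero_iff.2 (right_ne_zero_of_mul h)), ih (right_ne_zero_of_mul h), add_assoc]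

/-! ### Translates of logarithms and of harmonic functions -/

theorem abs_log_sub_log_le {x y : ℝ} (hx : 0 < x) (hy : 0 < y) :
    |log x - log y| ≤ |x - y| * (x⁻¹ + y⁻¹) := by
  have h : ∀ a b : ℝ, 0 < a → 0 < b → log a - log b ≤ |a - b| * (a⁻¹ + b⁻¹) := by
    intro a b ha hb
    rw [← log_div ha.ne' hb.ne']
    have h1 := log_le_sub_one_of_pos (div_pos ha hb)
    have h2 : a / b - 1 = (a - b) * b⁻¹ := by field_simp
    have h3 : (a - b) * b⁻¹ ≤ |a - b| * b⁻¹ := by gcongr; exact le_abs_self _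
    have h4 : 0 ≤ |a - b| * a⁻¹ := by positivity
    linarith
  rw [abs_le]
  have h1 := h x y hx hy
  have h2 := h y x hy hx
  rw [abs_sub_comm y x, add_comm y⁻¹] at h2
  exact ⟨by linarith, h1⟩

theorem abs_log_le_add_inv {x : ℝ} (hx : 0 < x) : |log x| ≤ x + x⁻¹ := by
  have h1 := log_le_sub_one_of_pos hx
  have h2 := log_le_sub_one_of_pos (inv_pos.2 hx)
  rw [log_inv] at h2
  have h3 := inv_pos.2 hx
  rw [abs_le]; constructor <;> linarith

/-- The kernel `‖w - b‖⁻¹` is integrable over discs in the plane, uniformly in the pole `b`. -/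
theorem exists_lintegral_inv_norm_sub_le :
    ∃ K : ℝ, 0 < K ∧ ∀ b : ℂ, ∫⁻ w in Metric.ball (0 : ℂ) 4, ENNReal.ofReal ‖w - b‖⁻¹ ≤
      ENNReal.ofReal K := by
  have hfin : ∫⁻ w in Metric.ball (0 : ℂ) 1, ENNReal.ofReal ‖w‖⁻¹ < ⊤ := by
    have hint : IntegrableOn (fun w : ℂ => ‖w‖⁻¹) (Metric.ball 0 1) volume := by
      refine (integrableOn_fun_norm_addHaar volume (f := fun y : ℝ => y⁻¹)).2 ?_
      refine (integrableOn_const (C := (1 : ℝ)) (by simp)).congr_fun (fun y hy => ?_)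
        measurableSet_Ioo
      have : y ≠ 0 := hy.1.ne'
      simp [Complex.finrank_real_complex, this]
    exact hint.lintegral_lt_top
  have hK : ∀ b : ℂ, ∫⁻ w in Metric.ball (0 : ℂ) 4, ENNReal.ofReal ‖w - b‖⁻¹ ≤
      volume (Metric.ball (0 : ℂ) 4) + ∫⁻ w in Metric.ball (0 : ℂ) 1, ENNReal.ofReal ‖w‖⁻¹ := by
    intro b
    have hpt : ∀ w : ℂ, ENNReal.ofReal ‖w - b‖⁻¹ ≤
        1 + (Metric.ball (0 : ℂ) 1).indicator (fun w => ENNReal.ofReal ‖w‖⁻¹) (w - b) := by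
      intro w
      by_cases hw : w - b ∈ Metric.ball (0 : ℂ) 1
      · rw [indicator_of_mem hw]; exact le_add_self
      · refine le_add_right ?_
        rw [← ENNReal.ofReal_one]
        refine ENNReal.ofReal_le_ofReal (inv_le_one_of_one_le₀ ?_)
        simpa using hw
    calc _ ≤ ∫⁻ w in Metric.ball (0 : ℂ) 4, (1 + (Metric.ball (0 : ℂ) 1).indicator
          (fun w => ENNReal.ofReal ‖w‖⁻¹) (w - b)) := lintegral_mono hpt
      _ = volume (Metric.ball (0 : ℂ) 4) + ∫⁻ w in Metric.ball (0 : ℂ) 4,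
          (Metric.ball (0 : ℂ) 1).indicator (fun w => ENNReal.ofReal ‖w‖⁻¹) (w - b) := by
        rw [lintegral_add_left measurable_const]; simp
      _ ≤ volume (Metric.ball (0 : ℂ) 4) + ∫⁻ w : ℂ,
          (Metric.ball (0 : ℂ) 1).indicator (fun w => ENNReal.ofReal ‖w‖⁻¹) (w - b) := by
        gcongr; exact Measure.restrict_le_self
      _ = _ := by
        rw [lintegral_sub_right_eq_self (μ := (volume : Measure ℂ)) 
          (fun w : ℂ => (Metric.ball (0 : ℂ) 1).indicator (fun w => ENNReal.ofReal ‖w‖⁻¹) w) b,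
          lintegral_indicator Metric.isOpen_ball.measurableSet]
  set L := volume (Metric.ball (0 : ℂ) 4) + ∫⁻ w in Metric.ball (0 : ℂ) 1, ENNReal.ofReal ‖w‖⁻¹
  have hL : L ≠ ⊤ := ENNReal.add_ne_top.2 ⟨measure_ball_lt_top.ne, hfin.ne⟩
  refine ⟨L.toReal + 1, by positivity, fun b => (hK b).trans ?_⟩
  rw [ENNReal.ofReal_add ENNReal.toReal_nonneg zero_le_one, ENNReal.ofReal_toReal hL]
  exact le_self_add

theorem ae_ne_complex (b : ℂ) : ∀ᵐ w : ℂ, w ≠ b := by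
  rw [ae_iff]; simp

theorem lintegral_abs_log_translate_le {K : ℝ} (hK : ∀ b : ℂ,
    ∫⁻ w in Metric.ball (0 : ℂ) 4, ENNReal.ofReal ‖w - b‖⁻¹ ≤ ENNReal.ofReal K)
    {s : ℝ} (hs : 0 ≤ s) (b : ℂ) :
    ∫⁻ w in Metric.ball (0 : ℂ) 1, ENNReal.ofReal |log ‖w + s - b‖ - log ‖w - b‖| ≤
      ENNReal.ofReal s * (2 * ENNReal.ofReal K) := by
  have hsub : Metric.ball (0 : ℂ) 1 ⊆ Metric.ball 0 4 := Metric.ball_subset_ball (by norm_num)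
  calc _ ≤ ∫⁻ w in Metric.ball (0 : ℂ) 1, ENNReal.ofReal s *
        (ENNReal.ofReal ‖w - (b - s)‖⁻¹ + ENNReal.ofReal ‖w - b‖⁻¹) := by
        refine lintegral_mono_ae (ae_restrict_of_ae ?_)
        filter_upwards [ae_ne_complex b, ae_ne_complex (b - s)] with w h1 h2
        have e : w + s - b = w - (b - s) := by ring
        rw [← ENNReal.ofReal_add (by positivity) (by positivity), ← ENNReal.ofReal_mul hs, e]
        refine ENNReal.ofReal_le_ofReal ((abs_log_sub_log_le (norm_pos_iff.2 (sub_ne_zero.2 h2))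
          (norm_pos_iff.2 (sub_ne_zero.2 h1))).trans ?_)
        gcongr
        refine (abs_norm_sub_norm_le _ _).trans ?_
        have e2 : w - (b - s) - (w - b) = (s : ℂ) := by ring
        rw [e2, Complex.norm_real, norm_of_nonneg hs]
    _ = ENNReal.ofReal s * ((∫⁻ w in Metric.ball (0 : ℂ) 1, ENNReal.ofReal ‖w - (b - s)‖⁻¹) +
        ∫⁻ w in Metric.ball (0 : ℂ) 1, ENNReal.ofReal ‖w - b‖⁻¹) := by
        rw [lintegral_const_mul' _ _ ENNReal.ofReal_ne_top, lintegral_add_left (by fun_prop)]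
    _ ≤ _ := by
        rw [two_mul]
        gcongr
        · exact (lintegral_mono_set hsub).trans (hK _)
        · exact (lintegral_mono_set hsub).trans (hK _)

theorem lintegral_abs_log_le {K : ℝ} (hK : ∀ b : ℂ,
    ∫⁻ w in Metric.ball (0 : ℂ) 4, ENNReal.ofReal ‖w - b‖⁻¹ ≤ ENNReal.ofReal K)
    {b : ℂ} (hb : ‖b‖ ≤ 4) :
    ∫⁻ w in Metric.ball (0 : ℂ) 4, ENNReal.ofReal |log ‖w - b‖| ≤
      ENNReal.ofReal (8 * (16 * π)) + ENNReal.ofReal K := by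
  calc _ ≤ ∫⁻ w in Metric.ball (0 : ℂ) 4, (ENNReal.ofReal 8 + ENNReal.ofReal ‖w - b‖⁻¹) := by
        refine lintegral_mono_ae ?_
        filter_upwards [ae_restrict_of_ae (ae_ne_complex b),
          ae_restrict_mem Metric.isOpen_ball.measurableSet] with w h1 h2
        rw [← ENNReal.ofReal_add (by positivity) (by positivity)]
        refine ENNReal.ofReal_le_ofReal
          ((abs_log_le_add_inv (norm_pos_iff.2 (sub_ne_zero.2 h1))).trans ?_)
        gcongr
        have : ‖w‖ < 4 := by simpa using h2
        linarith [norm_sub_le w b]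
    _ ≤ _ := by
        rw [lintegral_add_left measurable_const]
        gcongr
        · rw [lintegral_const, Measure.restrict_apply_univ, Complex.volume_ball,
            ENNReal.ofReal_mul (by norm_num)]
          gcongr
          rw [ENNReal.ofReal_mul (by norm_num), ← ENNReal.ofReal_pow (by norm_num),
            ← NNReal.coe_real_pi, ENNReal.ofReal_coe_nnreal]
          norm_num
        · exact hK b

/-- Mean value property over discs. -/
theorem integral_ball_eq_of_harmonic {k : ℂ → ℝ} {x : ℂ}
    (hk : InnerProductSpace.HarmonicOnNhd k (Metric.closedBall x 1)) :
    ∫ w in Metric.ball x 1, k w = π * k x := by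
  have hcont : ContinuousOn k (Metric.closedBall x 1) := hk.continuousOn
  have h1 : ∫ w in Metric.ball x 1, k w =
      ∫ w : ℂ, (Metric.ball (0 : ℂ) 1).indicator (fun w => k (x + w)) w := by
    rw [← integral_indicator Metric.isOpen_ball.measurableSet,
      ← integral_add_left_eq_self (μ := (volume : Measure ℂ)) _ x]
    refine integral_congr_ae (ae_of_all _ fun w => ?_)
    simp only [indicator, Metric.mem_ball, dist_zero_right, dist_self_add_left]
  rw [h1, ← Complex.integral_comp_polarCoord_symm]
  have h2 : ∀ p ∈ polarCoord.target, p.1 • (Metric.ball (0 : ℂ) 1).indicator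
      (fun w => k (x + w)) (Complex.polarCoord.symm p) =
      (Ioo (0 : ℝ) 1 ×ˢ Ioo (-π) π).indicator (fun p => p.1 * k (circleMap x p.1 p.2)) p := by
    rintro ⟨r, θ⟩ ⟨hr, hθ⟩
    have hr' : (0 : ℝ) < r := hr
    have e : circleMap x r θ = x + Complex.polarCoord.symm (r, θ) := by
      rw [Complex.polarCoord_symm_apply, circleMap, Complex.exp_mul_I]
      simp
    have en : ‖Complex.polarCoord.symm (r, θ)‖ = r := by
      rw [Complex.norm_polarCoord_symm, abs_of_pos hr']
    by_cases hr1 : r < 1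
    · rw [indicator_of_mem (by rwa [mem_ball_zero_iff, en]),
        indicator_of_mem (show (r, θ) ∈ Ioo (0 : ℝ) 1 ×ˢ Ioo (-π) π from ⟨⟨hr', hr1⟩, hθ⟩), e]
      rfl
    · rw [indicator_of_notMem (by rwa [mem_ball_zero_iff, en]),
        indicator_of_notMem (fun h => hr1 h.1.2), smul_zero]
  rw [setIntegral_congr_fun polarCoord.open_target.measurableSet h2,
    setIntegral_indicator (measurableSet_Ioo.prod measurableSet_Ioo)]
  have h3 : polarCoord.target ∩ Ioo (0 : ℝ) 1 ×ˢ Ioo (-π) π = Ioo (0 : ℝ) 1 ×ˢ Ioo (-π) π := by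
    refine inter_eq_right.2 ?_
    rintro ⟨r, θ⟩ ⟨hr, hθ⟩
    exact ⟨hr.1, hθ⟩
  have hint : IntegrableOn (fun p : ℝ × ℝ => p.1 * k (circleMap x p.1 p.2))
      (Ioo (0 : ℝ) 1 ×ˢ Ioo (-π) π) (volume.prod volume) := by
    have hc : ContinuousOn (fun p : ℝ × ℝ => p.1 * k (circleMap x p.1 p.2))
        (Icc (0 : ℝ) 1 ×ˢ Icc (-π) π) := by
      refine continuousOn_fst.mul (hcont.comp (by unfold circleMap; fun_prop) ?_)
      rintro ⟨r, θ⟩ ⟨hr, _⟩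
      simp [circleMap, abs_of_nonneg hr.1, hr.2]
    exact (hc.integrableOn_compact (isCompact_Icc.prod isCompact_Icc)).mono_set
      (prod_mono Ioo_subset_Icc_self Ioo_subset_Icc_self)
  rw [h3, Measure.volume_eq_prod, setIntegral_prod _ hint]
  have h4 : ∀ r ∈ Ioo (0 : ℝ) 1, ∫ θ in Ioo (-π) π, r * k (circleMap x r θ) =
      r * (2 * π * k x) := by
    intro r hr
    have hmean : circleAverage k x r = k x := by
      refine InnerProductSpace.HarmonicOnNhd.circleAverage_eq (hk.mono ?_)
      rw [abs_of_pos hr.1]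
      exact Metric.closedBall_subset_closedBall hr.2.le
    rw [circleAverage_eq_integral_add (-π), intervalIntegral.integral_comp_add_right
      (fun θ => k (circleMap x r θ)), smul_eq_mul] at hmean
    have e1 : (0 : ℝ) + -π = -π := by ring
    have e2 : 2 * π + -π = π := by ring
    rw [e1, e2, intervalIntegral.integral_of_le (by linarith [pi_pos]),
      integral_Ioc_eq_integral_Ioo] at hmean
    rw [integral_const_mul, ← hmean]
    field_simp
  rw [setIntegral_congr_fun measurableSet_Ioo h4, integral_mul_const,
    ← integral_Ioc_eq_integral_Ioo, ← intervalIntegral.integral_of_le zero_le_one, integral_id]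
  ring

/-- Interior estimate for translates of a harmonic function, obtained from two applications of the
mean value property: one bounds the function, the other compares averages over overlapping discs. -/
theorem abs_harmonic_translate_sub_le {k : ℂ → ℝ}
    (hk : InnerProductSpace.HarmonicOnNhd k (Metric.closedBall 0 4)) {s : ℝ} (hs : 0 ≤ s)
    (hs1 : s ≤ 1) {w : ℂ} (hw : w ∈ Metric.ball (0 : ℂ) 1) :
    |k (w + s) - k w| ≤ 2 * s * ∫ w in Metric.ball (0 : ℂ) 4, |k w| := by
  have hcont : ContinuousOn k (Metric.closedBall 0 4) := hk.continuousOn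
  have hint4 : IntegrableOn k (Metric.ball 0 4) :=
    (hcont.integrableOn_compact (isCompact_closedBall _ _)).mono_set Metric.ball_subset_closedBall
  set I := ∫ w in Metric.ball (0 : ℂ) 4, |k w| with hI
  have hI0 : 0 ≤ I := integral_nonneg fun _ => abs_nonneg _
  have hsup : ∀ x ∈ Metric.ball (0 : ℂ) 3, π * |k x| ≤ I := by
    intro x hx
    have hx' : ‖x‖ < 3 := by simpa using hx
    have hsub : Metric.closedBall x 1 ⊆ Metric.closedBall 0 4 :=
      Metric.closedBall_subset_closedBall' (by rw [dist_zero_right]; linarith)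
    have hsub' : Metric.ball x 1 ⊆ Metric.ball 0 4 :=
      Metric.ball_subset_ball' (by rw [dist_zero_right]; linarith)
    rw [← abs_of_pos pi_pos, ← abs_mul, ← integral_ball_eq_of_harmonic (hk.mono hsub)]
    refine (abs_integral_le_integral_abs).trans ?_
    exact setIntegral_mono_set hint4.abs (ae_of_all _ fun _ => abs_nonneg _)
      (LE.le.eventuallyLE hsub')
  have hw1 : ‖w‖ < 1 := by simpa using hw
  have hws : ‖w + s‖ < 2 := by
    refine (norm_add_le _ _).trans_lt ?_
    rw [Complex.norm_real, norm_of_nonneg hs]; linarith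
  have hdist : ∀ x y : ℂ, ‖x‖ < 2 → dist y x = s →
      |∫ u in Metric.ball x 1 \ Metric.ball y 1, k u| ≤ I / π * (3 * π * s) := by
    intro x y hx hxy
    have hvol : volume (Metric.ball x 1 \ Metric.ball y 1) ≤ ENNReal.ofReal (3 * π * s) := by
      calc volume (Metric.ball x 1 \ Metric.ball y 1)
          ≤ volume (Metric.ball y (1 + s) \ Metric.ball y 1) := by
            refine measure_mono (sdiff_subset_sdiff_left (Metric.ball_subset_ball' ?_))
            rw [dist_comm, hxy]
        _ = volume (Metric.ball y (1 + s)) - volume (Metric.ball y 1) :=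
            measure_sdiff (Metric.ball_subset_ball (by linarith))
              Metric.isOpen_ball.measurableSet.nullMeasurableSet measure_ball_lt_top.ne
        _ ≤ _ := by
            have hpi : (NNReal.pi : ENNReal) = ENNReal.ofReal π := by
              rw [← NNReal.coe_real_pi, ENNReal.ofReal_coe_nnreal]
            rw [Complex.volume_ball, Complex.volume_ball, hpi, ← ENNReal.ofReal_pow (by linarith),
              ← ENNReal.ofReal_pow (by norm_num), ← ENNReal.ofReal_mul (by positivity),
              ← ENNReal.ofReal_mul (by positivity), ← ENNReal.ofReal_sub _ (by positivity)]
            refine ENNReal.ofReal_le_ofReal ?_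
            nlinarith [pi_pos, mul_nonneg hs (sub_nonneg.2 hs1),
              mul_nonneg pi_pos.le (mul_nonneg hs (sub_nonneg.2 hs1))]
    have hb : ∀ u ∈ Metric.ball x 1 \ Metric.ball y 1, ‖k u‖ ≤ I / π := by
      intro u hu
      rw [norm_eq_abs, le_div_iff₀ pi_pos, mul_comm]
      refine hsup u (Metric.ball_subset_ball' (?_ : 1 + dist x 0 ≤ 3) hu.1)
      rw [dist_zero_right]; linarith
    rw [← norm_eq_abs]
    refine (norm_setIntegral_le_of_norm_le_const (hvol.trans_lt ENNReal.ofReal_lt_top) hb).trans ?_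
    refine mul_le_mul_of_nonneg_left ?_ (by positivity)
    exact ENNReal.toReal_le_of_le_ofReal (by positivity) hvol
  have hm : ∀ x : ℂ, ‖x‖ < 2 → IntegrableOn k (Metric.ball x 1) ∧
      ∫ u in Metric.ball x 1, k u = π * k x := by
    intro x hx
    have hsub : Metric.closedBall x 1 ⊆ Metric.closedBall 0 4 :=
      Metric.closedBall_subset_closedBall' (by rw [dist_zero_right]; linarith)
    exact ⟨hint4.mono_set (Metric.ball_subset_ball' (by rw [dist_zero_right]; linarith)),
      integral_ball_eq_of_harmonic (hk.mono hsub)⟩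
  obtain ⟨i1, m1⟩ := hm (w + s) hws
  obtain ⟨i2, m2⟩ := hm w (by linarith)
  have d1 := hdist (w + s) w hws (by rw [dist_self_add_right, Complex.norm_real, norm_of_nonneg hs])
  have d2 := hdist w (w + s) (by linarith)
    (by rw [dist_self_add_left, Complex.norm_real, norm_of_nonneg hs])
  have key : π * (k (w + s) - k w) =
      (∫ u in Metric.ball (w + s) 1 \ Metric.ball w 1, k u) -
        ∫ u in Metric.ball w 1 \ Metric.ball (w + s) 1, k u := by
    rw [mul_sub, ← m1, ← m2,
      ← integral_inter_add_sdiff (Metric.isOpen_ball (x := w) (ε := 1)).measurableSet i1,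
      ← integral_inter_add_sdiff (Metric.isOpen_ball (x := w + s) (ε := 1)).measurableSet i2,
      inter_comm (Metric.ball w 1)]
    ring
  have e : I / π * (3 * π * s) = 3 * s * I := by field_simp
  rw [e] at d1 d2
  have h6 : π * |k (w + s) - k w| ≤ 6 * s * I := by
    have e3 : π * |k (w + s) - k w| = |π * (k (w + s) - k w)| := by
      rw [abs_mul, abs_of_pos pi_pos]
    rw [e3, key]
    refine (abs_sub _ _).trans ?_
    linarith
  have h7 : 3 * |k (w + s) - k w| ≤ π * |k (w + s) - k w| :=
    mul_le_mul_of_nonneg_right pi_gt_three.le (abs_nonneg _)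
  linarith

/-! ### The difference estimate on a disc -/

theorem log_norm_multiset_sum_translate_le {K : ℝ} (hK : ∀ b : ℂ,
    ∫⁻ w in Metric.ball (0 : ℂ) 4, ENNReal.ofReal ‖w - b‖⁻¹ ≤ ENNReal.ofReal K)
    {s : ℝ} (hs : 0 ≤ s) (Z : Multiset ℂ) :
    ∫⁻ w in Metric.ball (0 : ℂ) 1, ENNReal.ofReal
      |(Z.map fun b => log ‖w + s - b‖).sum - (Z.map fun b => log ‖w - b‖).sum| ≤
      Z.card * (ENNReal.ofReal s * (2 * ENNReal.ofReal K)) := by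
  induction Z using Multiset.induction with
  | empty => simp
  | cons a Z ih =>
    have hmeas : Measurable fun w : ℂ => ENNReal.ofReal |log ‖w + s - a‖ - log ‖w - a‖| := by
      fun_prop
    calc _ ≤ ∫⁻ w in Metric.ball (0 : ℂ) 1, (ENNReal.ofReal |log ‖w + s - a‖ - log ‖w - a‖| +
          ENNReal.ofReal
          |(Z.map fun b => log ‖w + s - b‖).sum - (Z.map fun b => log ‖w - b‖).sum|) := by
          refine lintegral_mono fun w => ?_
          rw [← ENNReal.ofReal_add (abs_nonneg _) (abs_nonneg _)]
          refine ENNReal.ofReal_le_ofReal ?_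
          simp only [Multiset.map_cons, Multiset.sum_cons]
          rw [add_sub_add_comm]
          exact abs_add_le _ _
      _ ≤ _ := by
          rw [lintegral_add_left hmeas, Multiset.card_cons, Nat.cast_succ, add_mul, one_mul,
            add_comm]
          exact add_le_add ih (lintegral_abs_log_translate_le hK hs a)

theorem log_norm_multiset_sum_le {K : ℝ} (hK : ∀ b : ℂ,
    ∫⁻ w in Metric.ball (0 : ℂ) 4, ENNReal.ofReal ‖w - b‖⁻¹ ≤ ENNReal.ofReal K)
    (Z : Multiset ℂ) (hZ : ∀ b ∈ Z, ‖b‖ ≤ 4) :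
    ∫⁻ w in Metric.ball (0 : ℂ) 4, ENNReal.ofReal |(Z.map fun b => log ‖w - b‖).sum| ≤
      Z.card * (ENNReal.ofReal (8 * (16 * π)) + ENNReal.ofReal K) := by
  induction Z using Multiset.induction with
  | empty => simp
  | cons a Z ih =>
    have hmeas : Measurable fun w : ℂ => ENNReal.ofReal |log ‖w - a‖| := by fun_prop
    calc _ ≤ ∫⁻ w in Metric.ball (0 : ℂ) 4, (ENNReal.ofReal |log ‖w - a‖| +
          ENNReal.ofReal |(Z.map fun b => log ‖w - b‖).sum|) := by
          refine lintegral_mono fun w => ?_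
          rw [← ENNReal.ofReal_add (abs_nonneg _) (abs_nonneg _)]
          refine ENNReal.ofReal_le_ofReal ?_
          simp only [Multiset.map_cons, Multiset.sum_cons]
          exact abs_add_le _ _
      _ ≤ _ := by
          rw [lintegral_add_left hmeas, Multiset.card_cons, Nat.cast_succ, add_mul, one_mul,
            add_comm]
          exact add_le_add (ih fun b hb => hZ b (Multiset.mem_cons_of_mem hb))
            (lintegral_abs_log_le hK (hZ a (Multiset.mem_cons_self a Z)))

theorem Entire.ae_ne_zero {φ : ℂ → ℂ} (hφ : Differentiable ℂ φ) {x : ℂ} (hx : φ x ≠ 0) :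
    ∀ᵐ w : ℂ, φ w ≠ 0 := by
  have h := Entire.eventually_ne_zero_codiscrete hφ hx
  have h2 := ae_restrict_le_codiscreteWithin (μ := (volume : Measure ℂ)) MeasurableSet.univ h
  rwa [Measure.restrict_univ] at h2

theorem harmonicOnNhd_log_norm {ψ : ℂ → ℂ} (hψ : Differentiable ℂ ψ) {s : Set ℂ}
    (h : ∀ w ∈ s, ψ w ≠ 0) : InnerProductSpace.HarmonicOnNhd (fun w => log ‖ψ w‖) s :=
  fun w hw => (hψ.analyticAt w).harmonicAt_log_norm (h w hw)

/-- The one-variable core. On a disc, the quotient `φ₁ / φ₀` is a finite Blaschke-like product times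
a function without zeros or poles: the logarithms of the linear factors are translated at cost
`O(s)` each, their number is controlled by Jensen's formula, and the remaining harmonic function
obeys an interior estimate. -/
theorem exists_lintegral_abs_log_quotient_translate_le :
    ∃ C : ℝ, 0 < C ∧ ∀ φ₀ φ₁ : ℂ → ℂ, Differentiable ℂ φ₀ → Differentiable ℂ φ₁ →
      φ₀ 0 ≠ 0 → φ₁ 0 ≠ 0 → ∀ s : ℝ, 0 ≤ s → s ≤ 1 →
      ∫⁻ w in Metric.ball (0 : ℂ) 1, ENNReal.ofReal
        |(log ‖φ₁ (w + s)‖ - log ‖φ₀ (w + s)‖) - (log ‖φ₁ w‖ - log ‖φ₀ w‖)| ≤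
      ENNReal.ofReal (C * s) *
        ((∫⁻ w in Metric.ball (0 : ℂ) 4, ENNReal.ofReal |log ‖φ₁ w‖ - log ‖φ₀ w‖|) +
          ENNReal.ofReal (circleAverage (fun w => log ‖φ₀ w‖) 0 12 - log ‖φ₀ 0‖) +
          ENNReal.ofReal (circleAverage (fun w => log ‖φ₁ w‖) 0 12 - log ‖φ₁ 0‖)) := by
  obtain ⟨K, hK0, hK⟩ := exists_lintegral_inv_norm_sub_le
  set K' : ℝ := 8 * (16 * π) + K with hK'
  have hK'0 : 0 < K' := by positivity
  refine ⟨2 * K + 2 * π * (K' + 1), by positivity, fun φ₀ φ₁ h₀ h₁ h₀0 h₁0 s hs hs1 => ?_⟩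
  obtain ⟨Z₀, ψ₀, hψ₀, hψ₀n, hZ₀, hp₀, hc₀⟩ := exists_zero_factorization h₀ h₀0
  obtain ⟨Z₁, ψ₁, hψ₁, hψ₁n, hZ₁, hp₁, hc₁⟩ := exists_zero_factorization h₁ h₁0
  set k : ℂ → ℝ := fun w => log ‖ψ₁ w‖ - log ‖ψ₀ w‖ with hk
  have hkh : InnerProductSpace.HarmonicOnNhd k (Metric.closedBall 0 4) :=
    (harmonicOnNhd_log_norm hψ₁ hψ₁n).sub (harmonicOnNhd_log_norm hψ₀ hψ₀n)
  set S : Multiset ℂ → ℂ → ℝ := fun Z w => (Z.map fun b => log ‖w - b‖).sum with hS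
  set g : ℂ → ℝ := fun w => log ‖φ₁ w‖ - log ‖φ₀ w‖ with hg
  have hgdec : ∀ w, φ₀ w ≠ 0 → φ₁ w ≠ 0 → g w = S Z₁ w - S Z₀ w + k w := by
    intro w h0 h1
    rw [hp₀] at h0
    rw [hp₁] at h1
    simp only [hg, hk, hS]
    rw [hp₀ w, hp₁ w, log_norm_multiset_prod_mul h0, log_norm_multiset_prod_mul h1]
    ring
  have hae : ∀ᵐ w : ℂ, g w = S Z₁ w - S Z₀ w + k w := by
    filter_upwards [Entire.ae_ne_zero h₀ h₀0, Entire.ae_ne_zero h₁ h₁0] with w a b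
    exact hgdec w a b
  have haes : ∀ᵐ w : ℂ, g (w + s) = S Z₁ (w + s) - S Z₀ (w + s) + k (w + s) :=
    (measurePreserving_add_right (volume : Measure ℂ) (s : ℂ)).quasiMeasurePreserving.ae hae
  have hSm : ∀ Z, Measurable (S Z) := by
    intro Z
    simp only [hS]
    induction Z using Multiset.induction with
    | empty => simp
    | cons a Z ih =>
      simp only [Multiset.map_cons, Multiset.sum_cons]
      exact (by fun_prop : Measurable fun w : ℂ => log ‖w - a‖).add ih
  have hgm : Measurable g := by
    have := h₀.continuous
    have := h₁.continuous
    fun_prop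
  set G := ∫⁻ w in Metric.ball (0 : ℂ) 4, ENNReal.ofReal |g w| with hG
  set n₀ := (Z₀.card : ENNReal)
  set n₁ := (Z₁.card : ENNReal)
  have hKe : ENNReal.ofReal (8 * (16 * π)) + ENNReal.ofReal K = ENNReal.ofReal K' := by
    rw [← ENNReal.ofReal_add (by positivity) hK0.le]
  -- the harmonic part is controlled by `g` and by the logarithms of the linear factors
  have hkI : ∫⁻ w in Metric.ball (0 : ℂ) 4, ENNReal.ofReal |k w| ≤
      G + (n₀ + n₁) * ENNReal.ofReal K' := by
    calc _ ≤ ∫⁻ w in Metric.ball (0 : ℂ) 4, (ENNReal.ofReal |g w| + (ENNReal.ofReal |S Z₀ w| +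
          ENNReal.ofReal |S Z₁ w|)) := by
          refine lintegral_mono_ae (ae_restrict_of_ae ?_)
          filter_upwards [hae] with w hw
          rw [← ENNReal.ofReal_add (abs_nonneg _) (abs_nonneg _),
            ← ENNReal.ofReal_add (abs_nonneg _) (by positivity)]
          refine ENNReal.ofReal_le_ofReal ?_
          have : k w = g w + (S Z₀ w - S Z₁ w) := by rw [hw]; ring
          rw [this]
          exact (abs_add_le _ _).trans (add_le_add le_rfl (abs_sub _ _))
      _ ≤ _ := by
          have m0 := hSm Z₀
          rw [lintegral_add_left (by fun_prop), lintegral_add_left (by fun_prop), add_mul, ← hKe]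
          gcongr
          · exact log_norm_multiset_sum_le hK Z₀ hZ₀
          · exact log_norm_multiset_sum_le hK Z₁ hZ₁
  have hkint : IntegrableOn k (Metric.ball 0 4) :=
    (hkh.continuousOn.integrableOn_compact (isCompact_closedBall _ _)).mono_set
      Metric.ball_subset_closedBall
  have hkr : ENNReal.ofReal (∫ w in Metric.ball (0 : ℂ) 4, |k w|) =
      ∫⁻ w in Metric.ball (0 : ℂ) 4, ENNReal.ofReal |k w| :=
    ofReal_integral_eq_lintegral_ofReal hkint.abs (ae_of_all _ fun _ => abs_nonneg _)
  have hpi : (NNReal.pi : ENNReal) = ENNReal.ofReal π := by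
    rw [← NNReal.coe_real_pi, ENNReal.ofReal_coe_nnreal]
  have hktr : ∫⁻ w in Metric.ball (0 : ℂ) 1, ENNReal.ofReal |k (w + s) - k w| ≤
      ENNReal.ofReal (2 * π * s) * (G + (n₀ + n₁) * ENNReal.ofReal K') := by
    calc _ ≤ ∫⁻ w in Metric.ball (0 : ℂ) 1,
          ENNReal.ofReal (2 * s * ∫ w in Metric.ball (0 : ℂ) 4, |k w|) :=
          setLIntegral_mono measurable_const fun w hw =>
            ENNReal.ofReal_le_ofReal (abs_harmonic_translate_sub_le hkh hs hs1 hw)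
      _ = ENNReal.ofReal (2 * π * s) * ∫⁻ w in Metric.ball (0 : ℂ) 4, ENNReal.ofReal |k w| := by
          rw [lintegral_const, Measure.restrict_apply_univ, Complex.volume_ball, hpi,
            ENNReal.ofReal_one, one_pow, one_mul, ENNReal.ofReal_mul (by positivity), hkr,
            mul_right_comm, ← ENNReal.ofReal_mul (by positivity)]
          congr 2
          ring
      _ ≤ _ := by gcongr
  have hn₀ : n₀ ≤ ENNReal.ofReal (circleAverage (fun w => log ‖φ₀ w‖) 0 12 - log ‖φ₀ 0‖) := by
    exact (ENNReal.ofReal_natCast _).symm.le.trans (ENNReal.ofReal_le_ofReal hc₀)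
  have hn₁ : n₁ ≤ ENNReal.ofReal (circleAverage (fun w => log ‖φ₁ w‖) 0 12 - log ‖φ₁ 0‖) := by
    exact (ENNReal.ofReal_natCast _).symm.le.trans (ENNReal.ofReal_le_ofReal hc₁)
  have hmain : ∫⁻ w in Metric.ball (0 : ℂ) 1, ENNReal.ofReal |g (w + s) - g w| ≤
      n₀ * (ENNReal.ofReal s * (2 * ENNReal.ofReal K)) +
      (n₁ * (ENNReal.ofReal s * (2 * ENNReal.ofReal K)) +
      ENNReal.ofReal (2 * π * s) * (G + (n₀ + n₁) * ENNReal.ofReal K')) := by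
    calc _ ≤ ∫⁻ w in Metric.ball (0 : ℂ) 1, (ENNReal.ofReal |S Z₀ (w + s) - S Z₀ w| +
          (ENNReal.ofReal |S Z₁ (w + s) - S Z₁ w| + ENNReal.ofReal |k (w + s) - k w|)) := by
          refine lintegral_mono_ae (ae_restrict_of_ae ?_)
          filter_upwards [hae, haes] with w hw hws
          rw [← ENNReal.ofReal_add (abs_nonneg _) (abs_nonneg _),
            ← ENNReal.ofReal_add (abs_nonneg _) (by positivity)]
          refine ENNReal.ofReal_le_ofReal ?_
          have : g (w + s) - g w = -(S Z₀ (w + s) - S Z₀ w) +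
              ((S Z₁ (w + s) - S Z₁ w) + (k (w + s) - k w)) := by rw [hw, hws]; ring
          rw [this]
          refine (abs_add_le _ _).trans ?_
          rw [abs_neg]
          gcongr
          exact abs_add_le _ _
      _ ≤ _ := by
          have m0 := hSm Z₀
          have m1 := hSm Z₁
          rw [lintegral_add_left (by fun_prop), lintegral_add_left (by fun_prop)]
          gcongr
          · exact log_norm_multiset_sum_translate_le hK hs Z₀
          · exact log_norm_multiset_sum_translate_le hK hs Z₁
  refine hmain.trans ?_
  set a := ENNReal.ofReal s
  have e1 : ENNReal.ofReal ((2 * K + 2 * π * (K' + 1)) * s) =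
      (2 * ENNReal.ofReal K + ENNReal.ofReal (2 * π) * (ENNReal.ofReal K' + 1)) * a := by
    rw [ENNReal.ofReal_mul (by positivity), ENNReal.ofReal_add (by positivity) (by positivity),
      ENNReal.ofReal_mul (by norm_num), ENNReal.ofReal_mul (q := K' + 1) (by positivity),
      ENNReal.ofReal_add hK'0.le zero_le_one]
    simp [a]
  have e2 : ENNReal.ofReal (2 * π * s) = ENNReal.ofReal (2 * π) * a :=
    ENNReal.ofReal_mul (by positivity)
  rw [e1, e2]
  set p := ENNReal.ofReal (2 * π)
  set q := 2 * ENNReal.ofReal K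
  calc n₀ * (a * q) + (n₁ * (a * q) + p * a * (G + (n₀ + n₁) * ENNReal.ofReal K'))
      = q * a * (n₀ + n₁) + p * a * G + p * ENNReal.ofReal K' * a * (n₀ + n₁) := by ring
    _ ≤ q * a * (n₀ + n₁) + p * a * G + p * ENNReal.ofReal K' * a * (n₀ + n₁) +
        (q * a * G + p * ENNReal.ofReal K' * a * G + p * a * (n₀ + n₁)) := le_self_add
    _ = (q + p * (ENNReal.ofReal K' + 1)) * a * (G + n₀ + n₁) := by ring
    _ ≤ _ := by gcongr

/-! ### The angular measure -/

/-- The normalized Lebesgue measure on the angles of a circle. -/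
noncomputable def angleMeasure : Measure ℝ :=
  (ENNReal.ofReal (2 * π))⁻¹ • volume.restrict (Ioc 0 (2 * π))

instance : IsProbabilityMeasure angleMeasure where
  measure_univ := by
    have h : ENNReal.ofReal (2 * π) ≠ 0 := by simp [pi_pos]
    simp only [angleMeasure, Measure.smul_apply, Measure.restrict_apply_univ, volume_Ioc, sub_zero,
      smul_eq_mul]
    exact ENNReal.inv_mul_cancel h ENNReal.ofReal_ne_top

theorem circleAverage_eq_integral_angle (v : ℂ → ℝ) (c : ℂ) (R : ℝ) :
    circleAverage v c R = ∫ θ, v (circleMap c R θ) ∂angleMeasure := by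
  rw [circleAverage_def, angleMeasure, integral_smul_measure,
    intervalIntegral.integral_of_le (by positivity), ENNReal.toReal_inv,
    ENNReal.toReal_ofReal (by positivity)]

theorem CircleIntegrable.integrable_angle {v : ℂ → ℝ} {c : ℂ} {R : ℝ}
    (h : CircleIntegrable v c R) : Integrable (fun θ => v (circleMap c R θ)) angleMeasure := by
  refine Integrable.smul_measure ?_ (by simp [pi_pos])
  exact (intervalIntegrable_iff_integrableOn_Ioc_of_le (by positivity)).1 h

theorem lintegral_angle_eq_ofReal_sub {v : ℂ → ℝ} {R M : ℝ} (h : CircleIntegrable v 0 R)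
    (hM : ∀ w, ‖w‖ = |R| → v w ≤ M) :
    ∫⁻ θ, ENNReal.ofReal (M - v (circleMap 0 R θ)) ∂angleMeasure =
      ENNReal.ofReal (M - circleAverage v 0 R) := by
  have hi := h.integrable_angle
  have hi' : Integrable (fun θ => M - v (circleMap 0 R θ)) angleMeasure :=
    (integrable_const M).sub hi
  rw [← ofReal_integral_eq_lintegral_ofReal hi'
    (ae_of_all _ fun θ => sub_nonneg.2 (hM _ (by simp))), integral_sub (integrable_const M) hi,
    circleAverage_eq_integral_angle]
  simp

theorem Entire.ae_angle_ne_zero {φ : ℂ → ℂ} (hφ : Differentiable ℂ φ) {x : ℂ} (hx : φ x ≠ 0)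
    {R : ℝ} (hR : R ≠ 0) : ∀ᵐ θ ∂angleMeasure, φ (circleMap 0 R θ) ≠ 0 := by
  refine Measure.ae_smul_measure ?_ _
  have h : ∀ᶠ θ in codiscrete ℝ, φ (circleMap 0 R θ) ≠ 0 :=
    circleMap_preimage_codiscrete hR
      (codiscreteWithin_mono (subset_univ _) (Entire.eventually_ne_zero_codiscrete hφ hx))
  exact ae_restrict_le_codiscreteWithin measurableSet_Ioc
    (codiscreteWithin_mono (subset_univ _) h)

/-! ### Polar coordinates and rotation invariance in `ℂ^m` -/

/-- The surface area of the unit sphere of `ℂ^m`. -/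
noncomputable def sphereArea (m : ℕ) : ENNReal :=
  (volume : Measure (CSpace m)).toSphere univ

theorem nontrivial_CSpace {m : ℕ} (hm : 0 < m) : Nontrivial (CSpace m) := by
  have : Nonempty (Fin m) := ⟨⟨0, hm⟩⟩
  infer_instance

theorem sphereArea_ne_zero {m : ℕ} (hm : 0 < m) : sphereArea m ≠ 0 := by
  have := nontrivial_CSpace hm
  rw [sphereArea, Ne, Measure.measure_univ_eq_zero]
  exact Measure.toSphere_ne_zero _

theorem sphereArea_ne_top (m : ℕ) : sphereArea m ≠ ⊤ := measure_ne_top _ _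

theorem isProbabilityMeasure_unitSphereMeasure {m : ℕ} (hm : 0 < m) :
    IsProbabilityMeasure (unitSphereMeasure m) where
  measure_univ := ENNReal.inv_mul_cancel (sphereArea_ne_zero hm) (sphereArea_ne_top m)

instance instIsFiniteMeasureUnitSphereMeasure (m : ℕ) : IsFiniteMeasure (unitSphereMeasure m) := by
  rcases Nat.eq_zero_or_pos m with rfl | hm
  · refine ⟨?_⟩
    have : (univ : Set (Metric.sphere (0 : CSpace 0) 1)) = ∅ := by
      ext ⟨x, hx⟩
      have : x = 0 := Subsingleton.elim _ _
      simp [this] at hx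
    rw [this]; simp
  · have := isProbabilityMeasure_unitSphereMeasure hm
    infer_instance

theorem toSphere_eq_smul_unitSphereMeasure {m : ℕ} (hm : 0 < m) :
    (volume : Measure (CSpace m)).toSphere = sphereArea m • unitSphereMeasure m := by
  rw [unitSphereMeasure, ← sphereArea, smul_smul,
    ENNReal.mul_inv_cancel (sphereArea_ne_zero hm) (sphereArea_ne_top m), one_smul]

theorem lintegral_polar {m : ℕ} (hm : 0 < m) {F : CSpace m → ENNReal} (hF : Measurable F) :
    ∫⁻ z, F z = sphereArea m * ∫⁻ r in Ioi (0 : ℝ),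
      ENNReal.ofReal (r ^ (Module.finrank ℝ (CSpace m) - 1)) *
        ∫⁻ ξ : Metric.sphere (0 : CSpace m) 1, F (r • (ξ : CSpace m)) ∂unitSphereMeasure m := by
  have := nontrivial_CSpace hm
  set n := Module.finrank ℝ (CSpace m) - 1
  have hpres := (volume : Measure (CSpace m)).measurePreserving_homeomorphUnitSphereProd
  have hsm : Measurable fun p : (Metric.sphere (0 : CSpace m) 1) × Ioi (0 : ℝ) =>
      F ((p.2 : ℝ) • (p.1 : CSpace m)) := hF.comp (by fun_prop)
  calc ∫⁻ z, F z = ∫⁻ z in ({0}ᶜ : Set (CSpace m)), F z := by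
        rw [restrict_compl_singleton]
    _ = ∫⁻ z : ({0}ᶜ : Set (CSpace m)), F z ∂(volume.comap Subtype.val) := by
        rw [← lintegral_subtype_comap (measurableSet_singleton _).compl]
    _ = ∫⁻ p, F ((p.2 : ℝ) • (p.1 : CSpace m)) ∂((volume : Measure (CSpace m)).toSphere.prod
          (Measure.volumeIoiPow n)) := by
        rw [← hpres.lintegral_comp hsm]
        refine lintegral_congr fun z => ?_
        congr 1
        have h1 : (homeomorphUnitSphereProd (CSpace m)).symm (homeomorphUnitSphereProd (CSpace m) z)
          = z := (homeomorphUnitSphereProd (CSpace m)).symm_apply_apply z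
        conv_lhs => rw [← h1]
        rfl
    _ = ∫⁻ r, ∫⁻ ξ, F ((r : ℝ) • (ξ : CSpace m)) ∂(volume : Measure (CSpace m)).toSphere
          ∂(Measure.volumeIoiPow n) := by
        rw [lintegral_prod_symm _ hsm.aemeasurable]
    _ = ∫⁻ r : Ioi (0 : ℝ), ENNReal.ofReal ((r : ℝ) ^ n) *
          (∫⁻ ξ, F ((r : ℝ) • (ξ : CSpace m)) ∂(volume : Measure (CSpace m)).toSphere)
          ∂(volume.comap Subtype.val) := by
        rw [Measure.volumeIoiPow, lintegral_withDensity_eq_lintegral_mul _ (by fun_prop)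
          (Measurable.lintegral_prod_left hsm)]
        rfl
    _ = ∫⁻ r in Ioi (0 : ℝ), ENNReal.ofReal (r ^ n) *
          ∫⁻ ξ, F (r • (ξ : CSpace m)) ∂(volume : Measure (CSpace m)).toSphere :=
        lintegral_subtype_comap measurableSet_Ioi (fun r : ℝ => ENNReal.ofReal (r ^ n) *
          ∫⁻ ξ, F (r • (ξ : CSpace m)) ∂(volume : Measure (CSpace m)).toSphere)
    _ = _ := by
        rw [← lintegral_const_mul' _ _ (sphereArea_ne_top m)]
        refine lintegral_congr fun r => ?_
        rw [toSphere_eq_smul_unitSphereMeasure hm, lintegral_smul_measure, smul_eq_mul]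
        ring

theorem lintegral_Ioo_pow_ne (n : ℕ) :
    (∫⁻ r in Ioo (0 : ℝ) 1, ENNReal.ofReal (r ^ n)) ≠ 0 ∧
      (∫⁻ r in Ioo (0 : ℝ) 1, ENNReal.ofReal (r ^ n)) ≠ ⊤ := by
  constructor
  · rw [Ne, setLIntegral_eq_zero_iff measurableSet_Ioo (by fun_prop)]
    intro h
    have : volume (Ioo (0 : ℝ) 1) = 0 := by
      refine measure_mono_null (fun r hr => ?_) (ae_iff.1 h)
      simp only [mem_ofPred_eq, Classical.not_imp]
      exact ⟨hr, by simp [pow_pos hr.1]⟩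
    simp at this
  · refine ne_top_of_le_ne_top (b := ∫⁻ r in Ioo (0 : ℝ) 1, 1) (by simp) ?_
    refine setLIntegral_mono measurable_const fun r hr => ?_
    rw [← ENNReal.ofReal_one]
    exact ENNReal.ofReal_le_ofReal (pow_le_one₀ hr.1.le hr.2.le)

/-- Rotation invariance of the normalized surface measure, deduced from that of Lebesgue measure. -/
theorem lintegral_sphere_linearIsometry {m : ℕ} (hm : 0 < m) (L : CSpace m ≃ₗᵢ[ℝ] CSpace m)
    {F : CSpace m → ENNReal} (hF : Measurable F) :
    ∫⁻ ξ : Metric.sphere (0 : CSpace m) 1, F (L ξ) ∂unitSphereMeasure m =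
      ∫⁻ ξ : Metric.sphere (0 : CSpace m) 1, F ξ ∂unitSphereMeasure m := by
  -- compare the integrals over the unit ball of the extensions that are constant along rays
  have key : ∀ G : CSpace m → ENNReal, Measurable G →
      ∫⁻ z, (Metric.ball (0 : CSpace m) 1).indicator (fun z => G (‖z‖⁻¹ • z)) z =
      sphereArea m * ((∫⁻ r in Ioo (0 : ℝ) 1,
        ENNReal.ofReal (r ^ (Module.finrank ℝ (CSpace m) - 1))) *
        ∫⁻ ξ : Metric.sphere (0 : CSpace m) 1, G ξ ∂unitSphereMeasure m) := by
    intro G hG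
    have hm' : Measurable fun z : CSpace m => G (‖z‖⁻¹ • z) := hG.comp (by fun_prop)
    rw [lintegral_polar hm (hm'.indicator Metric.isOpen_ball.measurableSet),
      ← lintegral_mul_const _ (by fun_prop), ← lintegral_indicator measurableSet_Ioi,
      ← lintegral_indicator measurableSet_Ioo]
    congr 1
    refine lintegral_congr fun r => ?_
    by_cases h0 : 0 < r
    · rw [indicator_of_mem (show r ∈ Ioi (0 : ℝ) from h0)]
      by_cases h1 : r < 1
      · rw [indicator_of_mem (show r ∈ Ioo (0 : ℝ) 1 from ⟨h0, h1⟩)]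
        congr 1
        refine lintegral_congr fun ξ => ?_
        have hξ : ‖(ξ : CSpace m)‖ = 1 := by simp
        have hn : ‖r • (ξ : CSpace m)‖ = r := by
          rw [norm_smul, hξ, mul_one, norm_of_nonneg h0.le]
        rw [indicator_of_mem (by rw [mem_ball_zero_iff, hn]; exact h1), hn, smul_smul,
          inv_mul_cancel₀ h0.ne', one_smul]
      · rw [indicator_of_notMem (fun h => h1 h.2)]
        have : ∀ ξ : Metric.sphere (0 : CSpace m) 1, (Metric.ball (0 : CSpace m) 1).indicator
            (fun z => G (‖z‖⁻¹ • z)) (r • (ξ : CSpace m)) = 0 := by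
          intro ξ
          have hξ : ‖(ξ : CSpace m)‖ = 1 := by simp
          refine indicator_of_notMem ?_ _
          rwa [mem_ball_zero_iff, norm_smul, hξ, mul_one, norm_of_nonneg h0.le]
        simp [this]
    · rw [indicator_of_notMem (show r ∉ Ioi (0 : ℝ) from h0), indicator_of_notMem (fun h => h0 h.1)]
  have h1 := key F hF
  have h2 := key (fun z => F (L z)) (hF.comp L.continuous.measurable)
  have h3 : ∫⁻ z, (Metric.ball (0 : CSpace m) 1).indicator (fun z => F (L (‖z‖⁻¹ • z))) z =
      ∫⁻ z, (Metric.ball (0 : CSpace m) 1).indicator (fun z => F (‖z‖⁻¹ • z)) z := by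
    have hm' : Measurable fun z : CSpace m => F (‖z‖⁻¹ • z) := hF.comp (by fun_prop)
    rw [← L.measurePreserving.lintegral_comp (hm'.indicator Metric.isOpen_ball.measurableSet)]
    refine lintegral_congr fun z => ?_
    simp only [indicator, mem_ball_zero_iff, L.norm_map, map_smul]
  rw [h3, h1] at h2
  obtain ⟨c0, c1⟩ := lintegral_Ioo_pow_ne (Module.finrank ℝ (CSpace m) - 1)
  have h4 := (ENNReal.mul_right_inj (sphereArea_ne_zero hm) (sphereArea_ne_top m)).1 h2
  exact ((ENNReal.mul_right_inj c0 c1).1 h4).symm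

/-- Multiplication by a complex number of modulus one, as a real linear isometry. -/
noncomputable def rotationCSpace (m : ℕ) (a : Circle) : CSpace m ≃ₗᵢ[ℝ] CSpace m where
  toFun z := (a : ℂ) • z
  invFun z := ((a⁻¹ : Circle) : ℂ) • z
  map_add' x y := smul_add _ _ _
  map_smul' r x := smul_comm _ _ _
  left_inv z := by
    change ((a⁻¹ : Circle) : ℂ) • (a : ℂ) • z = z
    rw [smul_smul, ← Circle.coe_mul, inv_mul_cancel, Circle.coe_one, one_smul]
  right_inv z := by
    change (a : ℂ) • ((a⁻¹ : Circle) : ℂ) • z = z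
    rw [smul_smul, ← Circle.coe_mul, mul_inv_cancel, Circle.coe_one, one_smul]
  norm_map' z := by
    change ‖(a : ℂ) • z‖ = ‖z‖
    rw [norm_smul, Circle.norm_coe, one_mul]

theorem circleMap_zero_smul {m : ℕ} (r θ : ℝ) (z : CSpace m) :
    circleMap 0 r θ • z = r • rotationCSpace m (Circle.exp θ) z := by
  change circleMap 0 r θ • z = r • ((Circle.exp θ : ℂ) • z)
  rw [circleMap, zero_add, mul_smul, Circle.coe_exp]
  exact (RCLike.real_smul_eq_coe_smul (K := ℂ) r _).symm

/-- The circles `θ ↦ r e^{iθ} ξ` fibre the sphere of radius `r`. -/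
theorem lintegral_sphere_eq_lintegral_angle {m : ℕ} (hm : 0 < m) {F : CSpace m → ENNReal}
    (hF : Measurable F) (r : ℝ) :
    ∫⁻ ξ : Metric.sphere (0 : CSpace m) 1, F (r • (ξ : CSpace m)) ∂unitSphereMeasure m =
      ∫⁻ ξ : Metric.sphere (0 : CSpace m) 1, ∫⁻ θ, F (circleMap 0 r θ • (ξ : CSpace m))
        ∂angleMeasure ∂unitSphereMeasure m := by
  have hmeas : Measurable (Function.uncurry fun (ξ : Metric.sphere (0 : CSpace m) 1) (θ : ℝ) =>
      F (circleMap 0 r θ • (ξ : CSpace m))) := by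
    refine hF.comp ?_
    have : Continuous fun p : Metric.sphere (0 : CSpace m) 1 × ℝ =>
        circleMap 0 r p.2 • (p.1 : CSpace m) := by unfold circleMap; fun_prop
    exact this.measurable
  rw [lintegral_lintegral_swap hmeas.aemeasurable]
  have : ∀ θ, ∫⁻ ξ : Metric.sphere (0 : CSpace m) 1, F (circleMap 0 r θ • (ξ : CSpace m))
      ∂unitSphereMeasure m =
      ∫⁻ ξ : Metric.sphere (0 : CSpace m) 1, F (r • (ξ : CSpace m)) ∂unitSphereMeasure m := by
    intro θ
    simp_rw [circleMap_zero_smul]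
    exact lintegral_sphere_linearIsometry hm (rotationCSpace m (Circle.exp θ))
      (F := fun z => F (r • z)) (hF.comp (by fun_prop))
  simp_rw [this]
  simp

/-! ### Spherical means of `log ‖F‖` for entire functions on `ℂ^m` -/

section SphericalMeans

variable {m : ℕ} {F : CSpace m → ℂ}

theorem Entire.differentiable_slice (hF : Differentiable ℂ F) (z ξ : CSpace m) :
    Differentiable ℂ fun w : ℂ => F (z + w • ξ) := by
  fun_prop

theorem Entire.differentiable_slice_zero (hF : Differentiable ℂ F) (ξ : CSpace m) :
    Differentiable ℂ fun w : ℂ => F (w • ξ) := by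
  fun_prop

theorem Entire.measurable_log_norm (hF : Differentiable ℂ F) :
    Measurable fun z => log ‖F z‖ := by
  have := hF.continuous.measurable
  fun_prop

theorem Entire.measurableSet_zero (hF : Differentiable ℂ F) : MeasurableSet {z | F z = 0} :=
  (isClosed_singleton.preimage hF.continuous).measurableSet

theorem measurable_comp_sphere {β : Type*} [MeasurableSpace β] {G : CSpace m → β}
    (hG : Measurable G) (r : ℝ) :
    Measurable fun ξ : Metric.sphere (0 : CSpace m) 1 => G (r • (ξ : CSpace m)) :=
  hG.comp (by fun_prop)

theorem ae_sphere_of_ae_angle (hm : 0 < m) {S : Set (CSpace m)} (hS : MeasurableSet S) {r : ℝ}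
    (h : ∀ᵐ ξ : Metric.sphere (0 : CSpace m) 1 ∂unitSphereMeasure m,
      ∀ᵐ θ ∂angleMeasure, circleMap 0 r θ • (ξ : CSpace m) ∉ S) :
    ∀ᵐ ξ : Metric.sphere (0 : CSpace m) 1 ∂unitSphereMeasure m, r • (ξ : CSpace m) ∉ S := by
  have hind : Measurable (S.indicator (1 : CSpace m → ENNReal)) := measurable_one.indicator hS
  have h1 := lintegral_sphere_eq_lintegral_angle hm hind r
  have h2 : ∫⁻ ξ : Metric.sphere (0 : CSpace m) 1, ∫⁻ θ,
      S.indicator (1 : CSpace m → ENNReal) (circleMap 0 r θ • (ξ : CSpace m))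
        ∂angleMeasure ∂unitSphereMeasure m = 0 := by
    rw [← lintegral_zero (μ := unitSphereMeasure m)]
    refine lintegral_congr_ae ?_
    filter_upwards [h] with ξ hξ
    rw [← lintegral_zero (μ := angleMeasure)]
    refine lintegral_congr_ae ?_
    filter_upwards [hξ] with θ hθ
    simp [hθ]
  rw [h2, lintegral_eq_zero_iff (measurable_comp_sphere hind r)] at h1
  filter_upwards [h1] with ξ hξ hmem
  simp [hmem] at hξ

theorem Entire.ae_sphere_ne_zero_of_slice (hm : 0 < m) (hF : Differentiable ℂ F) {r : ℝ}
    (hr : r ≠ 0) (h : ∀ᵐ ξ : Metric.sphere (0 : CSpace m) 1 ∂unitSphereMeasure m,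
      ∃ w : ℂ, F (w • (ξ : CSpace m)) ≠ 0) :
    ∀ᵐ ξ : Metric.sphere (0 : CSpace m) 1 ∂unitSphereMeasure m, F (r • (ξ : CSpace m)) ≠ 0 := by
  refine ae_sphere_of_ae_angle hm (Entire.measurableSet_zero hF) ?_
  filter_upwards [h] with ξ ⟨w, hw⟩
  exact Entire.ae_angle_ne_zero (Entire.differentiable_slice_zero hF ξ) hw hr

/-- The zero set of an entire function that does not vanish identically is a null set: lines through
a point where the function is nonzero meet it in discrete sets. -/
theorem Entire.ae_ne_zero_CSpace (hm : 0 < m) (hF : Differentiable ℂ F) {z₀ : CSpace m}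
    (hz₀ : F z₀ ≠ 0) : ∀ᵐ z, F z ≠ 0 := by
  have hG : Differentiable ℂ fun z => F (z + z₀) := by fun_prop
  have hGz : ∀ᵐ z : CSpace m, F (z + z₀) ≠ 0 := by
    have hS := Entire.measurableSet_zero hG
    have hind : Measurable ({z | F (z + z₀) = 0}.indicator (1 : CSpace m → ENNReal)) :=
      measurable_one.indicator hS
    rw [ae_iff]
    simp only [ne_eq, not_not]
    rw [← lintegral_indicator_one hS, lintegral_polar hm hind, mul_eq_zero]
    right
    rw [setLIntegral_eq_zero_iff measurableSet_Ioi]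
    · refine ae_of_all _ fun r hr => ?_
      rw [mul_eq_zero]
      right
      rw [lintegral_eq_zero_iff (measurable_comp_sphere hind r)]
      filter_upwards [Entire.ae_sphere_ne_zero_of_slice hm hG (ne_of_gt hr)
        (ae_of_all _ fun ξ => ⟨0, by simpa using hz₀⟩)] with ξ hξ
      simp [hξ]
    · have h1 : Measurable fun p : ℝ × Metric.sphere (0 : CSpace m) 1 =>
          {z | F (z + z₀) = 0}.indicator (1 : CSpace m → ENNReal) (p.1 • (p.2 : CSpace m)) :=
        hind.comp (by fun_prop)
      have h2 := h1.lintegral_prod_right' (ν := unitSphereMeasure m)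
      fun_prop
  have := (measurePreserving_add_right (volume : Measure (CSpace m))
    (-z₀)).quasiMeasurePreserving.ae
    hGz
  simpa using this

theorem Entire.ae_exists_slice_ne_zero (hm : 0 < m) (hF : Differentiable ℂ F) {z₀ : CSpace m}
    (hz₀ : F z₀ ≠ 0) : ∀ᵐ ξ : Metric.sphere (0 : CSpace m) 1 ∂unitSphereMeasure m,
      ∃ w : ℂ, F (w • (ξ : CSpace m)) ≠ 0 := by
  have hS := Entire.measurableSet_zero hF
  have hind : Measurable ({z | F z = 0}.indicator (1 : CSpace m → ENNReal)) :=
    measurable_one.indicator hS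
  have h0 : ∫⁻ z, {z | F z = 0}.indicator (1 : CSpace m → ENNReal) z = 0 := by
    rw [lintegral_indicator_one hS]
    have := ae_iff.1 (Entire.ae_ne_zero_CSpace hm hF hz₀)
    simpa using this
  rw [lintegral_polar hm hind, mul_eq_zero, or_iff_right (sphereArea_ne_zero hm)] at h0
  have h1 : Measurable fun p : ℝ × Metric.sphere (0 : CSpace m) 1 =>
      {z | F z = 0}.indicator (1 : CSpace m → ENNReal) (p.1 • (p.2 : CSpace m)) :=
    hind.comp (by fun_prop)
  have h2 := h1.lintegral_prod_right' (ν := unitSphereMeasure m)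
  rw [lintegral_eq_zero_iff (by fun_prop)] at h0
  -- one radius is enough
  have h3 : ∃ r : ℝ, 0 < r ∧ ENNReal.ofReal (r ^ (Module.finrank ℝ (CSpace m) - 1)) *
      ∫⁻ ξ : Metric.sphere (0 : CSpace m) 1,
        {z | F z = 0}.indicator (1 : CSpace m → ENNReal) (r • (ξ : CSpace m))
        ∂unitSphereMeasure m = 0 := by
    have : NeBot (ae (volume.restrict (Ioi (0 : ℝ)))) := by
      rw [ae_neBot, Ne, Measure.restrict_eq_zero]; simp
    obtain ⟨r, hr, h⟩ := ((ae_restrict_mem measurableSet_Ioi).and h0).exists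
    exact ⟨r, hr, h⟩
  obtain ⟨r, hr, h⟩ := h3
  rw [mul_eq_zero, or_iff_right (by simpa using pow_pos hr _),
    lintegral_eq_zero_iff (measurable_comp_sphere hind r)] at h
  filter_upwards [h] with ξ hξ
  refine ⟨r, fun h0 => ?_⟩
  have e : ((r : ℂ) • (ξ : CSpace m)) = r • (ξ : CSpace m) :=
    (RCLike.real_smul_eq_coe_smul (K := ℂ) r _).symm
  rw [e] at h0
  simp [h0] at hξ

theorem Entire.ae_sphere_ne_zero (hm : 0 < m) (hF : Differentiable ℂ F) {z₀ : CSpace m}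
    (hz₀ : F z₀ ≠ 0) {r : ℝ} (hr : r ≠ 0) :
    ∀ᵐ ξ : Metric.sphere (0 : CSpace m) 1 ∂unitSphereMeasure m, F (r • (ξ : CSpace m)) ≠ 0 :=
  Entire.ae_sphere_ne_zero_of_slice hm hF hr (Entire.ae_exists_slice_ne_zero hm hF hz₀)

theorem Entire.exists_log_norm_le (hF : Differentiable ℂ F) (R : ℝ) :
    ∃ M : ℝ, 0 ≤ M ∧ ∀ z, ‖z‖ ≤ R → log ‖F z‖ ≤ M := by
  obtain ⟨M, hM⟩ := (isCompact_closedBall (0 : CSpace m) R).exists_bound_of_continuousOn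
    hF.continuous.continuousOn
  refine ⟨max M 0, le_max_right _ _, fun z hz => ?_⟩
  exact ((log_le_self (norm_nonneg _)).trans (hM z (by simpa using hz))).trans (le_max_left _ _)

theorem norm_smul_sphere (w : ℂ) (ξ : Metric.sphere (0 : CSpace m) 1) :
    ‖w • (ξ : CSpace m)‖ = ‖w‖ := by
  have hξ : ‖(ξ : CSpace m)‖ = 1 := by simp
  rw [norm_smul, hξ, mul_one]

theorem norm_real_smul_sphere {r : ℝ} (hr : 0 ≤ r) (ξ : Metric.sphere (0 : CSpace m) 1) :
    ‖r • (ξ : CSpace m)‖ = r := by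
  have hξ : ‖(ξ : CSpace m)‖ = 1 := by simp
  rw [norm_smul, hξ, mul_one, norm_of_nonneg hr]

/-- The spherical integral of `M - log ‖F‖`, computed on the circles of the Hopf fibration. -/
theorem Entire.lintegral_sphere_sub_log (hm : 0 < m) (hF : Differentiable ℂ F) {R M r : ℝ}
    (hM : ∀ z, ‖z‖ ≤ R → log ‖F z‖ ≤ M) (hr : 0 ≤ r) (hrR : r ≤ R) :
    ∫⁻ ξ : Metric.sphere (0 : CSpace m) 1, ENNReal.ofReal (M - log ‖F (r • (ξ : CSpace m))‖)
      ∂unitSphereMeasure m =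
    ∫⁻ ξ : Metric.sphere (0 : CSpace m) 1, ENNReal.ofReal
      (M - circleAverage (fun w => log ‖F (w • (ξ : CSpace m))‖) 0 r) ∂unitSphereMeasure m := by
  have hmeas : Measurable fun z => ENNReal.ofReal (M - log ‖F z‖) := by
    have := Entire.measurable_log_norm hF
    fun_prop
  rw [lintegral_sphere_eq_lintegral_angle hm hmeas r]
  refine lintegral_congr fun ξ => ?_
  refine lintegral_angle_eq_ofReal_sub (v := fun w => log ‖F (w • (ξ : CSpace m))‖)
    (Entire.circleIntegrable_log_norm (Entire.differentiable_slice_zero hF ξ) r) fun w hw => ?_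
  refine hM _ ?_
  rwa [norm_smul_sphere, hw, abs_of_nonneg hr]

theorem Entire.lintegral_sphere_sub_log_anti (hm : 0 < m) (hF : Differentiable ℂ F) {R M r : ℝ}
    (hM : ∀ z, ‖z‖ ≤ R → log ‖F z‖ ≤ M) (hr : 0 < r) (hrR : r ≤ R) :
    ∫⁻ ξ : Metric.sphere (0 : CSpace m) 1, ENNReal.ofReal (M - log ‖F (R • (ξ : CSpace m))‖)
      ∂unitSphereMeasure m ≤
    ∫⁻ ξ : Metric.sphere (0 : CSpace m) 1, ENNReal.ofReal (M - log ‖F (r • (ξ : CSpace m))‖)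
      ∂unitSphereMeasure m := by
  rw [Entire.lintegral_sphere_sub_log hm hF hM (hr.le.trans hrR) le_rfl,
    Entire.lintegral_sphere_sub_log hm hF hM hr.le hrR]
  refine lintegral_mono fun ξ => ENNReal.ofReal_le_ofReal ?_
  linarith [Entire.circleAverage_log_norm_mono (Entire.differentiable_slice_zero hF ξ) hr hrR]

theorem Entire.lintegral_sphere_sub_log_le (hm : 0 < m) (hF : Differentiable ℂ F) (h0 : F 0 ≠ 0)
    {R M : ℝ} (hM : ∀ z, ‖z‖ ≤ R → log ‖F z‖ ≤ M) (hR : 0 < R) :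
    ∫⁻ ξ : Metric.sphere (0 : CSpace m) 1, ENNReal.ofReal (M - log ‖F (R • (ξ : CSpace m))‖)
      ∂unitSphereMeasure m ≤ ENNReal.ofReal (M - log ‖F 0‖) := by
  have := isProbabilityMeasure_unitSphereMeasure hm
  rw [Entire.lintegral_sphere_sub_log hm hF hM hR.le le_rfl]
  calc _ ≤ ∫⁻ ξ : Metric.sphere (0 : CSpace m) 1, ENNReal.ofReal (M - log ‖F 0‖)
        ∂unitSphereMeasure m := by
        refine lintegral_mono fun ξ => ENNReal.ofReal_le_ofReal ?_
        have := Entire.log_norm_le_circleAverage (Entire.differentiable_slice_zero hF ξ)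
          (by simpa using h0) hR
        simp only [zero_smul] at this
        linarith
    _ = _ := by simp

theorem measurable_lintegral_sphere {G : CSpace m → ENNReal} (hG : Measurable G) :
    Measurable fun r : ℝ => ∫⁻ ξ : Metric.sphere (0 : CSpace m) 1, G (r • (ξ : CSpace m))
      ∂unitSphereMeasure m := by
  have h1 : Measurable fun p : ℝ × Metric.sphere (0 : CSpace m) 1 =>
      G (p.1 • (p.2 : CSpace m)) := hG.comp (by fun_prop)
  exact h1.lintegral_prod_right' (ν := unitSphereMeasure m)

/-- Finiteness without any assumption at the origin: local integrability of `log ‖F‖` holds around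
any point where `F` does not vanish, hence the spherical integral is finite for some small radius,
and it decreases with the radius. -/
theorem Entire.lintegral_sphere_sub_log_lt_top (hm : 0 < m) (hF : Differentiable ℂ F)
    {z₀ : CSpace m} (hz₀ : F z₀ ≠ 0) {R M : ℝ} (hM : ∀ z, ‖z‖ ≤ R → log ‖F z‖ ≤ M) (hR : 0 < R) :
    ∫⁻ ξ : Metric.sphere (0 : CSpace m) 1, ENNReal.ofReal (M - log ‖F (R • (ξ : CSpace m))‖)
      ∂unitSphereMeasure m < ⊤ := by
  set n := Module.finrank ℝ (CSpace m) - 1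
  set R' := R + ‖z₀‖ with hR'
  have hR'0 : 0 < R' := by positivity
  have hG : Differentiable ℂ fun z => F (z + z₀) := by fun_prop
  obtain ⟨M₁, hM₁0, hM₁⟩ := Entire.exists_log_norm_le hG R'
  have hGm : Measurable fun z => ENNReal.ofReal (M₁ - log ‖F (z + z₀)‖) := by
    have := Entire.measurable_log_norm hG
    fun_prop
  have hfin : ∫⁻ z in Metric.ball (0 : CSpace m) R',
      ENNReal.ofReal (M₁ - log ‖F (z + z₀)‖) < ⊤ := by
    rw [← lintegral_indicator Metric.isOpen_ball.measurableSet,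
      lintegral_polar hm (hGm.indicator Metric.isOpen_ball.measurableSet)]
    refine ENNReal.mul_lt_top (sphereArea_ne_top m).lt_top ?_
    calc _ ≤ ∫⁻ r in Ioi (0 : ℝ), (Ioo (0 : ℝ) R').indicator (fun _ => ENNReal.ofReal (R' ^ n) *
          ENNReal.ofReal (M₁ - log ‖F (0 + z₀)‖)) r := by
          refine setLIntegral_mono ((measurable_const).indicator measurableSet_Ioo) fun r hr => ?_
          have hr0 : (0 : ℝ) < r := hr
          by_cases hrR : r < R'
          · rw [indicator_of_mem (show r ∈ Ioo 0 R' from ⟨hr0, hrR⟩)]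
            gcongr
            have h1 := Entire.lintegral_sphere_sub_log_le hm hG (by simpa using hz₀) (R := r)
              (fun z hz => hM₁ z (hz.trans hrR.le)) hr0
            refine le_trans (lintegral_mono fun ξ => ?_) h1
            exact indicator_le_self' (fun _ _ => zero_le) _
          · have : ∀ ξ : Metric.sphere (0 : CSpace m) 1, (Metric.ball (0 : CSpace m) R').indicator
                (fun z => ENNReal.ofReal (M₁ - log ‖F (z + z₀)‖)) (r • (ξ : CSpace m)) = 0 := by
              intro ξ
              refine indicator_of_notMem ?_ _
              rwa [mem_ball_zero_iff, norm_real_smul_sphere hr0.le]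
            simp [this]
      _ < ⊤ := by
          rw [lintegral_indicator measurableSet_Ioo, setLIntegral_const]
          refine ENNReal.mul_lt_top (ENNReal.mul_lt_top ENNReal.ofReal_lt_top ENNReal.ofReal_lt_top)
            ((Measure.restrict_apply_le _ _).trans_lt (by simp))
  have hFm : Measurable fun z => ENNReal.ofReal (M - log ‖F z‖) := by
    have := Entire.measurable_log_norm hF
    fun_prop
  have hFm₁ : Measurable fun z => ENNReal.ofReal (M₁ - log ‖F z‖) := by
    have := Entire.measurable_log_norm hF
    fun_prop
  have hfin2 : ∫⁻ z in Metric.ball (0 : CSpace m) R, ENNReal.ofReal (M₁ - log ‖F z‖) < ⊤ := by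
    refine lt_of_le_of_lt ?_ hfin
    rw [← lintegral_indicator Metric.isOpen_ball.measurableSet,
      ← lintegral_indicator Metric.isOpen_ball.measurableSet,
      ← lintegral_add_right_eq_self (μ := (volume : Measure (CSpace m))) _ z₀]
    refine lintegral_mono fun z => ?_
    by_cases hz : z + z₀ ∈ Metric.ball (0 : CSpace m) R
    · rw [indicator_of_mem hz, indicator_of_mem]
      rw [mem_ball_zero_iff] at hz ⊢
      have : ‖z‖ ≤ ‖z + z₀‖ + ‖z₀‖ := by simpa using norm_sub_le (z + z₀) z₀
      linarith
    · rw [indicator_of_notMem hz]; exact zero_le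
  have hfin3 : ∫⁻ z in Metric.ball (0 : CSpace m) R, ENNReal.ofReal (M - log ‖F z‖) < ⊤ := by
    calc _ ≤ ∫⁻ z in Metric.ball (0 : CSpace m) R,
          (ENNReal.ofReal |M - M₁| + ENNReal.ofReal (M₁ - log ‖F z‖)) := by
          refine lintegral_mono fun z => ?_
          refine le_trans (ENNReal.ofReal_le_ofReal ?_) ENNReal.ofReal_add_le
          linarith [le_abs_self (M - M₁)]
      _ < ⊤ := by
          rw [lintegral_add_left measurable_const, setLIntegral_const]
          exact ENNReal.add_lt_top.2 ⟨ENNReal.mul_lt_top ENNReal.ofReal_lt_top measure_ball_lt_top,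
            hfin2⟩
  rw [← lintegral_indicator Metric.isOpen_ball.measurableSet,
    lintegral_polar hm (hFm.indicator Metric.isOpen_ball.measurableSet)] at hfin3
  have hfin4 : ∫⁻ r in Ioi (0 : ℝ), ENNReal.ofReal (r ^ n) *
      ∫⁻ ξ : Metric.sphere (0 : CSpace m) 1, (Metric.ball (0 : CSpace m) R).indicator
        (fun z => ENNReal.ofReal (M - log ‖F z‖)) (r • (ξ : CSpace m)) ∂unitSphereMeasure m < ⊤ :=
    (ENNReal.lt_top_of_mul_ne_top_right hfin3.ne (sphereArea_ne_zero hm))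
  have hmeas := measurable_lintegral_sphere (hFm.indicator
    (Metric.isOpen_ball (x := (0 : CSpace m)) (ε := R)).measurableSet)
  have hae := ae_lt_top' (by fun_prop) hfin4.ne
  have hex : ∃ r ∈ Ioo (0 : ℝ) R, ENNReal.ofReal (r ^ n) *
      ∫⁻ ξ : Metric.sphere (0 : CSpace m) 1, (Metric.ball (0 : CSpace m) R).indicator
        (fun z => ENNReal.ofReal (M - log ‖F z‖)) (r • (ξ : CSpace m))
          ∂unitSphereMeasure m < ⊤ := by
    have : NeBot (ae (volume.restrict (Ioo (0 : ℝ) R))) := by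
      rw [ae_neBot, Ne, Measure.restrict_eq_zero]; simpa using hR
    obtain ⟨r, hr, h⟩ := ((ae_restrict_mem measurableSet_Ioo).and
      (ae_restrict_of_ae_restrict_of_subset (fun r hr => hr.1 : Ioo (0 : ℝ) R ⊆ Ioi 0) hae)).exists
    exact ⟨r, hr, h⟩
  obtain ⟨r, ⟨hr0, hrR⟩, hr⟩ := hex
  have hr2 := ENNReal.lt_top_of_mul_ne_top_right hr.ne (by simpa using pow_pos hr0 n)
  refine lt_of_le_of_lt (Entire.lintegral_sphere_sub_log_anti hm hF hM hr0 hrR.le)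
    (lt_of_eq_of_lt ?_ hr2)
  refine lintegral_congr fun ξ => ?_
  rw [indicator_of_mem]
  rwa [mem_ball_zero_iff, norm_real_smul_sphere hr0.le]

theorem Entire.sphereIntegrable_log_norm (hm : 0 < m) (hF : Differentiable ℂ F) {z₀ : CSpace m}
    (hz₀ : F z₀ ≠ 0) {r : ℝ} (hr : 0 < r) : SphereIntegrable (fun z => log ‖F z‖) r := by
  obtain ⟨M, _, hM⟩ := Entire.exists_log_norm_le hF r
  have h := Entire.lintegral_sphere_sub_log_lt_top hm hF hz₀ hM hr
  have hmeas : Measurable fun ξ : Metric.sphere (0 : CSpace m) 1 => log ‖F (r • (ξ : CSpace m))‖ :=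
    (Entire.measurable_log_norm hF).comp (by fun_prop)
  have h1 : Integrable (fun ξ : Metric.sphere (0 : CSpace m) 1 =>
      M - log ‖F (r • (ξ : CSpace m))‖) (unitSphereMeasure m) := by
    refine ⟨(measurable_const.sub hmeas).aestronglyMeasurable, ?_⟩
    rw [hasFiniteIntegral_iff_ofReal (ae_of_all _ fun ξ => ?_)]
    · exact h
    · exact sub_nonneg.2 (hM _ (norm_real_smul_sphere hr.le ξ).le)
  have h2 := (integrable_const M).sub h1
  refine h2.congr (ae_of_all _ fun ξ => ?_)
  simp

theorem ofReal_sub_sphereIntegral (hm : 0 < m) {u : CSpace m → ℝ} {r M : ℝ}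
    (hu : SphereIntegrable u r) (hr : 0 ≤ r) (hM : ∀ z, ‖z‖ ≤ r → u z ≤ M) :
    ENNReal.ofReal (M - sphereIntegral u r) =
      ∫⁻ ξ : Metric.sphere (0 : CSpace m) 1, ENNReal.ofReal (M - u (r • (ξ : CSpace m)))
        ∂unitSphereMeasure m := by
  have := isProbabilityMeasure_unitSphereMeasure hm
  have hi : Integrable (fun ξ : Metric.sphere (0 : CSpace m) 1 => M - u (r • (ξ : CSpace m)))
    (unitSphereMeasure m) := (integrable_const M).sub hu
  rw [← ofReal_integral_eq_lintegral_ofReal hi (ae_of_all _ fun ξ => sub_nonneg.2 (hM _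
    (norm_real_smul_sphere hr ξ).le)), integral_sub (integrable_const M) hu, sphereIntegral]
  simp

theorem sphereIntegral_le_of_le (hm : 0 < m) {u : CSpace m → ℝ} {r M : ℝ}
    (hu : SphereIntegrable u r) (hr : 0 ≤ r) (hM : ∀ z, ‖z‖ ≤ r → u z ≤ M) :
    sphereIntegral u r ≤ M := by
  have := isProbabilityMeasure_unitSphereMeasure hm
  calc sphereIntegral u r ≤ ∫ ξ : Metric.sphere (0 : CSpace m) 1, M ∂unitSphereMeasure m :=
        integral_mono hu (integrable_const M) fun ξ => hM _ (norm_real_smul_sphere hr ξ).le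
    _ = M := by simp

theorem Entire.log_norm_le_sphereIntegral (hm : 0 < m) (hF : Differentiable ℂ F) (h0 : F 0 ≠ 0)
    {r : ℝ} (hr : 0 < r) : log ‖F 0‖ ≤ sphereIntegral (fun z => log ‖F z‖) r := by
  obtain ⟨M, _, hM⟩ := Entire.exists_log_norm_le hF r
  have hu := Entire.sphereIntegrable_log_norm hm hF h0 hr
  have h := Entire.lintegral_sphere_sub_log_le hm hF h0 hM hr
  rw [← ofReal_sub_sphereIntegral hm hu hr.le hM, ENNReal.ofReal_le_ofReal_iff
    (sub_nonneg.2 (hM 0 (by simpa using hr.le)))] at h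
  linarith

theorem Entire.sphereIntegral_log_norm_mono (hm : 0 < m) (hF : Differentiable ℂ F) {z₀ : CSpace m}
    (hz₀ : F z₀ ≠ 0) {r R : ℝ} (hr : 0 < r) (hrR : r ≤ R) :
    sphereIntegral (fun z => log ‖F z‖) r ≤ sphereIntegral (fun z => log ‖F z‖) R := by
  have hR := hr.trans_le hrR
  obtain ⟨M, _, hM⟩ := Entire.exists_log_norm_le hF R
  have h := Entire.lintegral_sphere_sub_log_anti hm hF hM hr hrR
  have hur := Entire.sphereIntegrable_log_norm hm hF hz₀ hr
  have hMr : ∀ z, ‖z‖ ≤ r → log ‖F z‖ ≤ M := fun z hz => hM z (hz.trans hrR)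
  rw [← ofReal_sub_sphereIntegral hm (Entire.sphereIntegrable_log_norm hm hF hz₀ hR) hR.le hM,
    ← ofReal_sub_sphereIntegral hm hur hr.le hMr,
    ENNReal.ofReal_le_ofReal_iff (sub_nonneg.2 (sphereIntegral_le_of_le hm hur hr.le hMr))] at h
  linarith

/-- Growth of the spherical means of an entire function vanishing at the origin, by the one-variable
statement on complex lines. -/
theorem Entire.sphereIntegral_log_norm_add_log_le (hm : 0 < m) (hF : Differentiable ℂ F)
    (h0 : F 0 = 0) {z₀ : CSpace m} (hz₀ : F z₀ ≠ 0) {r R : ℝ} (hr : 0 < r) (hrR : r ≤ R) :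
    sphereIntegral (fun z => log ‖F z‖) r + log (R / r) ≤
      sphereIntegral (fun z => log ‖F z‖) R := by
  have hR := hr.trans_le hrR
  obtain ⟨M, _, hM⟩ := Entire.exists_log_norm_le hF R
  have hMr : ∀ z, ‖z‖ ≤ r → log ‖F z‖ ≤ M := fun z hz => hM z (hz.trans hrR)
  have hl : 0 ≤ log (R / r) := log_nonneg ((one_le_div hr).2 hrR)
  have hur := Entire.sphereIntegrable_log_norm hm hF hz₀ hr
  have huR := Entire.sphereIntegrable_log_norm hm hF hz₀ hR
  have h : ∫⁻ ξ : Metric.sphere (0 : CSpace m) 1, ENNReal.ofReal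
      (M + log (R / r) - log ‖F (R • (ξ : CSpace m))‖) ∂unitSphereMeasure m ≤
    ∫⁻ ξ : Metric.sphere (0 : CSpace m) 1, ENNReal.ofReal (M - log ‖F (r • (ξ : CSpace m))‖)
      ∂unitSphereMeasure m := by
    rw [Entire.lintegral_sphere_sub_log hm hF (M := M + log (R / r))
      (fun z hz => (hM z hz).trans (by linarith)) hR.le le_rfl,
      Entire.lintegral_sphere_sub_log hm hF hM hr.le hrR]
    refine lintegral_mono_ae ?_
    filter_upwards [Entire.ae_exists_slice_ne_zero hm hF hz₀] with ξ ⟨w, hw⟩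
    refine ENNReal.ofReal_le_ofReal ?_
    linarith [Entire.circleAverage_log_norm_add_log_le (Entire.differentiable_slice_zero hF ξ)
      (by simpa using h0) hw hr hrR]
  rw [← ofReal_sub_sphereIntegral hm huR hR.le (M := M + log (R / r))
      (fun z hz => (hM z hz).trans (by linarith)),
    ← ofReal_sub_sphereIntegral hm hur hr.le hMr,
    ENNReal.ofReal_le_ofReal_iff (sub_nonneg.2 (sphereIntegral_le_of_le hm hur hr.le hMr))] at h
  linarith

end SphericalMeans

/-! ### The spherical mean of `max (log ‖f₀‖) (log ‖f₁‖)` -/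

section MaxMean

variable {m : ℕ} {f₀ f₁ : CSpace m → ℂ}

/-- The spherical mean of `log max (‖f₀‖, ‖f₁‖)`. Up to bounded terms it is the characteristic
function of `f₁ / f₀`, and it is monotone in the radius. The convention `log 0 = 0` makes the
maximum wrong at some zeros of `f₀` and `f₁`, which form a null set. -/
noncomputable def maxMean (f₀ f₁ : CSpace m → ℂ) (r : ℝ) : ℝ :=
  sphereIntegral (fun z => max (log ‖f₀ z‖) (log ‖f₁ z‖)) r

theorem circleAverage_log_norm_add_mul {a b : ℂ} (ha : a ≠ 0) (hb : b ≠ 0) :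
    circleAverage (fun w => log ‖a + w * b‖) 0 1 = max (log ‖a‖) (log ‖b‖) := by
  have h1 : ∀ w : ℂ, a + w * b = (w + a / b) * b := by intro w; field_simp; ring
  simp_rw [h1]
  rw [Entire.circleAverage_log_norm_mul (φ := fun w => w + a / b) (ψ := fun _ => b) (by fun_prop)
    (by fun_prop) (x := 1 - a / b) (y := 0) (by simp) hb one_pos,
    circleAverage_log_norm_add_const_eq_posLog, circleAverage_const, posLog, norm_div,
    log_div (norm_ne_zero_iff.2 ha) (norm_ne_zero_iff.2 hb), ← max_add_add_right, zero_add,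
    sub_add_cancel, max_comm]

theorem sphereIntegrable_max (hm : 0 < m) (h₀ : Differentiable ℂ f₀) (h₁ : Differentiable ℂ f₁)
    (h₀0 : f₀ 0 ≠ 0) (h₁0 : f₁ 0 ≠ 0) {r : ℝ} (hr : 0 < r) :
    SphereIntegrable (fun z => max (log ‖f₀ z‖) (log ‖f₁ z‖)) r :=
  (Entire.sphereIntegrable_log_norm hm h₀ h₀0 hr).sup
    (Entire.sphereIntegrable_log_norm hm h₁ h₁0 hr)

/-- Monotonicity follows from the average `log max (|a|, |b|) = ⨍ log |a + e^{iθ} b| dθ`, since each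
`f₀ + e^{iθ} f₁` is entire. -/
theorem maxMean_mono (hm : 0 < m) (h₀ : Differentiable ℂ f₀) (h₁ : Differentiable ℂ f₁)
    (h₀0 : f₀ 0 ≠ 0) (h₁0 : f₁ 0 ≠ 0) {r R : ℝ} (hr : 0 < r) (hrR : r ≤ R) :
    maxMean f₀ f₁ r ≤ maxMean f₀ f₁ R := by
  have hR := hr.trans_le hrR
  obtain ⟨M₀, hM₀⟩ := (isCompact_closedBall (0 : CSpace m) R).exists_bound_of_continuousOn
    h₀.continuous.continuousOn
  obtain ⟨M₁, hM₁⟩ := (isCompact_closedBall (0 : CSpace m) R).exists_bound_of_continuousOn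
    h₁.continuous.continuousOn
  set M := M₀ + M₁
  have hM : ∀ z, ‖z‖ ≤ R → ∀ w : ℂ, ‖w‖ = 1 → log ‖f₀ z + w * f₁ z‖ ≤ M := by
    intro z hz w hw
    refine (log_le_self (norm_nonneg _)).trans ((norm_add_le _ _).trans ?_)
    rw [norm_mul, hw, one_mul]
    exact add_le_add (hM₀ z (by simpa using hz)) (hM₁ z (by simpa using hz))
  have hMmax : ∀ z, ‖z‖ ≤ R → max (log ‖f₀ z‖) (log ‖f₁ z‖) ≤ M := by
    intro z hz
    have e0 := hM₀ z (by simpa using hz)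
    have e1 := hM₁ z (by simpa using hz)
    refine max_le ((log_le_self (norm_nonneg _)).trans ?_)
      ((log_le_self (norm_nonneg _)).trans ?_)
    · linarith [norm_nonneg (f₁ z)]
    · linarith [norm_nonneg (f₀ z)]
  have hrep : ∀ ρ : ℝ, 0 < ρ → ρ ≤ R →
      ENNReal.ofReal (M - maxMean f₀ f₁ ρ) = ∫⁻ θ, ∫⁻ ξ : Metric.sphere (0 : CSpace m) 1,
        ENNReal.ofReal (M - log ‖f₀ (ρ • (ξ : CSpace m)) +
          circleMap 0 1 θ * f₁ (ρ • (ξ : CSpace m))‖) ∂unitSphereMeasure m ∂angleMeasure := by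
    intro ρ hρ hρR
    have hmeas : Measurable (Function.uncurry fun (θ : ℝ) (ξ : Metric.sphere (0 : CSpace m) 1) =>
        ENNReal.ofReal (M - log ‖f₀ (ρ • (ξ : CSpace m)) +
          circleMap 0 1 θ * f₁ (ρ • (ξ : CSpace m))‖)) := by
      have hc : Continuous fun p : ℝ × Metric.sphere (0 : CSpace m) 1 =>
          f₀ (ρ • (p.2 : CSpace m)) + circleMap 0 1 p.1 * f₁ (ρ • (p.2 : CSpace m)) := by
        have := h₀.continuous
        have := h₁.continuous
        unfold circleMap
        fun_prop
      have := hc.measurable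
      unfold Function.uncurry
      fun_prop
    rw [lintegral_lintegral_swap hmeas.aemeasurable, maxMean, ofReal_sub_sphereIntegral hm
      (sphereIntegrable_max hm h₀ h₁ h₀0 h₁0 hρ) hρ.le fun z hz => hMmax z (hz.trans hρR)]
    refine lintegral_congr_ae ?_
    filter_upwards [Entire.ae_sphere_ne_zero hm h₀ h₀0 hρ.ne',
      Entire.ae_sphere_ne_zero hm h₁ h₁0 hρ.ne'] with ξ e0 e1
    rw [← circleAverage_log_norm_add_mul e0 e1]
    refine (lintegral_angle_eq_ofReal_sub
      (v := fun w => log ‖f₀ (ρ • (ξ : CSpace m)) + w * f₁ (ρ • (ξ : CSpace m))‖)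
      (Entire.circleIntegrable_log_norm (by fun_prop) 1) fun w hw => ?_).symm
    exact hM _ ((norm_real_smul_sphere hρ.le ξ).trans_le hρR) w (by simpa using hw)
  have h : ENNReal.ofReal (M - maxMean f₀ f₁ R) ≤ ENNReal.ofReal (M - maxMean f₀ f₁ r) := by
    rw [hrep R hR le_rfl, hrep r hr hrR]
    refine lintegral_mono fun θ => ?_
    exact Entire.lintegral_sphere_sub_log_anti hm (F := fun z => f₀ z + circleMap 0 1 θ * f₁ z)
      (by fun_prop) (fun z hz => hM z hz _ (by simp)) hr hrR
  have hrM : maxMean f₀ f₁ r ≤ M := sphereIntegral_le_of_le hm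
    (sphereIntegrable_max hm h₀ h₁ h₀0 h₁0 hr) hr.le fun z hz => hMmax z (hz.trans hrR)
  rw [ENNReal.ofReal_le_ofReal_iff (sub_nonneg.2 hrM)] at h
  linarith

theorem sphereIntegral_log_norm_le_maxMean (hm : 0 < m) (h₀ : Differentiable ℂ f₀)
    (h₁ : Differentiable ℂ f₁) (h₀0 : f₀ 0 ≠ 0) (h₁0 : f₁ 0 ≠ 0) {r : ℝ} (hr : 0 < r) :
    sphereIntegral (fun z => log ‖f₀ z‖) r ≤ maxMean f₀ f₁ r ∧
      sphereIntegral (fun z => log ‖f₁ z‖) r ≤ maxMean f₀ f₁ r :=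
  ⟨integral_mono (Entire.sphereIntegrable_log_norm hm h₀ h₀0 hr)
      (sphereIntegrable_max hm h₀ h₁ h₀0 h₁0 hr) fun _ => le_max_left _ _,
    integral_mono (Entire.sphereIntegrable_log_norm hm h₁ h₁0 hr)
      (sphereIntegrable_max hm h₀ h₁ h₀0 h₁0 hr) fun _ => le_max_right _ _⟩

/-- The `L¹` mean of `log ‖f₁ / f₀‖` on spheres: a weak form of the first main theorem. -/
theorem lintegral_sphere_abs_sub_le (hm : 0 < m) (h₀ : Differentiable ℂ f₀)
    (h₁ : Differentiable ℂ f₁) (h₀0 : f₀ 0 ≠ 0) (h₁0 : f₁ 0 ≠ 0) {r : ℝ} (hr : 0 < r) :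
    ∫⁻ ξ : Metric.sphere (0 : CSpace m) 1, ENNReal.ofReal
      |log ‖f₁ (r • (ξ : CSpace m))‖ - log ‖f₀ (r • (ξ : CSpace m))‖| ∂unitSphereMeasure m ≤
      ENNReal.ofReal (2 * maxMean f₀ f₁ r - log ‖f₀ 0‖ - log ‖f₁ 0‖) := by
  have i0 := Entire.sphereIntegrable_log_norm hm h₀ h₀0 hr
  have i1 := Entire.sphereIntegrable_log_norm hm h₁ h₁0 hr
  have ib := sphereIntegrable_max hm h₀ h₁ h₀0 h₁0 hr
  have e : ∀ ξ : Metric.sphere (0 : CSpace m) 1,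
      |log ‖f₁ (r • (ξ : CSpace m))‖ - log ‖f₀ (r • (ξ : CSpace m))‖| =
      2 * max (log ‖f₀ (r • (ξ : CSpace m))‖) (log ‖f₁ (r • (ξ : CSpace m))‖) -
        log ‖f₀ (r • (ξ : CSpace m))‖ - log ‖f₁ (r • (ξ : CSpace m))‖ := by
    intro ξ
    rcases le_total (log ‖f₀ (r • (ξ : CSpace m))‖) (log ‖f₁ (r • (ξ : CSpace m))‖) with h | h
    · rw [max_eq_right h, abs_of_nonneg (by linarith)]; ring
    · rw [max_eq_left h, abs_of_nonpos (by linarith)]; ring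
  have ia : Integrable (fun ξ : Metric.sphere (0 : CSpace m) 1 =>
      |log ‖f₁ (r • (ξ : CSpace m))‖ - log ‖f₀ (r • (ξ : CSpace m))‖|) (unitSphereMeasure m) :=
    (Integrable.sub i1 i0).abs
  rw [← ofReal_integral_eq_lintegral_ofReal ia (ae_of_all _ fun _ => abs_nonneg _)]
  refine ENNReal.ofReal_le_ofReal ?_
  simp_rw [e]
  have i2 : Integrable (fun ξ : Metric.sphere (0 : CSpace m) 1 =>
      2 * max (log ‖f₀ (r • (ξ : CSpace m))‖) (log ‖f₁ (r • (ξ : CSpace m))‖))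
      (unitSphereMeasure m) := Integrable.const_mul ib 2
  have i3 : Integrable (fun ξ : Metric.sphere (0 : CSpace m) 1 =>
      2 * max (log ‖f₀ (r • (ξ : CSpace m))‖) (log ‖f₁ (r • (ξ : CSpace m))‖) -
        log ‖f₀ (r • (ξ : CSpace m))‖) (unitSphereMeasure m) := i2.sub i0
  rw [integral_sub i3 i1, integral_sub i2 i0, integral_const_mul]
  have l0 := Entire.log_norm_le_sphereIntegral hm h₀ h₀0 hr
  have l1 := Entire.log_norm_le_sphereIntegral hm h₁ h₁0 hr
  unfold sphereIntegral at l0 l1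
  unfold maxMean sphereIntegral
  linarith

/-- The characteristic function is built from `log (‖f₀‖² + ‖f₁‖²)^{1/2}`, which differs from
`log max (‖f₀‖, ‖f₁‖)` by at most `log 2`. -/
theorem exists_abs_characteristicFn_sub_maxMean_le (hm : 0 < m) (h₀ : Differentiable ℂ f₀)
    (h₁ : Differentiable ℂ f₁) (h₀0 : f₀ 0 ≠ 0) (h₁0 : f₁ 0 ≠ 0) :
    ∃ C : ℝ, ∀ r : ℝ, 0 < r → |characteristicFn f₀ f₁ r - maxMean f₀ f₁ r| ≤ C := by
  have := isProbabilityMeasure_unitSphereMeasure hm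
  set h : CSpace m → ℝ := fun z => log (√(‖f₀ z‖ ^ 2 + ‖f₁ z‖ ^ 2)) with hh
  have key : ∀ z, f₀ z ≠ 0 → f₁ z ≠ 0 →
      max (log ‖f₀ z‖) (log ‖f₁ z‖) ≤ h z ∧ h z ≤ max (log ‖f₀ z‖) (log ‖f₁ z‖) + log 2 := by
    intro z e0 e1
    have p0 := norm_pos_iff.2 e0
    have p1 := norm_pos_iff.2 e1
    refine ⟨max_le (log_le_log p0 (le_sqrt_of_sq_le (by nlinarith)))
      (log_le_log p1 (le_sqrt_of_sq_le (by nlinarith))), ?_⟩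
    have hs : √(‖f₀ z‖ ^ 2 + ‖f₁ z‖ ^ 2) ≤ max ‖f₀ z‖ ‖f₁ z‖ * 2 := by
      refine (sqrt_le_left (by positivity)).2 ?_
      nlinarith [le_max_left ‖f₀ z‖ ‖f₁ z‖, le_max_right ‖f₀ z‖ ‖f₁ z‖]
    refine (log_le_log (by positivity) hs).trans ?_
    rw [log_mul (by positivity) (by norm_num)]
    gcongr
    rcases le_total ‖f₀ z‖ ‖f₁ z‖ with hle | hle
    · rw [max_eq_right hle]; exact le_max_right _ _
    · rw [max_eq_left hle]; exact le_max_left _ _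
  have hcomp : ∀ r : ℝ, 0 < r → maxMean f₀ f₁ r ≤ sphereIntegral h r ∧
      sphereIntegral h r ≤ maxMean f₀ f₁ r + log 2 := by
    intro r hr
    have ib := sphereIntegrable_max hm h₀ h₁ h₀0 h₁0 hr
    have hae : ∀ᵐ ξ : Metric.sphere (0 : CSpace m) 1 ∂unitSphereMeasure m,
        max (log ‖f₀ (r • (ξ : CSpace m))‖) (log ‖f₁ (r • (ξ : CSpace m))‖) ≤
          h (r • (ξ : CSpace m)) ∧ h (r • (ξ : CSpace m)) ≤
        max (log ‖f₀ (r • (ξ : CSpace m))‖) (log ‖f₁ (r • (ξ : CSpace m))‖) + log 2 := by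
      filter_upwards [Entire.ae_sphere_ne_zero hm h₀ h₀0 hr.ne',
        Entire.ae_sphere_ne_zero hm h₁ h₁0 hr.ne'] with ξ e0 e1
      exact key _ e0 e1
    have ibc : Integrable (fun ξ : Metric.sphere (0 : CSpace m) 1 =>
        max (log ‖f₀ (r • (ξ : CSpace m))‖) (log ‖f₁ (r • (ξ : CSpace m))‖) + log 2)
        (unitSphereMeasure m) := Integrable.add ib (integrable_const _)
    have ih : Integrable (fun ξ : Metric.sphere (0 : CSpace m) 1 => h (r • (ξ : CSpace m)))
        (unitSphereMeasure m) := by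
      refine (integrable_of_le_of_le (g₁ := fun ξ : Metric.sphere (0 : CSpace m) 1 =>
        max (log ‖f₀ (r • (ξ : CSpace m))‖) (log ‖f₁ (r • (ξ : CSpace m))‖)) ?_
        (hae.mono fun ξ h => h.1) (hae.mono fun ξ h => h.2) ib ibc)
      have hm : Measurable h := by
        have := h₀.continuous.measurable
        have := h₁.continuous.measurable
        fun_prop
      exact (measurable_comp_sphere hm r).aestronglyMeasurable
    refine ⟨integral_mono_ae ib ih (hae.mono fun ξ h => h.1), ?_⟩
    refine (integral_mono_ae ih ibc (hae.mono fun ξ h => h.2)).trans (le_of_eq ?_)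
    rw [integral_add ib (integrable_const _), maxMean, sphereIntegral]
    simp
  refine ⟨log 2 + |sphereIntegral h 1|, fun r hr => ?_⟩
  obtain ⟨c1, c2⟩ := hcomp r hr
  have e : characteristicFn f₀ f₁ r = sphereIntegral h r - sphereIntegral h 1 := rfl
  have hl : 0 ≤ log 2 := log_nonneg (by norm_num)
  rw [e, abs_le]
  constructor
  · linarith [le_abs_self (sphereIntegral h 1)]
  · linarith [neg_abs_le (sphereIntegral h 1)]

/-- The characteristic function of a nonconstant quotient tends to infinity, at least like `log r`:
some combination `f₁ - a f₀` vanishes at the origin, and the means of `log ‖f₁ - a f₀‖` grow like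
`log r` by Jensen's formula. -/
theorem exists_log_sub_le_maxMean (hm : 0 < m) (h₀ : Differentiable ℂ f₀)
    (h₁ : Differentiable ℂ f₁) (h₀0 : f₀ 0 ≠ 0) (h₁0 : f₁ 0 ≠ 0)
    (hnc : ∀ a : ℂ, ∃ z, f₁ z ≠ a * f₀ z) :
    ∃ C : ℝ, ∀ r : ℝ, 1 ≤ r → log r - C ≤ maxMean f₀ f₁ r := by
  have := isProbabilityMeasure_unitSphereMeasure hm
  -- `f₁ - a f₀` vanishes at the origin for `a = f₁ 0 / f₀ 0`
  set a := f₁ 0 / f₀ 0 with ha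
  obtain ⟨z₀, hz₀⟩ := hnc a
  set F : CSpace m → ℂ := fun z => f₁ z - a * f₀ z with hF
  have hFd : Differentiable ℂ F := by fun_prop
  have hF0 : F 0 = 0 := by simp only [hF, ha]; field_simp; ring
  have hFz : F z₀ ≠ 0 := sub_ne_zero.2 hz₀
  refine ⟨log (1 + ‖a‖) - sphereIntegral (fun z => log ‖F z‖) 1, fun r hr => ?_⟩
  have hr0 : 0 < r := by linarith
  have h1 := Entire.sphereIntegral_log_norm_add_log_le hm hFd hF0 hFz one_pos hr
  rw [div_one] at h1
  have ib := sphereIntegrable_max hm h₀ h₁ h₀0 h₁0 hr0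
  have h2 : sphereIntegral (fun z => log ‖F z‖) r ≤ maxMean f₀ f₁ r + log (1 + ‖a‖) := by
    have e : maxMean f₀ f₁ r + log (1 + ‖a‖) = ∫ ξ : Metric.sphere (0 : CSpace m) 1,
        (max (log ‖f₀ (r • (ξ : CSpace m))‖) (log ‖f₁ (r • (ξ : CSpace m))‖) + log (1 + ‖a‖))
        ∂unitSphereMeasure m := by
      rw [integral_add ib (integrable_const _), maxMean, sphereIntegral]; simp
    rw [e]
    refine integral_mono_ae (Entire.sphereIntegrable_log_norm hm hFd hFz hr0)
      (Integrable.add ib (integrable_const _)) ?_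
    filter_upwards [Entire.ae_sphere_ne_zero hm h₀ h₀0 hr0.ne',
        Entire.ae_sphere_ne_zero hm h₁ h₁0 hr0.ne',
        Entire.ae_sphere_ne_zero hm hFd hFz hr0.ne'] with ξ e0 e1 eF
    have p0 := norm_pos_iff.2 e0
    have p1 := norm_pos_iff.2 e1
    have pF := norm_pos_iff.2 eF
    set z := r • (ξ : CSpace m)
    have hb : ‖F z‖ ≤ max ‖f₀ z‖ ‖f₁ z‖ * (1 + ‖a‖) := by
      have h3 : ‖F z‖ ≤ ‖f₁ z‖ + ‖a‖ * ‖f₀ z‖ := by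
        simp only [hF]
        refine (norm_sub_le _ _).trans ?_
        rw [norm_mul]
      have h4 := mul_le_mul_of_nonneg_left (le_max_left ‖f₀ z‖ ‖f₁ z‖) (norm_nonneg a)
      have h5 := le_max_right ‖f₀ z‖ ‖f₁ z‖
      linarith
    refine (log_le_log pF hb).trans ?_
    rw [log_mul (by positivity) (by positivity)]
    gcongr
    rcases le_total ‖f₀ z‖ ‖f₁ z‖ with hle | hle
    · rw [max_eq_right hle]; exact le_max_right _ _
    · rw [max_eq_left hle]; exact le_max_left _ _
  linarith

end MaxMean

/-! ### Integrals over spherical shells -/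

section Shells

variable {m : ℕ}

/-- The closed spherical shell `a ≤ ‖z‖ ≤ b`; a negative `a` gives a ball. -/
def shell (m : ℕ) (a b : ℝ) : Set (CSpace m) := {z | a ≤ ‖z‖ ∧ ‖z‖ ≤ b}

theorem measurableSet_shell (a b : ℝ) : MeasurableSet (shell m a b) :=
  (measurableSet_le measurable_const measurable_norm).inter
    (measurableSet_le measurable_norm measurable_const)

theorem shell_mono {a b a' b' : ℝ} (ha : a' ≤ a) (hb : b ≤ b') : shell m a b ⊆ shell m a' b' :=
  fun _ hz => ⟨ha.trans hz.1, hz.2.trans hb⟩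

theorem volume_shell_lt_top (a b : ℝ) : volume (shell m a b) < ⊤ := by
  refine lt_of_le_of_lt (measure_mono fun z hz => ?_)
    (measure_closedBall_lt_top (x := (0 : CSpace m)) (r := b))
  simpa using hz.2

theorem add_mem_shell {a b t : ℝ} {z v : CSpace m} (hz : z ∈ shell m a b) (hv : ‖v‖ ≤ t) :
    z + v ∈ shell m (a - t) (b + t) := by
  have h1 := norm_add_le z v
  have h2 : ‖z‖ ≤ ‖z + v‖ + ‖v‖ := by simpa using norm_sub_le (z + v) v
  exact ⟨by linarith [hz.1], by linarith [hz.2]⟩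

/-- Translating a shell by a vector of norm at most `t` keeps it inside the shell enlarged by `t`.
-/
theorem setLIntegral_shell_le_translate {G : CSpace m → ENNReal} {a b t : ℝ} {v : CSpace m}
    (hv : ‖v‖ ≤ t) :
    ∫⁻ z in shell m a b, G (z + v) ≤ ∫⁻ z in shell m (a - t) (b + t), G z := by
  rw [← lintegral_indicator (measurableSet_shell _ _), ← lintegral_indicator
    (measurableSet_shell _ _), ← lintegral_add_right_eq_self (μ := (volume : Measure (CSpace m)))
      ((shell m (a - t) (b + t)).indicator G) v]
  refine lintegral_mono fun z => ?_
  by_cases hz : z ∈ shell m a b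
  · rw [indicator_of_mem hz, indicator_of_mem (add_mem_shell hz hv)]
  · rw [indicator_of_notMem hz]; exact zero_le

theorem setLIntegral_shell_translate_ge {G : CSpace m → ENNReal} {a b t : ℝ} {v : CSpace m}
    (hv : ‖v‖ ≤ t) :
    ∫⁻ z in shell m a b, G z ≤ ∫⁻ z in shell m (a - t) (b + t), G (z + v) := by
  have h := setLIntegral_shell_le_translate (G := fun z => G (z + v)) (a := a) (b := b) (v := -v)
    (by simpa using hv)
  simpa using h

theorem nonempty_unitSphere (hm : 0 < m) : Nonempty (Metric.sphere (0 : CSpace m) 1) := by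
  have := nontrivial_CSpace hm
  obtain ⟨x, hx⟩ := exists_norm_eq (CSpace m) (zero_le_one (α := ℝ))
  exact ⟨⟨x, by simpa using hx⟩⟩

theorem lintegral_mul_radial (hm : 0 < m) {F k : CSpace m → ENNReal} (hF : Measurable F)
    (hk : Measurable k) (hrad : ∀ z z', ‖z‖ = ‖z'‖ → k z = k z')
    (ξ₀ : Metric.sphere (0 : CSpace m) 1) :
    ∫⁻ z, F z * k z = sphereArea m * ∫⁻ r in Ioi (0 : ℝ),
      ENNReal.ofReal (r ^ (Module.finrank ℝ (CSpace m) - 1)) *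
        (k (r • (ξ₀ : CSpace m)) * ∫⁻ ξ : Metric.sphere (0 : CSpace m) 1, F (r • (ξ : CSpace m))
          ∂unitSphereMeasure m) := by
  rw [lintegral_polar hm (F := fun z => F z * k z) (hF.mul hk)]
  congr 1
  refine setLIntegral_congr_fun measurableSet_Ioi fun r hr => ?_
  have hr0 : (0 : ℝ) ≤ r := le_of_lt hr
  have e : ∀ ξ : Metric.sphere (0 : CSpace m) 1,
      k (r • (ξ : CSpace m)) = k (r • (ξ₀ : CSpace m)) := fun ξ =>
    hrad _ _ (by rw [norm_real_smul_sphere hr0, norm_real_smul_sphere hr0])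
  simp only [e]
  rw [lintegral_mul_const _ (measurable_comp_sphere hF r)]
  ring

/-- A lower bound for the spherical means of `F` gives one for its integral against a radial weight.
-/
theorem lintegral_mul_radial_ge (hm : 0 < m) {F k : CSpace m → ENNReal} (hF : Measurable F)
    (hk : Measurable k) (hrad : ∀ z z', ‖z‖ = ‖z'‖ → k z = k z') {K : ENNReal}
    (hK : ∀ z : CSpace m, z ≠ 0 → k z ≠ 0 → K ≤
      ∫⁻ ξ : Metric.sphere (0 : CSpace m) 1, F (‖z‖ • (ξ : CSpace m)) ∂unitSphereMeasure m) :
    K * ∫⁻ z, k z ≤ ∫⁻ z, F z * k z := by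
  have := isProbabilityMeasure_unitSphereMeasure hm
  obtain ⟨ξ₀⟩ := nonempty_unitSphere hm
  rw [← lintegral_const_mul _ hk, lintegral_mul_radial hm hF hk hrad ξ₀,
    lintegral_mul_radial hm measurable_const hk hrad ξ₀]
  gcongr 1
  refine setLIntegral_mono' measurableSet_Ioi fun r hr => ?_
  gcongr 1
  have hr0 : (0 : ℝ) < r := hr
  have hn := norm_real_smul_sphere hr0.le ξ₀
  by_cases h0 : k (r • (ξ₀ : CSpace m)) = 0
  · rw [h0]; simp
  · have := hK (r • (ξ₀ : CSpace m)) (fun h => by rw [h, norm_zero] at hn; linarith) h0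
    rw [hn] at this
    gcongr 1
    simpa using this

theorem setLIntegral_shell_le (hm : 0 < m) {F : CSpace m → ENNReal} (hF : Measurable F) {a b : ℝ}
    {K : ENNReal} (hK : ∀ r : ℝ, 0 < r → r ≤ b →
      ∫⁻ ξ : Metric.sphere (0 : CSpace m) 1, F (r • (ξ : CSpace m)) ∂unitSphereMeasure m ≤ K) :
    ∫⁻ z in shell m a b, F z ≤ K * volume (shell m a b) := by
  have := isProbabilityMeasure_unitSphereMeasure hm
  obtain ⟨ξ₀⟩ := nonempty_unitSphere hm
  set k : CSpace m → ENNReal := (shell m a b).indicator 1 with hk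
  have hkm : Measurable k := measurable_one.indicator (measurableSet_shell a b)
  have hrad : ∀ z z', ‖z‖ = ‖z'‖ → k z = k z' := by
    intro z z' h
    simp only [hk, indicator, shell, mem_ofPred_eq, h, Pi.one_apply]
  have e1 : ∫⁻ z in shell m a b, F z = ∫⁻ z, F z * k z := by
    rw [← lintegral_indicator (measurableSet_shell a b)]
    refine lintegral_congr fun z => ?_
    by_cases hz : z ∈ shell m a b <;> simp [hk, hz]
  have e2 : K * volume (shell m a b) = ∫⁻ z, K * k z := by
    rw [lintegral_const_mul _ hkm, lintegral_indicator_one (measurableSet_shell a b)]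
  rw [e1, e2, lintegral_mul_radial hm hF hkm hrad ξ₀,
    lintegral_mul_radial hm measurable_const hkm hrad ξ₀]
  gcongr 1
  refine setLIntegral_mono' measurableSet_Ioi fun r hr => ?_
  gcongr 1
  have hr0 : (0 : ℝ) < r := hr
  have hn := norm_real_smul_sphere hr0.le ξ₀
  by_cases h0 : r • (ξ₀ : CSpace m) ∈ shell m a b
  · have := hK r hr0 (by rw [← hn]; exact h0.2)
    gcongr 1
    simpa using this
  · have : k (r • (ξ₀ : CSpace m)) = 0 := indicator_of_notMem h0 _
    rw [this]; simp

theorem lintegral_comp_smul_ball {G : CSpace m → ENNReal} (hG : Measurable G) {s τ : ℝ}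
    (hs : 0 < s) :
    ∫⁻ v in Metric.ball (0 : CSpace m) (s * τ), G v =
      ENNReal.ofReal (s ^ Module.finrank ℝ (CSpace m)) *
        ∫⁻ y in Metric.ball (0 : CSpace m) τ, G (s • y) := by
  set n := Module.finrank ℝ (CSpace m)
  have hmap := Measure.map_addHaar_smul (volume : Measure (CSpace m)) hs.ne'
  have hGi : Measurable ((Metric.ball (0 : CSpace m) (s * τ)).indicator G) :=
    hG.indicator Metric.isOpen_ball.measurableSet
  have h1 : ∫⁻ y, (Metric.ball (0 : CSpace m) (s * τ)).indicator G (s • y) =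
      ENNReal.ofReal (abs (s ^ n)⁻¹) *
        ∫⁻ v, (Metric.ball (0 : CSpace m) (s * τ)).indicator G v := by
    rw [← lintegral_map hGi (by fun_prop : Measurable fun y : CSpace m => s • y), hmap,
      lintegral_smul_measure, smul_eq_mul]
  have h2 : ∀ y, (Metric.ball (0 : CSpace m) (s * τ)).indicator G (s • y) =
      (Metric.ball (0 : CSpace m) τ).indicator (fun y => G (s • y)) y := by
    intro y
    have : ‖s • y‖ = s * ‖y‖ := by rw [norm_smul, norm_of_nonneg hs.le]
    simp only [indicator, mem_ball_zero_iff, this, mul_lt_mul_iff_right₀ hs]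
  simp_rw [h2] at h1
  rw [lintegral_indicator Metric.isOpen_ball.measurableSet,
    lintegral_indicator Metric.isOpen_ball.measurableSet] at h1
  rw [h1, ← mul_assoc, ← ENNReal.ofReal_mul (by positivity), abs_of_pos (by positivity),
    mul_inv_cancel₀ (by positivity), ENNReal.ofReal_one, one_mul]

/-- The convolution of a shell with a ball is a radial function. -/
theorem setLIntegral_ball_indicator_shell_radial {a b τ κ : ℝ} {x x' : CSpace m}
    (h : ‖x‖ = ‖x'‖) :
    ∫⁻ y in Metric.ball (0 : CSpace m) τ,
      (shell m a b).indicator (1 : CSpace m → ENNReal) (x - κ • y) =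
    ∫⁻ y in Metric.ball (0 : CSpace m) τ,
      (shell m a b).indicator (1 : CSpace m → ENNReal) (x' - κ • y) := by
  obtain ⟨L, hL⟩ : ∃ L : CSpace m ≃ₗᵢ[ℝ] CSpace m, L x = x' :=
    ⟨(ℝ ∙ (x - x'))ᗮ.reflection, Submodule.reflection_sub h⟩
  have hmeas : Measurable fun y : CSpace m =>
      (shell m a b).indicator (1 : CSpace m → ENNReal) (x' - κ • y) :=
    (measurable_one.indicator (measurableSet_shell a b)).comp (by fun_prop)
  rw [← lintegral_indicator Metric.isOpen_ball.measurableSet,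
    ← lintegral_indicator Metric.isOpen_ball.measurableSet,
    ← L.measurePreserving.lintegral_comp (hmeas.indicator Metric.isOpen_ball.measurableSet)]
  refine lintegral_congr fun y => ?_
  have e : x' - κ • L y = L (x - κ • y) := by rw [map_sub, hL, map_smul]
  have hsh : x' - κ • L y ∈ shell m a b ↔ x - κ • y ∈ shell m a b := by
    simp only [shell, mem_ofPred_eq, e, L.norm_map]
  have hb : L y ∈ Metric.ball (0 : CSpace m) τ ↔ y ∈ Metric.ball (0 : CSpace m) τ := by
    simp only [mem_ball_zero_iff, L.norm_map]
  by_cases h1 : y ∈ Metric.ball (0 : CSpace m) τ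
  · rw [indicator_of_mem h1, indicator_of_mem (hb.2 h1)]
    by_cases h2 : x - κ • y ∈ shell m a b
    · rw [indicator_of_mem h2, indicator_of_mem (hsh.2 h2)]
      rfl
    · rw [indicator_of_notMem h2, indicator_of_notMem (mt hsh.1 h2)]
  · rw [indicator_of_notMem h1, indicator_of_notMem (mt hb.1 h1)]

/-- Averaging a function over a shell and over balls centred in the shell, from below: only its
spherical means enter. -/
theorem lintegral_ball_shell_ge (hm : 0 < m) {p : CSpace m → ENNReal} (hp : Measurable p)
    {a b τ κ : ℝ} (hκ : 0 ≤ κ) {K : ENNReal}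
    (hK : ∀ r : ℝ, 0 < r → r ≤ b + κ * τ → K ≤
      ∫⁻ ξ : Metric.sphere (0 : CSpace m) 1, p (r • (ξ : CSpace m)) ∂unitSphereMeasure m) :
    K * (volume (Metric.ball (0 : CSpace m) τ) * volume (shell m a b)) ≤
      ∫⁻ y in Metric.ball (0 : CSpace m) τ, ∫⁻ z in shell m a b, p (z + κ • y) := by
  set χ : CSpace m → ENNReal := (shell m a b).indicator 1 with hχ
  have hχm : Measurable χ := measurable_one.indicator (measurableSet_shell a b)
  set k : CSpace m → ENNReal := fun x => ∫⁻ y in Metric.ball (0 : CSpace m) τ, χ (x - κ • y) with hk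
  have hjoint : Measurable (Function.uncurry fun x y : CSpace m => χ (x - κ • y)) :=
    hχm.comp (by fun_prop : Measurable fun q : CSpace m × CSpace m => q.1 - κ • q.2)
  have hkm : Measurable k := hjoint.lintegral_prod_right'
  have hjointp : Measurable (Function.uncurry fun x y : CSpace m => p x * χ (x - κ • y)) :=
    (hp.comp measurable_fst).mul hjoint
  have e1 : ∫⁻ y in Metric.ball (0 : CSpace m) τ, ∫⁻ z in shell m a b, p (z + κ • y) =
      ∫⁻ x, p x * k x := by
    have e2 : ∀ y : CSpace m, ∫⁻ z in shell m a b, p (z + κ • y) = ∫⁻ x, p x * χ (x - κ • y) := by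
      intro y
      rw [← lintegral_indicator (measurableSet_shell a b),
        ← lintegral_add_right_eq_self (μ := (volume : Measure (CSpace m)))
          (fun x => p x * χ (x - κ • y)) (κ • y)]
      refine lintegral_congr fun z => ?_
      simp only [add_sub_cancel_right]
      by_cases hz : z ∈ shell m a b <;> simp [hχ, hz]
    simp_rw [e2]
    rw [← lintegral_lintegral_swap (μ := (volume : Measure (CSpace m)))
      (f := fun x y => p x * χ (x - κ • y)) hjointp.aemeasurable]
    refine lintegral_congr fun x => ?_
    rw [lintegral_const_mul _ (by fun_prop)]
  have e3 : ∫⁻ x, k x = volume (Metric.ball (0 : CSpace m) τ) * volume (shell m a b) := by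
    simp only [hk]
    rw [lintegral_lintegral_swap hjoint.aemeasurable]
    have : ∀ y : CSpace m, ∫⁻ x, χ (x - κ • y) = volume (shell m a b) := by
      intro y
      rw [lintegral_sub_right_eq_self (μ := (volume : Measure (CSpace m))) χ (κ • y),
        lintegral_indicator_one (measurableSet_shell a b)]
    simp_rw [this]
    rw [setLIntegral_const, mul_comm]
  rw [e1, ← e3]
  refine lintegral_mul_radial_ge hm hp hkm
    (fun x x' h => setLIntegral_ball_indicator_shell_radial h) fun z hz0 hz => ?_
  refine hK _ (norm_pos_iff.2 hz0) ?_
  by_contra hcon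
  refine hz ?_
  simp only [hk]
  rw [setLIntegral_eq_zero_iff Metric.isOpen_ball.measurableSet (by fun_prop)]
  refine ae_of_all _ fun y hy => indicator_of_notMem (fun hmem => hcon ?_) _
  have h1 : ‖z‖ ≤ ‖z - κ • y‖ + ‖κ • y‖ := by simpa using norm_add_le (z - κ • y) (κ • y)
  have h2 : ‖κ • y‖ ≤ κ * τ := by
    rw [norm_smul, norm_of_nonneg hκ]
    exact mul_le_mul_of_nonneg_left (le_of_lt (by simpa using hy)) hκ
  linarith [hmem.2]

end Shells

/-! ### The difference estimate on shells -/

section ShellEstimate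

variable {m : ℕ} {f₀ f₁ : CSpace m → ℂ}

/-- The function `log ‖f₁ / f₀‖`, written as a difference. Its values at the zeros of `f₀` and `f₁`
are meaningless, but these form a null set in space and on every sphere. -/
noncomputable def logQuot (f₀ f₁ : CSpace m → ℂ) (z : CSpace m) : ℝ := log ‖f₁ z‖ - log ‖f₀ z‖

theorem measurable_logQuot (h₀ : Differentiable ℂ f₀) (h₁ : Differentiable ℂ f₁) :
    Measurable (logQuot f₀ f₁) :=
  (Entire.measurable_log_norm h₁).sub (Entire.measurable_log_norm h₀)

theorem measurable_logQuot_diff (h₀ : Differentiable ℂ f₀) (h₁ : Differentiable ℂ f₁) :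
    Measurable fun q : CSpace m × CSpace m =>
      ENNReal.ofReal |logQuot f₀ f₁ (q.1 + q.2) - logQuot f₀ f₁ q.1| := by
  have h := measurable_logQuot h₀ h₁
  have h1 : Measurable fun q : CSpace m × CSpace m => logQuot f₀ f₁ (q.1 + q.2) :=
    h.comp (by fun_prop)
  have h2 : Measurable fun q : CSpace m × CSpace m => logQuot f₀ f₁ q.1 := h.comp (by fun_prop)
  fun_prop

/-- A fixed translation is controlled by the average over all translations of comparable length:
pass from `z` to `z + c` through a random point `z + v`. -/
theorem volume_ball_mul_lintegral_diff_le {g : CSpace m → ℝ}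
    (hg : Measurable fun q : CSpace m × CSpace m => ENNReal.ofReal |g (q.1 + q.2) - g q.1|)
    {a b ρ : ℝ} {c : CSpace m} (hc : ‖c‖ ≤ ρ) :
    volume (Metric.ball (0 : CSpace m) ρ) *
      ∫⁻ z in shell m a b, ENNReal.ofReal |g (z + c) - g z| ≤
    2 * ∫⁻ v in Metric.ball (0 : CSpace m) (2 * ρ),
      ∫⁻ z in shell m (a - ρ) (b + ρ), ENNReal.ofReal |g (z + v) - g z| := by
  have hρ : 0 ≤ ρ := (norm_nonneg c).trans hc
  set Φ : CSpace m → ENNReal := fun v =>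
    ∫⁻ z in shell m (a - ρ) (b + ρ), ENNReal.ofReal |g (z + v) - g z| with hΦ
  have hΦm : Measurable Φ := by
    have := hg.comp (by fun_prop : Measurable fun q : CSpace m × CSpace m => (q.2, q.1))
    exact this.lintegral_prod_right'
  have hv : ∀ v ∈ Metric.ball (0 : CSpace m) ρ,
      ∫⁻ z in shell m a b, ENNReal.ofReal |g (z + c) - g z| ≤ Φ v + Φ (c - v) := by
    intro v hv
    have hv' : ‖v‖ ≤ ρ := le_of_lt (by simpa using hv)
    calc _ ≤ ∫⁻ z in shell m a b, (ENNReal.ofReal |g (z + v) - g z| +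
          ENNReal.ofReal |g ((z + v) + (c - v)) - g (z + v)|) := by
          refine lintegral_mono fun z => ?_
          rw [← ENNReal.ofReal_add (abs_nonneg _) (abs_nonneg _)]
          refine ENNReal.ofReal_le_ofReal ?_
          have e : z + v + (c - v) = z + c := by abel
          rw [e]
          linarith [abs_sub_le (g (z + c)) (g (z + v)) (g z)]
      _ = (∫⁻ z in shell m a b, ENNReal.ofReal |g (z + v) - g z|) +
          ∫⁻ z in shell m a b, ENNReal.ofReal |g ((z + v) + (c - v)) - g (z + v)| :=
          lintegral_add_left (hg.comp (by fun_prop : Measurable fun z : CSpace m => (z, v))) _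
      _ ≤ _ := by
          gcongr
          · exact lintegral_mono_set (shell_mono (by linarith) (by linarith))
          · exact setLIntegral_shell_le_translate
              (G := fun z => ENNReal.ofReal |g (z + (c - v)) - g z|) hv'
  calc _ = ∫⁻ v in Metric.ball (0 : CSpace m) ρ,
        ∫⁻ z in shell m a b, ENNReal.ofReal |g (z + c) - g z| := by
        rw [setLIntegral_const, mul_comm]
    _ ≤ ∫⁻ v in Metric.ball (0 : CSpace m) ρ, (Φ v + Φ (c - v)) :=
        setLIntegral_mono' Metric.isOpen_ball.measurableSet hv
    _ = (∫⁻ v in Metric.ball (0 : CSpace m) ρ, Φ v) +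
        ∫⁻ v in Metric.ball (0 : CSpace m) ρ, Φ (c - v) := lintegral_add_left hΦm _
    _ ≤ _ := by
        rw [two_mul]
        refine add_le_add (lintegral_mono_set (Metric.ball_subset_ball (by linarith))) ?_
        · rw [← lintegral_indicator Metric.isOpen_ball.measurableSet,
            ← lintegral_indicator Metric.isOpen_ball.measurableSet,
            ← lintegral_sub_left_eq_self (μ := (volume : Measure (CSpace m)))
              ((Metric.ball (0 : CSpace m) (2 * ρ)).indicator Φ) c]
          refine lintegral_mono fun v => ?_
          by_cases hvm : v ∈ Metric.ball (0 : CSpace m) ρ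
          · rw [indicator_of_mem hvm, indicator_of_mem]
            rw [mem_ball_zero_iff] at hvm ⊢
            linarith [norm_sub_le c v]
          · rw [indicator_of_notMem hvm]; exact zero_le

/-- Averages over balls of the Jensen defect `⨍ log ‖F(z + 12 e^{iθ} y)‖ dθ - log ‖F z‖`, which
counts zeros of `F` near `z`, are controlled by the spherical means of `log ‖F‖`. -/
theorem lintegral_jensen_defect_le (hm : 0 < m) {F : CSpace m → ℂ} (hF : Differentiable ℂ F)
    (h0 : F 0 ≠ 0) {a b τ R : ℝ} (hR : 0 < R) (hτ : 0 ≤ τ) (hbR : b + 12 * τ ≤ R) :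
    ∫⁻ y in Metric.ball (0 : CSpace m) τ, ∫⁻ z in shell m a b, ENNReal.ofReal
      (circleAverage (fun w => log ‖F (z + w • y)‖) 0 12 - log ‖F z‖) ≤
    volume (Metric.ball (0 : CSpace m) τ) * volume (shell m a b) *
      ENNReal.ofReal (sphereIntegral (fun z => log ‖F z‖) R - log ‖F 0‖) := by
  obtain ⟨M, _, hM⟩ := Entire.exists_log_norm_le hF R
  set p : CSpace m → ENNReal := fun z => ENNReal.ofReal (M - log ‖F z‖) with hp
  have hpm : Measurable p := by
    have := Entire.measurable_log_norm hF
    fun_prop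
  set V := volume (Metric.ball (0 : CSpace m) τ) * volume (shell m a b) with hV
  have hVtop : V ≠ ⊤ := ENNReal.mul_ne_top measure_ball_lt_top.ne (volume_shell_lt_top a b).ne
  set U := sphereIntegral (fun z => log ‖F z‖) R
  have hUM : U ≤ M := sphereIntegral_le_of_le hm (Entire.sphereIntegrable_log_norm hm hF h0 hR)
    hR.le hM
  have hUl : log ‖F 0‖ ≤ U := Entire.log_norm_le_sphereIntegral hm hF h0 hR
  -- lower bound for the averages of `p` over circles
  have hlow : ENNReal.ofReal (M - U) * V ≤ ∫⁻ y in Metric.ball (0 : CSpace m) τ,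
      ∫⁻ z in shell m a b, ∫⁻ θ, p (z + circleMap 0 12 θ • y) ∂angleMeasure := by
    have hcm : Measurable fun q : ℝ × CSpace m × CSpace m => circleMap 0 12 q.1 • q.2.2 := by
      have : Continuous fun q : ℝ × CSpace m × CSpace m => circleMap 0 12 q.1 • q.2.2 := by
        unfold circleMap; fun_prop
      exact this.measurable
    have hj : Measurable fun q : ℝ × CSpace m × CSpace m =>
        p (q.2.1 + circleMap 0 12 q.1 • q.2.2) :=
      hpm.comp ((measurable_fst.comp measurable_snd).add hcm)
    -- by rotation invariance in `y`, each angle contributes as much as `θ = 0`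
    have hrot : ∀ θ : ℝ, ENNReal.ofReal (M - U) * V ≤ ∫⁻ y in Metric.ball (0 : CSpace m) τ,
        ∫⁻ z in shell m a b, p (z + circleMap 0 12 θ • y) := by
      intro θ
      have hge := lintegral_ball_shell_ge hm hpm (a := a) (b := b) (τ := τ) (κ := 12) (by norm_num)
        (K := ENNReal.ofReal (M - U)) (fun r hr hrb => by
          have hrR := hrb.trans hbR
          rw [← ofReal_sub_sphereIntegral hm (u := fun z => log ‖F z‖)
            (Entire.sphereIntegrable_log_norm hm hF h0 hr) hr.le (fun z hz => hM z (hz.trans hrR))]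
          refine ENNReal.ofReal_le_ofReal ?_
          linarith [Entire.sphereIntegral_log_norm_mono hm hF h0 hr hrR])
      refine hge.trans (le_of_eq ?_)
      set L := rotationCSpace m (Circle.exp θ)
      have hm1 : Measurable fun y : CSpace m => ∫⁻ z in shell m a b, p (z + (12 : ℝ) • y) := by
        have : Measurable (Function.uncurry fun y z : CSpace m => p (z + (12 : ℝ) • y)) :=
          hpm.comp (by fun_prop : Measurable fun q : CSpace m × CSpace m => q.2 + (12 : ℝ) • q.1)
        exact this.lintegral_prod_right'
      rw [← lintegral_indicator Metric.isOpen_ball.measurableSet,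
        ← lintegral_indicator Metric.isOpen_ball.measurableSet,
        ← L.measurePreserving.lintegral_comp (hm1.indicator Metric.isOpen_ball.measurableSet)]
      refine lintegral_congr fun y => ?_
      by_cases hy : y ∈ Metric.ball (0 : CSpace m) τ
      · rw [indicator_of_mem hy, indicator_of_mem (by simpa using hy)]
        simp_rw [circleMap_zero_smul]
        rfl
      · rw [indicator_of_notMem hy, indicator_of_notMem (by simpa using hy)]
    have hz : ∀ y : CSpace m,
        ∫⁻ z in shell m a b, ∫⁻ θ, p (z + circleMap 0 12 θ • y) ∂angleMeasure =
        ∫⁻ θ, (∫⁻ z in shell m a b, p (z + circleMap 0 12 θ • y)) ∂angleMeasure := by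
      intro y
      refine lintegral_lintegral_swap (Measurable.aemeasurable ?_)
      have := hj.comp (by fun_prop : Measurable fun q : CSpace m × ℝ => (q.2, q.1, y))
      exact this
    simp_rw [hz]
    rw [lintegral_lintegral_swap]
    · calc _ = ∫⁻ _θ, ENNReal.ofReal (M - U) * V ∂angleMeasure := by simp
        _ ≤ _ := lintegral_mono hrot
    · refine Measurable.aemeasurable ?_
      have := hj.comp
        (by fun_prop : Measurable fun q : (CSpace m × ℝ) × CSpace m => (q.1.2, q.2, q.1.1))
      exact this.lintegral_prod_right'
  -- upper bound for the values of `p`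
  have hup : ∫⁻ y in Metric.ball (0 : CSpace m) τ, ∫⁻ z in shell m a b, p z ≤
      ENNReal.ofReal (M - log ‖F 0‖) * V := by
    have h1 := setLIntegral_shell_le hm hpm (a := a) (b := b) (K := ENNReal.ofReal (M - log ‖F 0‖))
      (fun r hr hrb => Entire.lintegral_sphere_sub_log_le hm hF h0 (R := r)
        (fun z hz => hM z (by linarith)) hr)
    rw [setLIntegral_const, hV, mul_comm (volume (Metric.ball _ _)), ← mul_assoc]
    gcongr
  have hsum : (∫⁻ y in Metric.ball (0 : CSpace m) τ, ∫⁻ z in shell m a b, ENNReal.ofReal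
      (circleAverage (fun w => log ‖F (z + w • y)‖) 0 12 - log ‖F z‖)) +
      ∫⁻ y in Metric.ball (0 : CSpace m) τ,
      ∫⁻ z in shell m a b, ∫⁻ θ, p (z + circleMap 0 12 θ • y) ∂angleMeasure ≤
      ∫⁻ y in Metric.ball (0 : CSpace m) τ, ∫⁻ z in shell m a b, p z := by
    have hcm : Measurable fun q : (CSpace m × CSpace m) × ℝ => circleMap 0 12 q.2 • q.1.1 := by
      have : Continuous fun q : (CSpace m × CSpace m) × ℝ => circleMap 0 12 q.2 • q.1.1 := by
        unfold circleMap; fun_prop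
      exact this.measurable
    have hj : Measurable fun q : (CSpace m × CSpace m) × ℝ =>
        p (q.1.2 + circleMap 0 12 q.2 • q.1.1) :=
      hpm.comp ((measurable_snd.comp measurable_fst).add hcm)
    have hj2 : Measurable fun q : CSpace m × CSpace m =>
        ∫⁻ θ, p (q.2 + circleMap 0 12 θ • q.1) ∂angleMeasure := hj.lintegral_prod_right'
    rw [← lintegral_add_right]
    · refine setLIntegral_mono' Metric.isOpen_ball.measurableSet fun y hy => ?_
      rw [← lintegral_add_right]
      · refine lintegral_mono_ae ?_
        filter_upwards [ae_restrict_of_ae (Entire.ae_ne_zero_CSpace hm hF h0),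
          ae_restrict_mem (measurableSet_shell a b)] with z hz hzs
        have hsl := Entire.differentiable_slice hF z y
        have hbd : ∀ w : ℂ, ‖w‖ = |12| → log ‖F (z + w • y)‖ ≤ M := by
          intro w hw
          refine hM _ ((norm_add_le _ _).trans ?_)
          rw [norm_smul, hw, abs_of_pos (by norm_num)]
          have : ‖y‖ < τ := by simpa using hy
          linarith [hzs.2]
        have hJ := Entire.log_norm_le_circleAverage hsl (by simpa using hz)
          (by norm_num : (0 : ℝ) < 12)
        simp only [zero_smul, add_zero] at hJ
        have hca : circleAverage (fun w => log ‖F (z + w • y)‖) 0 12 ≤ M :=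
          circleAverage_mono_on_of_le_circle (Entire.circleIntegrable_log_norm hsl 12)
            fun w hw => hbd w (by simpa using hw)
        have e := lintegral_angle_eq_ofReal_sub (Entire.circleIntegrable_log_norm hsl 12) hbd
        simp only [hp]
        rw [e, ← ENNReal.ofReal_add (sub_nonneg.2 hJ) (sub_nonneg.2 hca)]
        refine ENNReal.ofReal_le_ofReal ?_
        linarith
      · have := hj2.comp (by fun_prop : Measurable fun z : CSpace m => (y, z))
        exact this
    · exact hj2.lintegral_prod_right'
  have hfin : ENNReal.ofReal (M - U) * V ≠ ⊤ := ENNReal.mul_ne_top ENNReal.ofReal_ne_top hVtop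
  refine ENNReal.le_of_add_le_add_right hfin ?_
  calc _ ≤ _ := add_le_add le_rfl hlow
    _ ≤ _ := hsum
    _ ≤ _ := hup
    _ = V * ENNReal.ofReal (U - log ‖F 0‖) + ENNReal.ofReal (M - U) * V := by
        rw [mul_comm V, ← add_mul, ← ENNReal.ofReal_add (sub_nonneg.2 hUl) (sub_nonneg.2 hUM)]
        congr 2
        ring

theorem measurable_circleAverage_slice {F : CSpace m → ℂ} (hF : Differentiable ℂ F) (R : ℝ) :
    Measurable fun q : CSpace m × CSpace m =>
      circleAverage (fun w => log ‖F (q.1 + w • q.2)‖) 0 R := by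
  have hcm : Measurable fun q : (CSpace m × CSpace m) × ℝ =>
      q.1.1 + circleMap 0 R q.2 • q.1.2 := by
    have : Continuous fun q : (CSpace m × CSpace m) × ℝ =>
        q.1.1 + circleMap 0 R q.2 • q.1.2 := by
      unfold circleMap; fun_prop
    exact this.measurable
  have h := (Entire.measurable_log_norm hF).comp hcm
  have h2 := h.stronglyMeasurable.integral_prod_right'
    (ν := (volume : Measure ℝ).restrict (Ioc 0 (2 * π)))
  have h3 := h2.measurable.const_smul (2 * π)⁻¹
  convert h3 using 2 with q
  simp only [circleAverage, intervalIntegral.integral_of_le two_pi_pos.le, Pi.smul_apply]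
  rfl

/-- The one-variable estimate on the slices `w ↦ z + w y`, averaged over the base points `z` in a
shell. -/
theorem exists_lintegral_shell_slice_le (m : ℕ) : ∃ C : ℝ, 0 < C ∧
    ∀ f₀ f₁ : CSpace m → ℂ, Differentiable ℂ f₀ → Differentiable ℂ f₁ → f₀ 0 ≠ 0 → f₁ 0 ≠ 0 →
    0 < m → ∀ (a b s : ℝ) (y : CSpace m), 0 ≤ s → s ≤ 1 →
    ∫⁻ z in shell m a b, ∫⁻ w in Metric.ball (0 : ℂ) 1,
      ENNReal.ofReal |logQuot f₀ f₁ (z + w • y + s • y) - logQuot f₀ f₁ (z + w • y)| ≤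
    ENNReal.ofReal (C * s) *
      ((∫⁻ z in shell m a b, ∫⁻ w in Metric.ball (0 : ℂ) 4,
        ENNReal.ofReal |logQuot f₀ f₁ (z + w • y)|) +
      (∫⁻ z in shell m a b, ENNReal.ofReal
        (circleAverage (fun w => log ‖f₀ (z + w • y)‖) 0 12 - log ‖f₀ z‖)) +
      ∫⁻ z in shell m a b, ENNReal.ofReal
        (circleAverage (fun w => log ‖f₁ (z + w • y)‖) 0 12 - log ‖f₁ z‖)) := by
  obtain ⟨C, hC, hA⟩ := exists_lintegral_abs_log_quotient_translate_le
  refine ⟨C, hC, fun f₀ f₁ h₀ h₁ h₀0 h₁0 hm a b s y hs hs1 => ?_⟩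
  have hg := measurable_logQuot h₀ h₁
  have m1 : Measurable fun z : CSpace m => ∫⁻ w in Metric.ball (0 : ℂ) 4,
      ENNReal.ofReal |logQuot f₀ f₁ (z + w • y)| := by
    have hz : Measurable fun q : CSpace m × ℂ => q.1 + q.2 • y := by fun_prop
    have h1 := hg.comp hz
    have h2 : Measurable fun q : CSpace m × ℂ =>
        ENNReal.ofReal |(logQuot f₀ f₁ ∘ fun q : CSpace m × ℂ => q.1 + q.2 • y) q| := by fun_prop
    exact h2.lintegral_prod_right'
  have m2 : ∀ {F : CSpace m → ℂ}, Differentiable ℂ F → Measurable fun z : CSpace m =>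
      ENNReal.ofReal (circleAverage (fun w => log ‖F (z + w • y)‖) 0 12 - log ‖F z‖) := by
    intro F hF
    have h1 := (measurable_circleAverage_slice hF 12).comp
      (by fun_prop : Measurable fun z : CSpace m => (z, y))
    have h2 := Entire.measurable_log_norm hF
    exact (h1.sub h2).ennreal_ofReal
  rw [← lintegral_add_left m1, ← lintegral_add_right _ (m2 h₁),
    ← lintegral_const_mul' _ _ ENNReal.ofReal_ne_top]
  refine lintegral_mono_ae ?_
  filter_upwards [ae_restrict_of_ae (Entire.ae_ne_zero_CSpace hm h₀ h₀0),
    ae_restrict_of_ae (Entire.ae_ne_zero_CSpace hm h₁ h₁0)] with z hz0 hz1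
  have h := hA (fun w => f₀ (z + w • y)) (fun w => f₁ (z + w • y))
    (Entire.differentiable_slice h₀ z y) (Entire.differentiable_slice h₁ z y)
    (by simpa using hz0) (by simpa using hz1) s hs hs1
  have e : ∀ w : ℂ, z + (w + (s : ℂ)) • y = z + w • y + s • y := by
    intro w
    rw [add_smul, Complex.coe_smul, add_assoc]
  simp only [e, zero_smul, add_zero] at h
  exact h

/-- The mean of `|log |f₁ / f₀ (z + c)| - log |f₁ / f₀ (z)||` over a shell gains the factor
`‖c‖ / τ` when the data are taken on the shell enlarged by a multiple of `τ`. -/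
theorem exists_lintegral_shell_diff_le (m : ℕ) : ∃ C : ℝ, 0 < C ∧
    ∀ f₀ f₁ : CSpace m → ℂ, Differentiable ℂ f₀ → Differentiable ℂ f₁ → f₀ 0 ≠ 0 → f₁ 0 ≠ 0 →
    0 < m → ∀ (c : CSpace m) (a b ρ τ : ℝ), 0 < ρ → ‖c‖ ≤ ρ → 2 * ρ ≤ τ → 0 < b →
    ∫⁻ z in shell m a b, ENNReal.ofReal |logQuot f₀ f₁ (z + c) - logQuot f₀ f₁ z| ≤
    ENNReal.ofReal (C * (ρ / τ)) * (volume (shell m (a - 20 * τ) (b + 20 * τ)) *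
      ENNReal.ofReal (2 * maxMean f₀ f₁ (b + 20 * τ) - log ‖f₀ 0‖ - log ‖f₁ 0‖)) := by
  obtain ⟨C, hC, hA⟩ := exists_lintegral_shell_slice_le m
  set n := Module.finrank ℝ (CSpace m)
  set v1 := volume (Metric.ball (0 : ℂ) 1) with hv1
  set v4 := volume (Metric.ball (0 : ℂ) 4) with hv4
  have hv1pos : v1 ≠ 0 := (Metric.measure_ball_pos volume _ one_pos).ne'
  have hv1top : v1 ≠ ⊤ := measure_ball_lt_top.ne
  have hv4top : v4 ≠ ⊤ := measure_ball_lt_top.ne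
  -- the constant collects the factor `2 ^ (n + 1)` from comparing balls and the areas of discs
  set κ : ENNReal := v1⁻¹ * (2 * ENNReal.ofReal (2 ^ n) * (v4 + 2) * ENNReal.ofReal (2 * C)) with hκ
  have hκtop : κ ≠ ⊤ := by
    refine ENNReal.mul_ne_top (ENNReal.inv_ne_top.2 hv1pos) (ENNReal.mul_ne_top
      (ENNReal.mul_ne_top (ENNReal.mul_ne_top (by norm_num) ENNReal.ofReal_ne_top) ?_)
      ENNReal.ofReal_ne_top)
    exact ENNReal.add_ne_top.2 ⟨hv4top, by norm_num⟩
  refine ⟨κ.toReal + 1, by positivity, fun f₀ f₁ h₀ h₁ h₀0 h₁0 hm c a b ρ τ hρ hc hρτ hb => ?_⟩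
  have hτ : 0 < τ := by linarith
  set s := 2 * ρ / τ with hs
  have hs0 : 0 < s := by positivity
  have hs1 : s ≤ 1 := (div_le_one hτ).2 hρτ
  set g := logQuot f₀ f₁ with hg
  have hgm := measurable_logQuot h₀ h₁
  have hgd := measurable_logQuot_diff h₀ h₁
  set R := b + 20 * τ with hR
  have hRpos : 0 < R := by positivity
  set K : ENNReal := ENNReal.ofReal (2 * maxMean f₀ f₁ R - log ‖f₀ 0‖ - log ‖f₁ 0‖) with hK
  set VS := volume (shell m (a - 20 * τ) (b + 20 * τ)) with hVS
  set Vb := volume (Metric.ball (0 : CSpace m) τ) with hVb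
  have hVb0 : Vb ≠ 0 := (Metric.measure_ball_pos volume _ hτ).ne'
  have hVbt : Vb ≠ ⊤ := measure_ball_lt_top.ne
  set X := ∫⁻ z in shell m a b, ENNReal.ofReal |g (z + c) - g z| with hX
  set Φ : CSpace m → ENNReal := fun v =>
    ∫⁻ z in shell m (a - ρ) (b + ρ), ENNReal.ofReal |g (z + v) - g z| with hΦ
  have hΦm : Measurable Φ := by
    have := hgd.comp (by fun_prop : Measurable fun q : CSpace m × CSpace m => (q.2, q.1))
    exact this.lintegral_prod_right'
  -- the averages over the translations `s y`
  have havg_translation : Vb * X ≤ 2 * ENNReal.ofReal (2 ^ n) *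
      ∫⁻ y in Metric.ball (0 : CSpace m) τ, Φ (s • y) := by
    have h1 := volume_ball_mul_lintegral_diff_le hgd (a := a) (b := b) hc
    have e1 : 2 * ρ = s * τ := by rw [hs]; field_simp
    have e2 : ρ = s / 2 * τ := by rw [hs]; field_simp
    have e3 : volume (Metric.ball (0 : CSpace m) ρ) = ENNReal.ofReal ((s / 2) ^ n) * Vb := by
      rw [e2, Measure.addHaar_ball_mul_of_pos _ _ (by positivity)]
    have h2 : ∫⁻ v in Metric.ball (0 : CSpace m) (2 * ρ), Φ v = ENNReal.ofReal (s ^ n) *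
        ∫⁻ y in Metric.ball (0 : CSpace m) τ, Φ (s • y) := by
      rw [e1]; exact lintegral_comp_smul_ball hΦm hs0
    have h3 : ENNReal.ofReal ((s / 2) ^ n) * (Vb * X) ≤ 2 * (ENNReal.ofReal (s ^ n) *
        ∫⁻ y in Metric.ball (0 : CSpace m) τ, Φ (s • y)) := by
      rw [← mul_assoc, ← e3, ← h2]; exact h1
    have e4 : ENNReal.ofReal (s ^ n) = ENNReal.ofReal ((s / 2) ^ n) * ENNReal.ofReal (2 ^ n) := by
      rw [← ENNReal.ofReal_mul (by positivity), ← mul_pow]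
      congr 2; ring
    rw [e4] at h3
    have hpos : ENNReal.ofReal ((s / 2) ^ n) ≠ 0 := by
      rw [Ne, ENNReal.ofReal_eq_zero, not_le]; positivity
    refine (ENNReal.mul_le_mul_iff_right hpos ENNReal.ofReal_ne_top).1 (h3.trans (le_of_eq ?_))
    ring
  -- averaging over the discs `z + w y`
  set A := shell m (a - 2 * τ) (b + 2 * τ) with hAdef
  have hw : ∀ y ∈ Metric.ball (0 : CSpace m) τ, ∀ (r : ℝ), ∀ w ∈ Metric.ball (0 : ℂ) r,
      ‖w • y‖ ≤ r * τ := by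
    intro y hy r w hwm
    rw [mem_ball_zero_iff] at hy hwm
    rw [norm_smul]
    exact mul_le_mul hwm.le hy.le (norm_nonneg _) ((norm_nonneg _).trans hwm.le)
  have havg_disc : ∀ y ∈ Metric.ball (0 : CSpace m) τ, v1 * Φ (s • y) ≤
      ∫⁻ z in A, ∫⁻ w in Metric.ball (0 : ℂ) 1,
        ENNReal.ofReal |g (z + w • y + s • y) - g (z + w • y)| := by
    intro y hy
    rw [lintegral_lintegral_swap]
    · calc v1 * Φ (s • y) = ∫⁻ _w in Metric.ball (0 : ℂ) 1, Φ (s • y) := by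
            rw [setLIntegral_const, mul_comm]
        _ ≤ _ := by
            refine setLIntegral_mono' Metric.isOpen_ball.measurableSet fun w hwm => ?_
            refine (setLIntegral_shell_translate_ge
              (G := fun z => ENNReal.ofReal |g (z + s • y) - g z|) (hw y hy 1 w hwm)).trans ?_
            exact lintegral_mono_set (shell_mono (by linarith) (by linarith))
    · have := hgd.comp (by fun_prop : Measurable fun q : CSpace m × ℂ => (q.1 + q.2 • y, s • y))
      exact this.aemeasurable
  have hKge : ∀ r : ℝ, 0 < r → r ≤ R →
      ∫⁻ ξ : Metric.sphere (0 : CSpace m) 1, ENNReal.ofReal |g (r • (ξ : CSpace m))|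
        ∂unitSphereMeasure m ≤ K := by
    intro r hr hrR
    refine (lintegral_sphere_abs_sub_le hm h₀ h₁ h₀0 h₁0 hr).trans (ENNReal.ofReal_le_ofReal ?_)
    linarith [maxMean_mono hm h₀ h₁ h₀0 h₁0 hr hrR]
  have hgabs : Measurable fun z => ENNReal.ofReal |g z| := by fun_prop
  have hmean_logQuot : ∀ y ∈ Metric.ball (0 : CSpace m) τ,
      ∫⁻ z in A, ∫⁻ w in Metric.ball (0 : ℂ) 4, ENNReal.ofReal |g (z + w • y)| ≤
      VS * K * v4 := by
    intro y hy
    rw [lintegral_lintegral_swap]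
    · calc _ ≤ ∫⁻ _w in Metric.ball (0 : ℂ) 4, VS * K := by
            refine setLIntegral_mono' Metric.isOpen_ball.measurableSet fun w hwm => ?_
            refine (setLIntegral_shell_le_translate
              (G := fun z => ENNReal.ofReal |g z|) (hw y hy 4 w hwm)).trans ?_
            refine (lintegral_mono_set (shell_mono (a' := a - 20 * τ) (b' := b + 20 * τ)
              (by linarith) (by linarith))).trans ?_
            rw [mul_comm VS]
            exact setLIntegral_shell_le hm (F := fun z => ENNReal.ofReal |g z|) (b := b + 20 * τ)
              hgabs hKge
        _ = _ := setLIntegral_const _ _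
    · have h1 := hgm.comp (by fun_prop : Measurable fun q : CSpace m × ℂ => q.1 + q.2 • y)
      have h2 : Measurable fun q : CSpace m × ℂ =>
        ENNReal.ofReal |(logQuot f₀ f₁ ∘ fun q : CSpace m × ℂ => q.1 + q.2 • y) q| := by fun_prop
      exact h2.aemeasurable
  -- `B - l_i ≤ 2 B - l₀ - l₁` for the mean `B` on the large sphere, where `l_i = log ‖f_i 0‖ ≤ B`
  have hU := sphereIntegral_log_norm_le_maxMean hm h₀ h₁ h₀0 h₁0 hRpos
  have hl0 := Entire.log_norm_le_sphereIntegral hm h₀ h₀0 hRpos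
  have hl1 := Entire.log_norm_le_sphereIntegral hm h₁ h₁0 hRpos
  have hAVS : volume A ≤ VS := measure_mono (shell_mono (by linarith) (by linarith))
  have hmean_jensen : ∀ {F : CSpace m → ℂ}, Differentiable ℂ F → F 0 ≠ 0 →
      sphereIntegral (fun z => log ‖F z‖) R - log ‖F 0‖ ≤
        2 * maxMean f₀ f₁ R - log ‖f₀ 0‖ - log ‖f₁ 0‖ →
      ∫⁻ y in Metric.ball (0 : CSpace m) τ, ∫⁻ z in A, ENNReal.ofReal
        (circleAverage (fun w => log ‖F (z + w • y)‖) 0 12 - log ‖F z‖) ≤ Vb * (VS * K) := by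
    intro F hF hF0 hle
    refine (lintegral_jensen_defect_le hm hF hF0 hRpos hτ.le (by linarith)).trans ?_
    rw [mul_assoc]
    gcongr
    exact ENNReal.ofReal_le_ofReal hle
  have hJm : ∀ {F : CSpace m → ℂ}, Differentiable ℂ F → Measurable fun y : CSpace m =>
      ∫⁻ z in A, ENNReal.ofReal
        (circleAverage (fun w => log ‖F (z + w • y)‖) 0 12 - log ‖F z‖) := by
    intro F hF
    have h1 := (measurable_circleAverage_slice hF 12).comp
      (by fun_prop : Measurable fun q : CSpace m × CSpace m => (q.2, q.1))
    have h2 := (Entire.measurable_log_norm hF).comp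
      (measurable_snd : Measurable fun q : CSpace m × CSpace m => q.2)
    exact (h1.sub h2).ennreal_ofReal.lintegral_prod_right'
  have hcombine : v1 * ∫⁻ y in Metric.ball (0 : CSpace m) τ, Φ (s • y) ≤
      ENNReal.ofReal (C * s) * (Vb * (VS * K) * (v4 + 2)) := by
    rw [← lintegral_const_mul' _ _ hv1top]
    calc _ ≤ ∫⁻ y in Metric.ball (0 : CSpace m) τ, ENNReal.ofReal (C * s) *
          (VS * K * v4 +
          (∫⁻ z in A, ENNReal.ofReal
            (circleAverage (fun w => log ‖f₀ (z + w • y)‖) 0 12 - log ‖f₀ z‖)) +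
          ∫⁻ z in A, ENNReal.ofReal
            (circleAverage (fun w => log ‖f₁ (z + w • y)‖) 0 12 - log ‖f₁ z‖)) := by
          refine setLIntegral_mono' Metric.isOpen_ball.measurableSet fun y hy => ?_
          refine (havg_disc y hy).trans ((hA f₀ f₁ h₀ h₁ h₀0 h₁0 hm _ _ s y hs0.le hs1).trans ?_)
          gcongr 3
          exact hmean_logQuot y hy
      _ = ENNReal.ofReal (C * s) * (VS * K * v4 * Vb +
          (∫⁻ y in Metric.ball (0 : CSpace m) τ, ∫⁻ z in A, ENNReal.ofReal
            (circleAverage (fun w => log ‖f₀ (z + w • y)‖) 0 12 - log ‖f₀ z‖)) +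
          ∫⁻ y in Metric.ball (0 : CSpace m) τ, ∫⁻ z in A, ENNReal.ofReal
            (circleAverage (fun w => log ‖f₁ (z + w • y)‖) 0 12 - log ‖f₁ z‖)) := by
          rw [lintegral_const_mul' _ _ ENNReal.ofReal_ne_top, lintegral_add_right _ (hJm h₁),
            lintegral_add_right _ (hJm h₀), setLIntegral_const]
      _ ≤ ENNReal.ofReal (C * s) * (VS * K * v4 * Vb + Vb * (VS * K) + Vb * (VS * K)) := by
          gcongr
          · exact hmean_jensen h₀ h₀0 (by linarith [hU.1])
          · exact hmean_jensen h₁ h₁0 (by linarith [hU.2])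
      _ = _ := by ring
  have hCs : ENNReal.ofReal (C * s) = ENNReal.ofReal (2 * C) * ENNReal.ofReal (ρ / τ) := by
    rw [← ENNReal.ofReal_mul (by positivity), hs]
    congr 1; ring
  have fin : v1 * Vb * X ≤ v1 * Vb * (κ * ENNReal.ofReal (ρ / τ) * (VS * K)) := by
    calc v1 * Vb * X = v1 * (Vb * X) := mul_assoc _ _ _
      _ ≤ v1 * (2 * ENNReal.ofReal (2 ^ n) *
          ∫⁻ y in Metric.ball (0 : CSpace m) τ, Φ (s • y)) := by gcongr
      _ = 2 * ENNReal.ofReal (2 ^ n) *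
          (v1 * ∫⁻ y in Metric.ball (0 : CSpace m) τ, Φ (s • y)) := by ring
      _ ≤ 2 * ENNReal.ofReal (2 ^ n) *
          (ENNReal.ofReal (C * s) * (Vb * (VS * K) * (v4 + 2))) := by gcongr
      _ = (v1 * v1⁻¹) * (2 * ENNReal.ofReal (2 ^ n) *
          (ENNReal.ofReal (2 * C) * ENNReal.ofReal (ρ / τ) * (Vb * (VS * K) * (v4 + 2)))) := by
          rw [ENNReal.mul_inv_cancel hv1pos hv1top, one_mul, hCs]
      _ = _ := by rw [hκ]; ring
  have h6 := (ENNReal.mul_le_mul_iff_right (mul_ne_zero hv1pos hVb0)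
    (ENNReal.mul_ne_top hv1top hVbt)).1 fin
  refine h6.trans ?_
  rw [ENNReal.ofReal_mul (by positivity)]
  gcongr
  exact (ENNReal.ofReal_toReal hκtop).symm.le.trans (ENNReal.ofReal_le_ofReal (by linarith))

/-- The mean over spheres of `|log |f₁ / f₀ (z + c)| - log |f₁ / f₀ (z)||`. -/
noncomputable def sphereDiff (f₀ f₁ : CSpace m → ℂ) (c : CSpace m) (r : ℝ) : ENNReal :=
  ∫⁻ ξ : Metric.sphere (0 : CSpace m) 1,
    ENNReal.ofReal |logQuot f₀ f₁ (r • (ξ : CSpace m) + c) - logQuot f₀ f₁ (r • (ξ : CSpace m))|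
    ∂unitSphereMeasure m

theorem measurable_logQuot_diff_left (h₀ : Differentiable ℂ f₀) (h₁ : Differentiable ℂ f₁)
    (c : CSpace m) :
    Measurable fun z : CSpace m => ENNReal.ofReal |logQuot f₀ f₁ (z + c) - logQuot f₀ f₁ z| := by
  have := (measurable_logQuot_diff h₀ h₁).comp
    (by fun_prop : Measurable fun z : CSpace m => (z, c))
  exact this

theorem measurable_sphereDiff (h₀ : Differentiable ℂ f₀) (h₁ : Differentiable ℂ f₁)
    (c : CSpace m) : Measurable (sphereDiff f₀ f₁ c) :=
  measurable_lintegral_sphere (measurable_logQuot_diff_left h₀ h₁ c)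

/-- In polar coordinates the shell estimate bounds integrals over radii. The factor `‖c‖ / τ` and
the width of the shell, a multiple of `τ`, cancel, so the bound does not involve the width. -/
theorem exists_lintegral_sphereDiff_le (hm : 0 < m) (h₀ : Differentiable ℂ f₀)
    (h₁ : Differentiable ℂ f₁) (h₀0 : f₀ 0 ≠ 0) (h₁0 : f₁ 0 ≠ 0) (c : CSpace m) :
    ∃ C L : ℝ, 0 < C ∧ ∀ a b : ℝ, 0 < a → L ≤ b - a → b ≤ 2 * a →
      ∫⁻ r in Icc a b, sphereDiff f₀ f₁ c r ≤
        ENNReal.ofReal (C * (2 * maxMean f₀ f₁ (2 * b - a) - log ‖f₀ 0‖ - log ‖f₁ 0‖)) := by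
  have := isProbabilityMeasure_unitSphereMeasure hm
  obtain ⟨C, hC, hS⟩ := exists_lintegral_shell_diff_le m
  set n := Module.finrank ℝ (CSpace m) - 1 with hn
  set ρ := ‖c‖ + 1 with hρ
  have hρ0 : 0 < ρ := by positivity
  refine ⟨C * (60 * ρ) * 3 ^ n, 40 * ρ, by positivity, fun a b ha hL hb => ?_⟩
  -- with this choice the enlarged shell is `2 a - b ≤ ‖z‖ ≤ 2 b - a`
  set τ := (b - a) / 20 with hτ
  have hτ2 : 2 * ρ ≤ τ := by rw [hτ]; linarith
  have hτ0 : 0 < τ := by linarith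
  have hab : a ≤ b := by linarith
  have h := hS f₀ f₁ h₀ h₁ h₀0 h₁0 hm c a b ρ τ hρ0 (by rw [hρ]; linarith) hτ2 (by linarith)
  have e1 : a - 20 * τ = 2 * a - b := by rw [hτ]; ring
  have e2 : b + 20 * τ = 2 * b - a := by rw [hτ]; ring
  rw [e1, e2] at h
  set K := 2 * maxMean f₀ f₁ (2 * b - a) - log ‖f₀ 0‖ - log ‖f₁ 0‖ with hK
  set σ := sphereArea m with hσ
  have hσ0 : σ ≠ 0 := sphereArea_ne_zero hm
  have hσt : σ ≠ ⊤ := sphereArea_ne_top m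
  have hpolar : ∀ {G : CSpace m → ENNReal}, Measurable G → ∀ a' b' : ℝ,
      ∫⁻ z in shell m a' b', G z = σ * ∫⁻ r in Ioi (0 : ℝ) ∩ Icc a' b',
        ENNReal.ofReal (r ^ n) *
          ∫⁻ ξ : Metric.sphere (0 : CSpace m) 1, G (r • (ξ : CSpace m)) ∂unitSphereMeasure m := by
    intro G hG a' b'
    rw [← lintegral_indicator (measurableSet_shell a' b'),
      lintegral_polar hm (hG.indicator (measurableSet_shell a' b')), inter_comm,
      ← Measure.restrict_restrict measurableSet_Icc, ← lintegral_indicator measurableSet_Icc]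
    congr 1
    refine setLIntegral_congr_fun measurableSet_Ioi fun r hr => ?_
    have hr0 : (0 : ℝ) ≤ r := le_of_lt hr
    by_cases hrm : r ∈ Icc a' b'
    · rw [indicator_of_mem hrm]
      congr 1
      refine lintegral_congr fun ξ => ?_
      rw [indicator_of_mem]
      rw [shell, mem_ofPred_eq, norm_real_smul_sphere hr0]
      exact hrm
    · rw [indicator_of_notMem hrm]
      rw [lintegral_congr (g := fun _ => 0) fun ξ => ?_]
      · simp
      rw [indicator_of_notMem]
      rw [shell, mem_ofPred_eq, norm_real_smul_sphere hr0]
      exact hrm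
  -- the shell integral dominates the integral over radii
  have lower : σ * (ENNReal.ofReal (a ^ n) * ∫⁻ r in Icc a b, sphereDiff f₀ f₁ c r) ≤
      ∫⁻ z in shell m a b, ENNReal.ofReal |logQuot f₀ f₁ (z + c) - logQuot f₀ f₁ z| := by
    rw [hpolar (measurable_logQuot_diff_left h₀ h₁ c),
      inter_eq_right.2 (fun r (hr : r ∈ Icc a b) => mem_Ioi.2 (ha.trans_le hr.1)),
      ← lintegral_const_mul' _ _ ENNReal.ofReal_ne_top]
    gcongr 1
    refine setLIntegral_mono' measurableSet_Icc fun r hr => ?_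
    unfold sphereDiff
    gcongr
    exact hr.1
  have upper : volume (shell m (2 * a - b) (2 * b - a)) ≤
      σ * ENNReal.ofReal ((3 * a) ^ n * (60 * τ)) := by
    rw [← setLIntegral_one, hpolar measurable_const]
    gcongr 1
    calc _ ≤ ∫⁻ _r in Icc (2 * a - b) (2 * b - a), ENNReal.ofReal ((3 * a) ^ n) := by
          refine (setLIntegral_mono' (measurableSet_Ioi.inter measurableSet_Icc)
            (g := fun _ => ENNReal.ofReal ((3 * a) ^ n)) fun r hr => ?_).trans
            (lintegral_mono_set inter_subset_right)
          have h1 : (0 : ℝ) < r := hr.1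
          have h2 : r ≤ 3 * a := hr.2.2.trans (by linarith)
          simp only [lintegral_const, measure_univ, mul_one]
          gcongr
      _ = _ := by
          rw [setLIntegral_const, Real.volume_Icc, ← ENNReal.ofReal_mul (by positivity)]
          congr 2
          rw [hτ]; ring
  have hpos : σ * ENNReal.ofReal (a ^ n) ≠ 0 := by
    refine mul_ne_zero hσ0 ?_
    rw [Ne, ENNReal.ofReal_eq_zero, not_le]; positivity
  refine (ENNReal.mul_le_mul_iff_right hpos (ENNReal.mul_ne_top hσt ENNReal.ofReal_ne_top)).1 ?_
  calc _ = σ * (ENNReal.ofReal (a ^ n) * ∫⁻ r in Icc a b, sphereDiff f₀ f₁ c r) := mul_assoc _ _ _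
    _ ≤ _ := lower
    _ ≤ _ := h
    _ ≤ ENNReal.ofReal (C * (ρ / τ)) * (σ * ENNReal.ofReal ((3 * a) ^ n * (60 * τ)) *
        ENNReal.ofReal K) := by gcongr
    _ = σ * (ENNReal.ofReal (C * (ρ / τ)) * ENNReal.ofReal ((3 * a) ^ n * (60 * τ)) *
        ENNReal.ofReal K) := by ring
    _ = σ * ENNReal.ofReal (a ^ n) * ENNReal.ofReal (C * (60 * ρ) * 3 ^ n * K) := by
        rw [mul_assoc σ, ← ENNReal.ofReal_mul (by positivity), ← ENNReal.ofReal_mul (by positivity),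
          ← ENNReal.ofReal_mul (by positivity)]
        congr 2
        rw [mul_pow]
        field_simp

end ShellEstimate

/-! ### A growth lemma of Borel type -/

section Growth

/-- Summation by parts: the increments of a sequence of growth `k ^ θ` with `θ < 1` are summable
against `1 / k`. -/
theorem summable_sub_div_of_le_rpow {b : ℕ → ℝ} {C θ : ℝ} (hb : Monotone b) (hb0 : ∀ k, 0 ≤ b k)
    (hbC : ∀ k, b k ≤ C * ((k : ℝ) + 1) ^ θ) (hθ : θ < 1) :
    Summable fun k : ℕ => (b (k + 1) - b k) / ((k : ℝ) + 1) := by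
  have hC : 0 ≤ C := by simpa using (hb0 0).trans (hbC 0)
  have hp : Summable fun k : ℕ => 2 * C * ((k : ℝ) + 2) ^ (θ - 2) := by
    refine Summable.mul_left _ ?_
    have h1 := (summable_nat_add_iff 2).2 (Real.summable_nat_rpow.2 (by linarith : θ - 2 < -1))
    simpa using h1
  refine summable_of_sum_range_le (c := C + ∑' k : ℕ, 2 * C * ((k : ℝ) + 2) ^ (θ - 2)) (fun k => ?_)
    fun N => ?_
  · exact div_nonneg (sub_nonneg.2 (hb (Nat.le_succ k))) (by positivity)
  have e : ∀ k : ℕ, (b (k + 1) - b k) / ((k : ℝ) + 1) =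
      (b (k + 1) / (((k + 1 : ℕ) : ℝ) + 1) - b k / ((k : ℝ) + 1)) +
        b (k + 1) / (((k : ℝ) + 1) * ((k : ℝ) + 2)) := by
    intro k
    push_cast
    field_simp
    ring
  simp_rw [e]
  rw [Finset.sum_add_distrib, Finset.sum_range_sub fun k : ℕ => b k / ((k : ℝ) + 1)]
  have h1 : b N / ((N : ℝ) + 1) ≤ C := by
    rw [div_le_iff₀ (by positivity)]
    refine (hbC N).trans (mul_le_mul_of_nonneg_left ?_ hC)
    calc ((N : ℝ) + 1) ^ θ ≤ ((N : ℝ) + 1) ^ (1 : ℝ) :=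
          rpow_le_rpow_of_exponent_le (by linarith [Nat.cast_nonneg (α := ℝ) N]) hθ.le
      _ = _ := rpow_one _
  have h2 : 0 ≤ b 0 / (((0 : ℕ) : ℝ) + 1) := div_nonneg (hb0 0) (by positivity)
  have h3 : ∑ k ∈ Finset.range N, b (k + 1) / (((k : ℝ) + 1) * ((k : ℝ) + 2)) ≤
      ∑' k : ℕ, 2 * C * ((k : ℝ) + 2) ^ (θ - 2) := by
    refine (Finset.sum_le_sum fun k _ => ?_).trans
      (hp.sum_le_tsum _ fun k _ => by positivity)
    rw [div_le_iff₀ (by positivity)]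
    have h4 := hbC (k + 1)
    push_cast at h4
    have e2 : (k : ℝ) + 1 + 1 = k + 2 := by ring
    rw [e2] at h4
    have e3 : ((k : ℝ) + 2) ^ θ = ((k : ℝ) + 2) ^ (θ - 2) * ((k : ℝ) + 2) ^ 2 := by
      rw [← rpow_natCast, ← rpow_add (by positivity)]
      congr 1; push_cast; ring
    rw [e3] at h4
    refine h4.trans ?_
    have h5 : 0 ≤ C * ((k : ℝ) + 2) ^ (θ - 2) * ((k : ℝ) + 2) := by positivity
    nlinarith [Nat.cast_nonneg (α := ℝ) k, mul_nonneg h5 (Nat.cast_nonneg (α := ℝ) k)]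
  linarith

theorem rpow_succ_le {p : ℝ} (hp : 1 ≤ p) {k : ℕ} (hk : 1 ≤ k) :
    ((k : ℝ) + 1) ^ p ≤ (k : ℝ) ^ p * (1 + 2 ^ p / k) := by
  have hk0 : (0 : ℝ) < k := by exact_mod_cast hk
  have hk1 : (1 : ℝ) ≤ k := by exact_mod_cast hk
  have h := (convexOn_rpow hp).2 (show (1 : ℝ) ∈ Ici 0 by simp) (show (2 : ℝ) ∈ Ici 0 by simp)
    (sub_nonneg.2 ((div_le_one hk0).2 hk1)) (by positivity : 0 ≤ 1 / (k : ℝ)) (by ring)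
  simp only [smul_eq_mul, one_rpow, mul_one] at h
  have e : (k : ℝ) + 1 = k * (1 - 1 / (k : ℝ) + 1 / (k : ℝ) * 2) := by field_simp; ring
  rw [e, mul_rpow hk0.le (by
    have : 0 ≤ 1 - 1 / (k : ℝ) := sub_nonneg.2 ((div_le_one hk0).2 hk1)
    positivity)]
  refine mul_le_mul_of_nonneg_left (h.trans ?_) (by positivity)
  have : 0 ≤ 1 / (k : ℝ) := by positivity
  have e2 : 1 / (k : ℝ) * 2 ^ p = 2 ^ p / k := by ring
  linarith

theorem le_rpow_succ {p : ℝ} (hp : 1 ≤ p) {k : ℕ} (hk : 1 ≤ k) :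
    (k : ℝ) ^ p + p * (k : ℝ) ^ (p - 1) ≤ ((k : ℝ) + 1) ^ p := by
  have hk0 : (0 : ℝ) < k := by exact_mod_cast hk
  have h := one_add_mul_self_le_rpow_one_add (s := 1 / (k : ℝ)) (p := p)
    (by linarith [show 0 < 1 / (k : ℝ) by positivity]) hp
  have e : (k : ℝ) + 1 = k * (1 + 1 / (k : ℝ)) := by field_simp
  rw [e, mul_rpow hk0.le (by positivity)]
  refine le_trans (le_of_eq ?_) (mul_le_mul_of_nonneg_left h (by positivity))
  rw [rpow_sub_one hk0.ne']
  field_simp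

theorem two_mul_rpow_succ_sub_le {p : ℝ} (hp : 1 ≤ p) (k : ℕ) :
    2 * ((k : ℝ) + 1) ^ p - (k : ℝ) ^ p ≤ ((k : ℝ) + 2) ^ p := by
  have h := (convexOn_rpow hp).2 (show (k : ℝ) ∈ Ici 0 by simp)
    (show (k : ℝ) + 2 ∈ Ici 0 from mem_Ici.2 (by positivity))
    (show (0 : ℝ) ≤ 1 / 2 by norm_num) (show (0 : ℝ) ≤ 1 / 2 by norm_num) (by norm_num)
  simp only [smul_eq_mul] at h
  have e : 1 / 2 * (k : ℝ) + 1 / 2 * (k + 2) = k + 1 := by ring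
  rw [e] at h
  linarith

/-- A growth lemma of Borel type. If `log B` grows slower than `r ^ γ` and the integral of `D` over
an interval is at most the value of `B` slightly to the right of it, then `D` is smaller than `B` by
a power `r ^ δ` with `δ < 1 - γ`, outside of a set of finite logarithmic measure. On the intervals
`[k ^ (1 / γ), (k + 1) ^ (1 / γ)]` either `B` grows by a bounded factor, and Chebyshev's inequality
applies, or `log B` increases by at least `1`, which is rare. -/
theorem exists_finiteLogMeasure_of_lintegral_le {D : ℝ → ENNReal} {B : ℝ → ℝ} (hD : Measurable D)
    (hB : Monotone B) (hB1 : ∀ᶠ r in atTop, 1 ≤ B r) {σ γ δ C R L : ℝ}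
    (hgr : ∀ᶠ r in atTop, log (B r) ≤ r ^ σ) (hσ : 0 ≤ σ) (hσγ : σ < γ) (hγ : γ < 1) (hδ : 0 ≤ δ)
    (hδγ : δ < 1 - γ) (hC : 0 ≤ C)
    (hint : ∀ a b, R ≤ a → L ≤ b - a → b ≤ 2 * a →
      ∫⁻ r in Icc a b, D r ≤ ENNReal.ofReal (C * B (2 * b - a))) :
    ∃ E, FiniteLogMeasure E ∧ ∀ r, 1 ≤ r → r ∉ E → D r ≤ ENNReal.ofReal (B r * r ^ (-δ)) := by
  have hγ0 : 0 < γ := hσ.trans_lt hσγ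
  set p := 1 / γ with hp
  have hp1 : 1 < p := (one_lt_div hγ0).2 hγ
  have hp0 : 0 < p := by linarith
  have hnat : Tendsto (fun k : ℕ => (k : ℝ)) atTop atTop := tendsto_natCast_atTop_atTop
  have hkp : Tendsto (fun k : ℕ => (k : ℝ) ^ p) atTop atTop := (tendsto_rpow_atTop hp0).comp hnat
  have hkp1 : Tendsto (fun k : ℕ => p * (k : ℝ) ^ (p - 1)) atTop atTop :=
    Tendsto.const_mul_atTop hp0 ((tendsto_rpow_atTop (by linarith)).comp hnat)
  obtain ⟨k₀, hk₀⟩ := eventually_atTop.1 ((hkp.eventually hB1).and ((hkp.eventually hgr).and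
    ((hkp.eventually_ge_atTop R).and ((hkp1.eventually_ge_atTop L).and
      ((hnat.eventually_ge_atTop (2 ^ p)).and (eventually_ge_atTop 1))))))
  have hk₀1 : 1 ≤ k₀ := (hk₀ k₀ le_rfl).2.2.2.2.2
  set r : ℕ → ℝ := fun j => ((k₀ + j : ℕ) : ℝ) ^ p with hr
  have hkpos : ∀ j : ℕ, (0 : ℝ) < ((k₀ + j : ℕ) : ℝ) := fun j => by exact_mod_cast (by omega)
  have hkj : ∀ j : ℕ, (j : ℝ) + 1 ≤ ((k₀ + j : ℕ) : ℝ) := fun j => by exact_mod_cast (by omega)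
  have hrpos : ∀ j, 0 < r j := fun j => rpow_pos_of_pos (hkpos j) _
  have hr1 : ∀ j, r (j + 1) = (((k₀ + j : ℕ) : ℝ) + 1) ^ p := fun j => by
    simp only [hr]; congr 1; push_cast; ring
  have hr2 : ∀ j, r (j + 2) = (((k₀ + j : ℕ) : ℝ) + 2) ^ p := fun j => by
    simp only [hr]; congr 1; push_cast; ring
  have hrs : ∀ j, r j ≤ r (j + 1) := fun j => by
    rw [hr1]; exact rpow_le_rpow (hkpos j).le (by linarith) hp0.le
  have hquot : ∀ j, r (j + 1) ≤ r j * (1 + 2 ^ p / ((k₀ + j : ℕ) : ℝ)) := fun j => by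
    rw [hr1]; exact rpow_succ_le hp1.le (by omega)
  have hdouble : ∀ j, r (j + 1) ≤ 2 * r j := fun j => by
    have h1 : 2 ^ p / ((k₀ + j : ℕ) : ℝ) ≤ 1 :=
      (div_le_one (hkpos j)).2 (hk₀ (k₀ + j) (by omega)).2.2.2.2.1
    have := mul_le_mul_of_nonneg_left (add_le_add_right h1 1) (hrpos j).le
    linarith [hquot j]
  have hBr : ∀ j, 1 ≤ B (r j) := fun j => (hk₀ (k₀ + j) (by omega)).1
  have hintj : ∀ j, ∫⁻ t in Icc (r j) (r (j + 1)), D t ≤ ENNReal.ofReal (C * B (r (j + 2))) := by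
    intro j
    have h1 := le_rpow_succ hp1.le (k := k₀ + j) (by omega)
    have h2 := (hk₀ (k₀ + j) (by omega)).2.2.2.1
    refine (hint _ _ (hk₀ (k₀ + j) (by omega)).2.2.1 ?_ (hdouble j)).trans
      (ENNReal.ofReal_le_ofReal (mul_le_mul_of_nonneg_left (hB ?_) hC))
    · rw [hr1]; linarith
    · rw [hr1, hr2]; exact two_mul_rpow_succ_sub_le hp1.le _
  set b : ℕ → ℝ := fun j => log (B (r j)) + log (B (r (j + 1))) with hb
  have hlogmono : ∀ j, log (B (r j)) ≤ log (B (r (j + 1))) := fun j =>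
    log_le_log (by linarith [hBr j]) (hB (hrs j))
  have hbmono : Monotone b := monotone_nat_of_le_succ fun j =>
    add_le_add (hlogmono j) (hlogmono (j + 1))
  have hθ : p * σ < 1 := by rw [hp, one_div_mul_eq_div]; exact (div_lt_one hγ0).2 hσγ
  have hθ0 : 0 ≤ p * σ := by positivity
  have hbsum : Summable fun j : ℕ => (b (j + 1) - b j) / ((j : ℝ) + 1) := by
    refine summable_sub_div_of_le_rpow (C := 2 * ((k₀ : ℝ) + 1) ^ (p * σ)) hbmono
      (fun j => add_nonneg (log_nonneg (hBr j)) (log_nonneg (hBr _))) (fun j => ?_) hθ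
    have h1 := (hk₀ (k₀ + (j + 1)) (by omega)).2.1
    rw [← rpow_mul (hkpos (j + 1)).le] at h1
    have h2 : (((k₀ + (j + 1) : ℕ) : ℝ)) ^ (p * σ) ≤
        (((k₀ : ℝ) + 1) * ((j : ℝ) + 1)) ^ (p * σ) := by
      refine rpow_le_rpow (hkpos (j + 1)).le ?_ hθ0
      push_cast
      nlinarith [Nat.cast_nonneg (α := ℝ) j, Nat.cast_nonneg (α := ℝ) k₀,
        mul_nonneg (Nat.cast_nonneg (α := ℝ) j) (Nat.cast_nonneg (α := ℝ) k₀)]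
    rw [mul_rpow (by positivity) (by positivity)] at h2
    have h3 : log (B (r (j + 1))) ≤ ((k₀ : ℝ) + 1) ^ (p * σ) * ((j : ℝ) + 1) ^ (p * σ) :=
      h1.trans h2
    simp only [hb]
    linarith [hlogmono j]
  have hs : 1 < p * (1 - δ) := by
    rw [hp, one_div_mul_eq_div, one_lt_div hγ0]; linarith
  have hpsum : Summable fun j : ℕ => ((j : ℝ) + 1) ^ (-(p * (1 - δ))) := by
    have h1 := (summable_nat_add_iff 1).2 (Real.summable_nat_rpow.2 (by linarith :
      -(p * (1 - δ)) < -1))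
    simpa using h1
  set Bad : Set ℝ := {t | ENNReal.ofReal (B t * t ^ (-δ)) < D t} with hBad
  have hBadm : MeasurableSet Bad := by
    refine measurableSet_lt ?_ hD
    have := hB.measurable
    fun_prop
  set C₁ := C * exp 1 * 2 ^ δ + 2 ^ p with hC₁
  have hpiece : ∀ j, ∫⁻ t in Bad ∩ Icc (r j) (r (j + 1)), ENNReal.ofReal (1 / t) ≤
      ENNReal.ofReal (C₁ * (((j : ℝ) + 1) ^ (-(p * (1 - δ))) +
        (b (j + 1) - b j) / ((j : ℝ) + 1))) := by
    intro j
    have hrj := hrpos j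
    have hbj : 0 ≤ (b (j + 1) - b j) / ((j : ℝ) + 1) :=
      div_nonneg (sub_nonneg.2 (hbmono (Nat.le_succ j))) (by positivity)
    have hpj : 0 ≤ ((j : ℝ) + 1) ^ (-(p * (1 - δ))) := by positivity
    have hC2 : 0 ≤ C * exp 1 * 2 ^ δ := by positivity
    have hC3 : 0 ≤ (2 : ℝ) ^ p := by positivity
    have hinv : ∀ {S : Set ℝ}, MeasurableSet S → S ⊆ Icc (r j) (r (j + 1)) →
        ∫⁻ t in S, ENNReal.ofReal (1 / t) ≤ ENNReal.ofReal (1 / r j) * volume S := by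
      intro S hSm hS
      rw [← setLIntegral_const]
      refine setLIntegral_mono' hSm fun t ht => ENNReal.ofReal_le_ofReal ?_
      exact one_div_le_one_div_of_le hrj (hS ht).1
    have hIm : MeasurableSet (Bad ∩ Icc (r j) (r (j + 1))) := hBadm.inter measurableSet_Icc
    -- bounded growth: Chebyshev's inequality; otherwise the logarithmic length of the interval is
    -- charged to the increase of `log B`
    by_cases hq : B (r (j + 2)) ≤ exp 1 * B (r j)
    · set β := B (r j) * r (j + 1) ^ (-δ) with hβ
      have hβ0 : 0 < β := mul_pos (by linarith [hBr j]) (rpow_pos_of_pos (hrpos _) _)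
      have hcheb : ENNReal.ofReal β * volume (Bad ∩ Icc (r j) (r (j + 1))) ≤
          ENNReal.ofReal (C * B (r (j + 2))) := by
        rw [← setLIntegral_const]
        refine le_trans ?_ (hintj j)
        refine (setLIntegral_mono' hIm (g := D) fun t ht => ?_).trans
          (lintegral_mono_set inter_subset_right)
        refine le_trans (ENNReal.ofReal_le_ofReal ?_) (le_of_lt ht.1)
        have ht0 : 0 < t := hrj.trans_le ht.2.1
        refine mul_le_mul (hB ht.2.1) ?_ (rpow_nonneg (hrpos _).le _)
          (by linarith [hBr j, hB ht.2.1])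
        exact rpow_le_rpow_of_nonpos ht0 ht.2.2 (by linarith)
      have hvol : volume (Bad ∩ Icc (r j) (r (j + 1))) ≤
          ENNReal.ofReal (C * B (r (j + 2)) / β) := by
        rw [ENNReal.ofReal_div_of_pos hβ0, ENNReal.le_div_iff_mul_le
          (Or.inl (by rw [Ne, ENNReal.ofReal_eq_zero, not_le]; exact hβ0))
          (Or.inl ENNReal.ofReal_ne_top), mul_comm]
        exact hcheb
      refine (hinv hIm inter_subset_right).trans ?_
      refine (mul_le_mul_right hvol _).trans ?_
      rw [← ENNReal.ofReal_mul (by positivity)]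
      refine ENNReal.ofReal_le_ofReal ?_
      have h1 : C * B (r (j + 2)) / β ≤ C * exp 1 * r (j + 1) ^ δ := by
        rw [div_le_iff₀ hβ0, hβ]
        have e : C * exp 1 * r (j + 1) ^ δ * (B (r j) * r (j + 1) ^ (-δ)) =
            C * (exp 1 * B (r j)) * (r (j + 1) ^ δ * r (j + 1) ^ (-δ)) := by ring
        rw [e, ← rpow_add (hrpos _), add_neg_cancel, rpow_zero, mul_one]
        exact mul_le_mul_of_nonneg_left hq hC
      have h2 : r (j + 1) ^ δ ≤ 2 ^ δ * r j ^ δ := by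
        rw [← mul_rpow (by norm_num) hrj.le]
        exact rpow_le_rpow (hrpos _).le (hdouble j) hδ
      have h3 : r j ^ δ / r j ≤ ((j : ℝ) + 1) ^ (-(p * (1 - δ))) := by
        rw [← rpow_sub_one hrj.ne']
        have e : r j ^ (δ - 1) = ((k₀ + j : ℕ) : ℝ) ^ (-(p * (1 - δ))) := by
          simp only [hr]
          rw [← rpow_mul (hkpos j).le]
          congr 1; ring
        rw [e]
        exact rpow_le_rpow_of_nonpos (by positivity) (hkj j) (by linarith)
      calc 1 / r j * (C * B (r (j + 2)) / β) ≤ 1 / r j * (C * exp 1 * (2 ^ δ * r j ^ δ)) := by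
            refine mul_le_mul_of_nonneg_left (h1.trans ?_) (by positivity)
            exact mul_le_mul_of_nonneg_left h2 (by positivity)
        _ = C * exp 1 * 2 ^ δ * (r j ^ δ / r j) := by ring
        _ ≤ C * exp 1 * 2 ^ δ * ((j : ℝ) + 1) ^ (-(p * (1 - δ))) :=
            mul_le_mul_of_nonneg_left h3 hC2
        _ ≤ _ := by
            rw [hC₁, add_mul, mul_add]
            have := mul_nonneg hC2 hbj
            have := mul_nonneg hC3 (add_nonneg hpj hbj)
            linarith
    · rw [not_le] at hq
      have hlog : 1 ≤ b (j + 1) - b j := by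
        have h1 := log_le_log (by have := hBr j; positivity) hq.le
        rw [log_mul (exp_pos _).ne' (by linarith [hBr j]), log_exp] at h1
        simp only [hb]
        linarith
      refine (lintegral_mono_set inter_subset_right).trans
        ((hinv measurableSet_Icc subset_rfl).trans ?_)
      rw [Real.volume_Icc, ← ENNReal.ofReal_mul (by positivity)]
      refine ENNReal.ofReal_le_ofReal ?_
      calc 1 / r j * (r (j + 1) - r j) ≤ 1 / r j * (r j * (2 ^ p / ((k₀ + j : ℕ) : ℝ))) := by
            refine mul_le_mul_of_nonneg_left ?_ (by positivity)
            linarith [hquot j]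
        _ = 2 ^ p / ((k₀ + j : ℕ) : ℝ) := by field_simp
        _ ≤ 2 ^ p / ((j : ℝ) + 1) := by
            have := hkj j
            gcongr
        _ ≤ 2 ^ p * ((b (j + 1) - b j) / ((j : ℝ) + 1)) := by
            rw [← mul_div_assoc]
            gcongr
            linarith [mul_le_mul_of_nonneg_left hlog hC3]
        _ ≤ _ := by
            rw [hC₁, add_mul, mul_add ((2 : ℝ) ^ p)]
            have := mul_nonneg hC3 hpj
            have := mul_nonneg hC2 (add_nonneg hpj hbj)
            linarith
  refine ⟨Icc 1 (r 0) ∪ (Bad ∩ Ici (r 0)), ⟨measurableSet_Icc.union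
    (hBadm.inter measurableSet_Ici), ?_, ?_⟩, fun t ht htE => ?_⟩
  · have h1 : 1 ≤ r 0 := one_le_rpow (by exact_mod_cast (by omega)) hp0.le
    rintro t (ht | ht)
    · exact ht.1
    · exact h1.trans ht.2
  · have hcover : Bad ∩ Ici (r 0) ⊆ ⋃ j, Bad ∩ Icc (r j) (r (j + 1)) := by
      rintro t ⟨htB, ht⟩
      have ht0 : 0 < t := (hrpos 0).trans_le ht
      have hinvp : (t ^ γ) ^ p = t := by
        rw [← rpow_mul ht0.le, hp, mul_one_div_cancel hγ0.ne', rpow_one]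
      have hfl := Nat.floor_le (rpow_nonneg ht0.le γ)
      have hfl2 := Nat.lt_floor_add_one (t ^ γ)
      have hk : k₀ ≤ ⌊t ^ γ⌋₊ := by
        refine Nat.le_floor ?_
        have h1 : (k₀ : ℝ) ^ p ≤ (t ^ γ) ^ p := by rw [hinvp]; simpa [hr] using ht
        exact (rpow_le_rpow_iff (by positivity) (by positivity) hp0).1 h1
      refine mem_iUnion.2 ⟨⌊t ^ γ⌋₊ - k₀, htB, ?_, ?_⟩
      · simp only [hr]
        rw [Nat.add_sub_cancel' hk]
        calc _ ≤ (t ^ γ) ^ p := rpow_le_rpow (by positivity) hfl hp0.le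
          _ = t := hinvp
      · rw [hr1, Nat.add_sub_cancel' hk]
        calc t = (t ^ γ) ^ p := hinvp.symm
          _ ≤ _ := rpow_le_rpow (by positivity) hfl2.le hp0.le
    refine (lintegral_union_le _ _ _).trans_lt (ENNReal.add_lt_top.2 ⟨?_, ?_⟩)
    · refine lt_of_le_of_lt (setLIntegral_mono' measurableSet_Icc
        (g := fun _ => ENNReal.ofReal 1) fun t ht => ENNReal.ofReal_le_ofReal ?_) ?_
      · exact (div_le_one (zero_lt_one.trans_le ht.1)).2 ht.1
      · rw [setLIntegral_const]
        exact ENNReal.mul_lt_top ENNReal.ofReal_lt_top measure_Icc_lt_top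
    · refine ((lintegral_mono_set hcover).trans (lintegral_iUnion_le _ _)).trans_lt ?_
      exact (ENNReal.tsum_le_tsum hpiece).trans_lt
        ((hpsum.add hbsum).mul_left C₁).tsum_ofReal_lt_top
  · by_contra hcon
    rw [not_le] at hcon
    refine htE ?_
    by_cases h : t ≤ r 0
    · exact Or.inl ⟨ht, h⟩
    · exact Or.inr ⟨hcon, (not_le.1 h).le⟩

end Growth

/-! ### The proximity function of the difference quotient -/

section Proximity

variable {m : ℕ} {f₀ f₁ f : CSpace m → ℂ}

theorem sphereIntegrable_logQuot_diff (hm : 0 < m) (h₀ : Differentiable ℂ f₀)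
    (h₁ : Differentiable ℂ f₁) (h₀0 : f₀ 0 ≠ 0) (h₁0 : f₁ 0 ≠ 0) (c : CSpace m) {r : ℝ}
    (hr : 0 < r) : SphereIntegrable (fun z => logQuot f₀ f₁ (z + c) - logQuot f₀ f₁ z) r := by
  have i0 := Entire.sphereIntegrable_log_norm hm h₀ h₀0 hr
  have i1 := Entire.sphereIntegrable_log_norm hm h₁ h₁0 hr
  have j0 := Entire.sphereIntegrable_log_norm hm (F := fun z => f₀ (z + c)) (z₀ := -c)
    (by fun_prop) (by simpa using h₀0) hr
  have j1 := Entire.sphereIntegrable_log_norm hm (F := fun z => f₁ (z + c)) (z₀ := -c)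
    (by fun_prop) (by simpa using h₁0) hr
  exact (j1.sub j0).sub (i1.sub i0)

theorem ae_posLog_norm_div_eq (hm : 0 < m) (h₀ : Differentiable ℂ f₀) (h₁ : Differentiable ℂ f₁)
    (h₀0 : f₀ 0 ≠ 0) (h₁0 : f₁ 0 ≠ 0) (hf : ∀ z, f₀ z ≠ 0 → f z = f₁ z / f₀ z) (c : CSpace m)
    {r : ℝ} (hr : 0 < r) :
    (fun ξ : Metric.sphere (0 : CSpace m) 1 =>
      max 0 (logQuot f₀ f₁ (r • (ξ : CSpace m) + c) - logQuot f₀ f₁ (r • (ξ : CSpace m))))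
      =ᵐ[unitSphereMeasure m] fun ξ =>
        posLog ‖f (r • (ξ : CSpace m) + c) / f (r • (ξ : CSpace m))‖ := by
  filter_upwards [Entire.ae_sphere_ne_zero hm h₀ h₀0 hr.ne',
    Entire.ae_sphere_ne_zero hm h₁ h₁0 hr.ne',
    Entire.ae_sphere_ne_zero hm (F := fun z => f₀ (z + c)) (z₀ := -c) (by fun_prop)
      (by simpa using h₀0) hr.ne',
    Entire.ae_sphere_ne_zero hm (F := fun z => f₁ (z + c)) (z₀ := -c) (by fun_prop)
      (by simpa using h₁0) hr.ne'] with ξ a0 a1 b0 b1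
  rw [hf _ a0, hf _ b0, posLog, norm_div, norm_div, norm_div, log_div, log_div, log_div]
  · rfl
  all_goals simp [a0, a1, b0, b1]

theorem sphereIntegrable_posLog_norm_div (hm : 0 < m) (h₀ : Differentiable ℂ f₀)
    (h₁ : Differentiable ℂ f₁) (h₀0 : f₀ 0 ≠ 0) (h₁0 : f₁ 0 ≠ 0)
    (hf : ∀ z, f₀ z ≠ 0 → f z = f₁ z / f₀ z) (c : CSpace m) {r : ℝ} (hr : 0 < r) :
    SphereIntegrable (fun z => posLog ‖f (z + c) / f z‖) r := by
  have := isProbabilityMeasure_unitSphereMeasure hm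
  have h := sphereIntegrable_logQuot_diff hm h₀ h₁ h₀0 h₁0 c hr
  exact ((integrable_const (0 : ℝ)).sup h).congr
    (ae_posLog_norm_div_eq hm h₀ h₁ h₀0 h₁0 hf c hr)

theorem ofReal_proximityFn_le_sphereDiff (hm : 0 < m) (h₀ : Differentiable ℂ f₀)
    (h₁ : Differentiable ℂ f₁) (h₀0 : f₀ 0 ≠ 0) (h₁0 : f₁ 0 ≠ 0)
    (hf : ∀ z, f₀ z ≠ 0 → f z = f₁ z / f₀ z) (c : CSpace m) {r : ℝ} (hr : 0 < r) :
    ENNReal.ofReal (proximityFn (fun z => f (z + c) / f z) r) ≤ sphereDiff f₀ f₁ c r := by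
  have := isProbabilityMeasure_unitSphereMeasure hm
  have h := sphereIntegrable_logQuot_diff hm h₀ h₁ h₀0 h₁0 c hr
  unfold proximityFn sphereIntegral sphereDiff
  rw [← integral_congr_ae (ae_posLog_norm_div_eq hm h₀ h₁ h₀0 h₁0 hf c hr),
    ofReal_integral_eq_lintegral_ofReal (f := fun ξ : Metric.sphere (0 : CSpace m) 1 =>
      max 0 (logQuot f₀ f₁ (r • (ξ : CSpace m) + c) - logQuot f₀ f₁ (r • (ξ : CSpace m))))
      ((integrable_const (0 : ℝ)).sup h) (ae_of_all _ fun _ => le_max_left _ _)]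
  refine lintegral_mono fun ξ => ENNReal.ofReal_le_ofReal ?_
  exact max_le (abs_nonneg _) (le_abs_self _)

theorem hyperOrder_nonneg (f₀ f₁ : CSpace m → ℂ) : 0 ≤ hyperOrder f₀ f₁ := by
  by_contra hcon
  rw [not_le] at hcon
  obtain ⟨r, h1, h2⟩ := ((eventually_lt_of_limsup_lt hcon).and (eventually_gt_atTop 1)).exists
  have h3 : posLog (posLog (characteristicFn f₀ f₁ r)) / log r < 0 := by exact_mod_cast h1
  exact absurd (div_nonneg posLog_nonneg (log_pos h2).le) (not_le.2 h3)

theorem eventually_log_characteristicFn_le {f₀ f₁ : CSpace m → ℂ} {σ : ℝ}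
    (h : hyperOrder f₀ f₁ < (σ : EReal)) :
    ∀ᶠ r in atTop, log (characteristicFn f₀ f₁ r) ≤ r ^ σ := by
  filter_upwards [eventually_lt_of_limsup_lt h, eventually_gt_atTop 1] with r h1 hr
  have hr0 : 0 < r := zero_lt_one.trans hr
  have h2 : posLog (posLog (characteristicFn f₀ f₁ r)) / log r < σ := by exact_mod_cast h1
  rw [div_lt_iff₀ (log_pos hr)] at h2
  have h3 : log (characteristicFn f₀ f₁ r) ≤ posLog (characteristicFn f₀ f₁ r) := le_max_right _ _
  refine h3.trans ?_
  by_cases h0 : posLog (characteristicFn f₀ f₁ r) ≤ 0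
  · exact h0.trans (rpow_nonneg hr0.le _)
  rw [not_le] at h0
  have h4 : log (posLog (characteristicFn f₀ f₁ r)) ≤ σ * log r := (le_max_right _ _).trans h2.le
  rw [rpow_def_of_pos hr0, mul_comm]
  exact (log_le_iff_le_exp h0).1 h4

theorem tendsto_maxMean_atTop (hm : 0 < m) (h₀ : Differentiable ℂ f₀)
    (h₁ : Differentiable ℂ f₁) (h₀0 : f₀ 0 ≠ 0) (h₁0 : f₁ 0 ≠ 0)
    (hnc : ∀ a : ℂ, ∃ z, f₁ z ≠ a * f₀ z) : Tendsto (maxMean f₀ f₁) atTop atTop := by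
  obtain ⟨C, hC⟩ := exists_log_sub_le_maxMean hm h₀ h₁ h₀0 h₁0 hnc
  refine tendsto_atTop_mono' atTop ?_ (tendsto_atTop_add_const_right atTop (-C) tendsto_log_atTop)
  filter_upwards [eventually_ge_atTop 1] with r hr
  exact hC r hr

/-- The growth lemma applied to the spherical means of `log |f₁ / f₀ (z + c)| - log |f₁ / f₀ (z)|`.
The exponents `ζ < ζ + η / 8 < ζ + η / 4 < ζ + η / 2 < ζ + 3 η / 4` leave room for the passage from
the upper limit to an inequality, from the characteristic function to `maxMean`, and for the two
strict inequalities in the growth lemma. -/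
theorem exists_finiteLogMeasure_proximityFn_le (hm : 0 < m) (h₀ : Differentiable ℂ f₀)
    (h₁ : Differentiable ℂ f₁) (h₀0 : f₀ 0 ≠ 0) (h₁0 : f₁ 0 ≠ 0)
    (hf : ∀ z, f₀ z ≠ 0 → f z = f₁ z / f₀ z) (hnc : ∀ a : ℂ, ∃ z, f₁ z ≠ a * f₀ z)
    (c : CSpace m) {ζ η : ℝ} (hζ : hyperOrder f₀ f₁ = (ζ : EReal)) (hη : 0 < η) (hη1 : η ≤ 1 - ζ) :
    ∃ E : Set ℝ, FiniteLogMeasure E ∧ ∀ᶠ r in atTop, r ∉ E →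
      0 < characteristicFn f₀ f₁ r ∧ proximityFn (fun z => f (z + c) / f z) r ≤
        2 * characteristicFn f₀ f₁ r * r ^ (-(1 - ζ - 3 * η / 4)) := by
  have hζ0 : 0 ≤ ζ := by
    have := hyperOrder_nonneg f₀ f₁
    rw [hζ] at this
    exact_mod_cast this
  set B : ℝ → ℝ := fun r => maxMean f₀ f₁ (max r 1) with hBdef
  have hBmono : Monotone B := fun x y hxy =>
    maxMean_mono hm h₀ h₁ h₀0 h₁0 (by positivity) (max_le_max_right 1 hxy)
  have hBeq : ∀ r, 1 ≤ r → B r = maxMean f₀ f₁ r := fun r hr => by simp only [hBdef, max_eq_left hr]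
  have hBtop : Tendsto B atTop atTop := by
    refine (tendsto_maxMean_atTop hm h₀ h₁ h₀0 h₁0 hnc).congr' ?_
    filter_upwards [eventually_ge_atTop 1] with r hr
    exact (hBeq r hr).symm
  obtain ⟨K, hK⟩ := exists_abs_characteristicFn_sub_maxMean_le hm h₀ h₁ h₀0 h₁0
  have hTB : ∀ᶠ r in atTop, 0 < characteristicFn f₀ f₁ r ∧ B r ≤ 2 * characteristicFn f₀ f₁ r := by
    filter_upwards [eventually_ge_atTop 1, hBtop.eventually_ge_atTop (2 * K + 1)] with r hr hBr
    have h1 := abs_le.1 (hK r (by linarith))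
    rw [← hBeq r hr] at h1
    have h2 : 0 ≤ K := (abs_nonneg _).trans (hK r (by linarith))
    exact ⟨by linarith [h1.1], by linarith [h1.1]⟩
  have hgr : ∀ᶠ r in atTop, log (B r) ≤ r ^ (ζ + η / 4) := by
    have h1 : hyperOrder f₀ f₁ < ((ζ + η / 8 : ℝ) : EReal) := by
      rw [hζ]; exact_mod_cast (by linarith)
    filter_upwards [eventually_log_characteristicFn_le h1, hTB, eventually_gt_atTop 0,
      hBtop.eventually_ge_atTop 1,
      (tendsto_rpow_atTop (by linarith : 0 < η / 8)).eventually_ge_atTop 2,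
      (tendsto_rpow_atTop (by linarith : 0 < ζ + η / 8)).eventually_ge_atTop (log 2)]
      with r hT hTBr hr hBr h2 h3
    have h4 := log_le_log (by linarith) hTBr.2
    rw [log_mul two_ne_zero hTBr.1.ne'] at h4
    have e : r ^ (ζ + η / 4) = r ^ (ζ + η / 8) * r ^ (η / 8) := by
      rw [← rpow_add hr]; congr 1; ring
    rw [e]
    have h5 : 0 ≤ r ^ (ζ + η / 8) := rpow_nonneg hr.le _
    nlinarith
  obtain ⟨C, L, hC, hint⟩ := exists_lintegral_sphereDiff_le hm h₀ h₁ h₀0 h₁0 c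
  obtain ⟨R, hR⟩ := eventually_atTop.1
    (hBtop.eventually_ge_atTop (-log ‖f₀ 0‖ - log ‖f₁ 0‖))
  obtain ⟨E, hE, hEb⟩ := exists_finiteLogMeasure_of_lintegral_le
    (D := sphereDiff f₀ f₁ c) (B := B) (σ := ζ + η / 4) (γ := ζ + η / 2) (δ := 1 - ζ - 3 * η / 4)
    (C := C * 3) (R := max R 1) (L := max L 0)
    (measurable_sphereDiff h₀ h₁ c) hBmono (hBtop.eventually_ge_atTop 1) hgr (by linarith)
    (by linarith) (by linarith) (by linarith) (by linarith) (by positivity)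
    (fun a b ha hb hab => by
      have ha1 : 1 ≤ a := (le_max_right _ _).trans ha
      have hb0 : 0 ≤ b - a := (le_max_right _ _).trans hb
      refine (hint a b (by linarith) ((le_max_left _ _).trans hb) hab).trans
        (ENNReal.ofReal_le_ofReal ?_)
      have h1 := hR (2 * b - a) ((le_max_left _ _).trans (ha.trans (by linarith)))
      rw [hBeq _ (by linarith)] at h1 ⊢
      rw [mul_assoc]
      exact mul_le_mul_of_nonneg_left (by linarith) hC.le)
  refine ⟨E, hE, ?_⟩
  filter_upwards [hTB, eventually_ge_atTop 1, hBtop.eventually_ge_atTop 0] with r hT hr hBr hrE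
  have hr0 : 0 < r := zero_lt_one.trans_le hr
  have hpow : 0 ≤ r ^ (-(1 - ζ - 3 * η / 4)) := rpow_nonneg hr0.le _
  refine ⟨hT.1, ?_⟩
  have h1 := (ofReal_proximityFn_le_sphereDiff hm h₀ h₁ h₀0 h₁0 hf c hr0).trans (hEb r hr hrE)
  rw [ENNReal.ofReal_le_ofReal_iff (mul_nonneg hBr hpow)] at h1
  exact h1.trans (mul_le_mul_of_nonneg_right hT.2 hpow)

end Proximity

theorem mainTheorem5 (m : ℕ) (f f₀ f₁ : CSpace m → ℂ)
    (hf : IsReducedRepresentation f₀ f₁ f)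
    (hnonconst : ∀ a : ℂ, ∃ z, f₀ z ≠ 0 ∧ f z ≠ a)
    (h0_ne_zero : f 0 ≠ 0) (h0_ne_infty : f₀ 0 ≠ 0)
    (ζ : ℝ) (hζ : hyperOrder f₀ f₁ = (ζ : EReal)) (hζ_lt : ζ < 1)
    (ε : ℝ) (hε : 0 < ε) (c : CSpace m) :
    (∀ r : ℝ, 0 < r → SphereIntegrable (fun z => Real.posLog ‖f (z + c) / f z‖) r) ∧
    ∃ E : Set ℝ, FiniteLogMeasure E ∧
      Asymptotics.IsLittleO (Filter.atTop ⊓ Filter.principal Eᶜ)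
        (fun r : ℝ => proximityFn (fun z => f (z + c) / f z) r)
        (fun r : ℝ => characteristicFn f₀ f₁ r / r ^ (1 - ζ - ε)) := by
  have hm : 0 < m := by
    rcases Nat.eq_zero_or_pos m with rfl | h
    · obtain ⟨z, _, hz⟩ := hnonconst (f 0)
      exact absurd (congrArg f (Subsingleton.elim z 0)) hz
    · exact h
  have h₀ := hf.entire_den
  have h₁ := hf.entire_num
  have h₁0 : f₁ 0 ≠ 0 := by
    intro h
    rw [hf.eq_div 0 h0_ne_infty, h, zero_div] at h0_ne_zero
    exact h0_ne_zero rfl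
  have hnc : ∀ a : ℂ, ∃ z, f₁ z ≠ a * f₀ z := by
    intro a
    obtain ⟨z, hz0, hz⟩ := hnonconst a
    exact ⟨z, fun h => hz (by rw [hf.eq_div z hz0, h, mul_div_cancel_right₀ _ hz0])⟩
  refine ⟨fun r hr => sphereIntegrable_posLog_norm_div hm h₀ h₁ h0_ne_infty h₁0 hf.eq_div c hr, ?_⟩
  set η := min ε (1 - ζ) with hη
  have hη0 : 0 < η := lt_min hε (by linarith)
  have hηε : η ≤ ε := min_le_left _ _
  obtain ⟨E, hE, hEb⟩ := exists_finiteLogMeasure_proximityFn_le hm h₀ h₁ h0_ne_infty h₁0 hf.eq_div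
    hnc c hζ hη0 (min_le_right _ _)
  refine ⟨E, hE, Asymptotics.IsLittleO.of_bound fun e he => ?_⟩
  rw [eventually_inf_principal]
  -- the exponents of `r` differ by `ε - 3 η / 4 > 0`
  have hlim := (tendsto_rpow_neg_atTop (by linarith : 0 < ε - 3 * η / 4)).eventually_le_const
    (by positivity : 0 < e / 2)
  filter_upwards [hEb, hlim, eventually_gt_atTop 0] with r hr hpow hr0 hrE
  obtain ⟨hT, hprox⟩ := hr hrE
  have hnn : 0 ≤ proximityFn (fun z => f (z + c) / f z) r :=
    integral_nonneg fun _ => posLog_nonneg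
  have hq : 0 < r ^ (1 - ζ - ε) := rpow_pos_of_pos hr0 _
  rw [norm_of_nonneg hnn, norm_of_nonneg (div_nonneg hT.le hq.le)]
  have e1 : r ^ (-(1 - ζ - 3 * η / 4)) = r ^ (-(ε - 3 * η / 4)) / r ^ (1 - ζ - ε) := by
    rw [← rpow_sub hr0]; congr 1; ring
  rw [e1] at hprox
  refine hprox.trans ?_
  calc _ = 2 * r ^ (-(ε - 3 * η / 4)) * (characteristicFn f₀ f₁ r / r ^ (1 - ζ - ε)) := by ring
    _ ≤ _ := mul_le_mul_of_nonneg_right (by linarith) (div_nonneg hT.le hq.le)
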